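/- **Setting.** Let $g\in\mathbb N$, $r\in\mathbb N_0$, and let $E_0,\dots,E_N\in\mathbb C$ be distinct, with $N=2g$ (KdV, sGmKdV) or $N=2g+1$ (AKNS, Toda). Let $R(z)=\prod_{m=0}^N(z-E_m)$, and let $\mathcal K_g$ be the compact Riemann surface of genus $g$ of $y^2=R(z)$. Fix a homology basis $\{a_j,b_j\}_{j=1}^g$, a base point $P_0\in\mathcal K_g$, and the holomorphic differentials $d\omega_k=\sum_{\ell=1}^g c_{k,\ell}\,z^{\ell-1}dz/y$ normalized by $\int_{a_j}d\omega_k=\delta_{jk}$. Let $L_g\subset\mathbb C^g$ be the period lattice of $(d\omega_1,\dots,d\omega_g)$, and let $\underline A_{P_0}(P)=(\int_{P_0}^P d\omega_k)_{k=1}^g\in J(\mathcal K_g)=\mathbb C^g/L_g$ be the Abel map. Put $\underline\alpha(Q_1,\dots,Q_g)=\sum_{j}\underline A_{P_0}(Q_j)$. For $\underline\mu\in\mathbb C^g$ let $\Phi^{(j)}_k(\underline\mu)$ be $(-1)^k$ times the $k$-th elementary symmetric function of the $\mu_\ell$, $\ell\ne j$, let $\Pi_j(\underline\mu)=\prod_{\ell\neq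 j}(\mu_j-\mu_\ell)$, and let $c_k(\underline E)$ be the coefficient of $z^{-k}$ in $\prod_m(1-E_m/z)^{-1/2}$. Let $c_\ell,\tilde c_\ell\in\mathbb C$ be two independent sets of integration constants ($c_0=\tilde c_0=1$), and put $d_{r,k}=\sum_{s=0}^{r-k}\tilde c_s\,c_{r-k-s}(\underline E)$ for $0\le k\le r$, $d_{r,k}=0$ for $k>r$. Variables: $(x,t)\in\Omega$, where $\Omega\subseteq\mathbb R^2$ is open and connected (for Toda, $n\in\mathbb Z$ and $t$ in an open interval $I$). All functions of $x$ are smooth in $x$. Quantities with a tilde are built like those without, with $\tilde c_\ell$ for $c_\ell$ and $r$ for $g$. "Stationary" refers to every fixed $t$. * **KdV.** Let $f_0=1$, $f_{j,x}=-\frac14f_{j-1,xxx}+Vf_{j-1,x}+\frac12V_xf_{j-1}$; the $f_j$ are the differential polynomials in $V$ whose constant term is $c_j$. Let $F_r(z)=\sum_{j=0}^r f_{r-j}z^j$. Let $V(\cdot,t)$ be a stationary solution $f_{g+1,x}=0$ with $\frac12F_{g,xx}F_g-\frac14F_{g,x}^2-(V-z)F_g^2=R(z)$, and let $F_g=\prod_j(z-\mu_j)$.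 Dubrovin equations: $\mu_{j,x}=-2iy_j/\Pi_j(\underline\mu)$ and $\mu_{j,t}=-2i\,y_j\,\widetilde F_r(\mu_j)/\Pi_j(\underline\mu)$. * **AKNS.** Let $f_0=-iq$, $g_0=1$, $h_0=ip$, $f_{\ell+1}=\frac i2f_{\ell,x}-iqg_{\ell+1}$, $g_{\ell+1,x}=pf_\ell+qh_\ell$, $h_{\ell+1}=-\frac i2h_{\ell,x}+ipg_{\ell+1}$; these are differential polynomials in $p,q$, and $g_\ell$ has constant term $c_\ell$. Let $F_r=\sum_{\ell=0}^r f_{r-\ell}z^\ell$, $H_r=\sum_{\ell=0}^r h_{r-\ell}z^\ell$, $G_{r+1}=\sum_{\ell=0}^{r+1}g_{r+1-\ell}z^\ell$. Let $(p,q)(\cdot,t)$ be a stationary solution $f_{g+1}=h_{g+1}=0$ with $G_{g+1}^2-F_gH_g=R(z)$. Where $q\neq0$ on $\Omega$, let $F_g=-iq\prod_j(z-\mu_j)$; where $p\ne0$ on $\Omega$, let $H_g=ip\prod_j(z-\nu_j)$. Dubrovin equations: $\mu_{j,x}=-2iy_j/\Pi_j(\underline\mu)$, $\mu_{j,t}=2y_j\widetilde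 F_r(\mu_j)/(q\,\Pi_j(\underline\mu))$, and $\nu_{j,x}=-2iy_j/\Pi_j(\underline\nu)$, $\nu_{j,t}=-2y_j\widetilde H_r(\nu_j)/(p\,\Pi_j(\underline\nu))$. * **Toda.** With $h^\pm(n)=h(n\pm1)$, let $f_0=1$, $g_0=-c_1$, $2f_{j+1}+g_j+g_j^-+2bf_j=0$, $g_{j+1}-g_{j+1}^-+2(a^2f_j^+-(a^-)^2f_j^-)+b(g_j-g_j^-)=0$; these are polynomials in the shifts of $a,b$, and $f_j$ has constant term $c_j$. Let $F_r=\sum_{j=0}^r f_{r-j}z^j$, $G_{r+1}=-z^{r+1}+\sum_{j=0}^r g_{r-j}z^j+f_{r+1}$. Let $(a,b)(\cdot,t)$ be a stationary solution, $g_g^++g_g+f_{g+1}^++f_{g+1}+2b^+f_g^+=0$ and $b(g_g+f_{g+1})+a^2f_g^+-(a^-)^2f_g^-+b^2f_g=0$, with $G_{g+1}^2-4a^2F_gF_g^+=R(z)$, for all $n$. Fix $n$ and let $F_g(\cdot,n,t)=\prod_j(z-\mu_j(t))$. Dubrovin equations: $\mu_{j,t}=2y_j\widetilde F_r(\mu_j)/\Pi_j(\underline\mu)$.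 * **sGmKdV.** Let $E_0=0$, $w_\pm=-\frac14(u_x^2\pm2iu_{xx})$, let $f_j$, $h_j$ be the KdV coefficients above with $V$ replaced by $w_+$, $w_-$ respectively, and, for $\alpha,\beta,\tilde\alpha,\tilde\beta\in\mathbb C$, let $F_g=\alpha e^{-iu}+\sum_{j=0}^{g-1}f_jz^{g-j}$, $H_g=\beta e^{iu}+\sum_{j=0}^{g-1}h_jz^{g-j}$, $G_{g-1}=\sum_{j=0}^{g-1}\frac i2(f_{j,x}+iu_xf_j)z^{g-1-j}$, and $\widetilde F_r=\tilde\alpha e^{-iu}+\sum_{j=0}^{r-1}\tilde f_jz^{r-j}$, $\widetilde H_r=\tilde\beta e^{iu}+\sum_{j=0}^{r-1}\tilde h_jz^{r-j}$. Let $u(\cdot,t)$ be a stationary solution, $-2iG_{g-1,x}-2(H_g-F_g)=0$, $F_{g,x}=-iu_xF_g-2izG_{g-1}$, $H_{g,x}=iu_xH_g+2izG_{g-1}$, with $z^2G_{g-1}^2+zF_gH_g=R(z)$. Let $F_g=\prod_j(z-\mu_j)$, $H_g=\prod_j(z-\nu_j)$. Dubrovin equations: $\mu_{j,x}=-2iy_j/\Pi_j(\underline\mu)$,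 $\mu_{j,t}=2y_j\widetilde F_r(\mu_j)/(\mu_j\Pi_j(\underline\mu))$, and the same for $\nu_j$ with $\widetilde H_r(\nu_j)/\nu_j$. Here $\hat\mu_j=(\mu_j,y_j)\in\mathcal K_g$, $y_j^2=R(\mu_j)$ (and similarly $\hat\nu_j=(\nu_j,y_j)$), and a Dubrovin equation $\mu_j'=v_jy_j$ is an equation on $\mathcal K_g$: the point $\hat\mu_j$ moves with $\mu_j'=v_jy_j$, $y_j'=\frac12v_jR'(\mu_j)$ (the second equation follows from the first unless $\hat\mu_j$ is a branch point, where $y$ is the local coordinate). **Corollary.** Suppose that, in one of these cases, the points $\hat\mu_j$ (respectively $\hat\nu_j$), $j=1,\dots,g$, satisfy the Dubrovin equations and $\mu_j\ne\mu_{j'}$ (respectively $\nu_j\neq\nu_{j'}$) for $j\ne j'$ throughout. Then: 1. $\widetilde F_r(\mu_j)=\sum_{k=0}^{\min(r,g)}d_{r,k}\Phi^{(j)}_k(\underline\mu)$ for KdV and Toda; $\widetilde F_r(\mu_j)=-iq\sum_{k=0}^{\min(r,g)}d_{r,k}\Phi^{(j)}_k(\underline\mu)$ and $\widetilde H_r(\nu_j)=ip\sum_{k=0}^{\min(r,g)}d_{r,k}\Phi^{(j)}_k(\underline\nu)$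 for AKNS; $\widetilde F_r(\mu_j)/\mu_j=\sum_{k=0}^{g-1}D_k\Phi_k^{(j)}(\underline\mu)$ for sGmKdV, where $D_k=d_{r-1,k}-\frac{\tilde\alpha}{\alpha}\delta_{k,g-1}$ (with $d_{-1,k}=0$), and $\widetilde H_r(\nu_j)/\nu_j=\sum_{k=0}^{g-1}D_k\Phi_k^{(j)}(\underline\nu)$ with $\tilde\beta/\beta$ in place of $\tilde\alpha/\alpha$. 2. Put $A_k=-2i\,c_{k,g}$, and $B_k=-2i\sum_{\ell=1}^g c_{k,\ell}d_{r,g-\ell}$ for KdV and AKNS (both divisors), $B_k=2\sum_{\ell=1}^g c_{k,\ell}d_{r,g-\ell}$ for Toda, $B_k=2\sum_{\ell=1}^g c_{k,\ell}D_{g-\ell}$ for sGmKdV (with the respective $D_k$). If the integrals are continued along the flow, then, for $k=1,\dots,g$, $$\frac{\partial}{\partial t}\sum_{j=1}^g\int_{P_0}^{\hat\mu_j(x,t)}d\omega_k=B_k,\qquad \frac{\partial}{\partial x}\sum_{j=1}^g\int_{P_0}^{\hat\mu_j(x,t)}d\omega_k=A_k$$ (only the first for Toda). 3. For all $(x_0,t_0),(x,t)\in\Omega$,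 in $J(\mathcal K_g)$, $$\underline\alpha(\underline{\hat\mu}(x,t))=\underline\alpha(\underline{\hat\mu}(x_0,t_0))+(x-x_0)\underline A+(t-t_0)\underline B,$$ and for Toda $\underline\alpha(\underline{\hat\mu}(n,t))=\underline\alpha(\underline{\hat\mu}(n,t_0))+(t-t_0)\underline B$. The statements 2 and 3 hold likewise for $\underline{\hat\nu}$ in the AKNS and sGmKdV cases. -/

import Mathlib

open scoped ContDiff

/-! ## Hyperelliptic curves, abelian integrals and the Abel map -/

/-- `R(z) = ∏ (z - E_m)`. -/
noncomputable def curvePoly {n : ℕ} (E : Fin n → ℂ) (z : ℂ) : ℂ := ∏ m, (z - E m)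

/-- The homogenization of `R` of degree `2g + 2`. -/
noncomputable def homCurvePoly (g : ℕ) {n : ℕ} (E : Fin n → ℂ) (Z W : ℂ) : ℂ :=
  W ^ (2 * g + 2 - n) * ∏ m, (Z - E m * W)

/-- Homogeneous coordinates `(Z, W, Y)` of weights `(1, 1, g + 1)`
for a point of the compactified curve `y² = R(z)`, with `z = Z / W` and `y = Y / W ^ (g + 1)`. -/
structure HomPoint (g : ℕ) {n : ℕ} (E : Fin n → ℂ) where
  Z : ℂ
  W : ℂ
  Y : ℂ
  nonzero : ¬(Z = 0 ∧ W = 0)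
  eqn : Y ^ 2 = homCurvePoly g E Z W

/-- Two homogeneous coordinate triples give the same point if they differ by the weighted
action of `ℂˣ`. -/
def HomPoint.Same {g n : ℕ} {E : Fin n → ℂ} (p q : HomPoint g E) : Prop :=
  ∃ s : ℂ, s ≠ 0 ∧ q.Z = s * p.Z ∧ q.W = s * p.W ∧ q.Y = s ^ (g + 1) * p.Y

theorem HomPoint.same_equivalence {g n : ℕ} {E : Fin n → ℂ} :
    Equivalence (HomPoint.Same (g := g) (E := E)) where
  refl p := ⟨1, one_ne_zero, by simp, by simp, by simp⟩
  symm := by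
    rintro p q ⟨s, hs, h1, h2, h3⟩
    refine ⟨s⁻¹, inv_ne_zero hs, ?_, ?_, ?_⟩
    · rw [h1]; field_simp
    · rw [h2]; field_simp
    · rw [h3, ← mul_assoc, ← mul_pow, inv_mul_cancel₀ hs, one_pow, one_mul]
  trans := by
    rintro p q w ⟨s, hs, h1, h2, h3⟩ ⟨t, ht, k1, k2, k3⟩
    refine ⟨t * s, mul_ne_zero ht hs, ?_, ?_, ?_⟩
    · rw [k1, h1]; ring
    · rw [k2, h2]; ring
    · rw [k3, h3]; ring

/-- Equality of points, as a setoid on homogeneous coordinates. -/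
def homPointSetoid (g : ℕ) {n : ℕ} (E : Fin n → ℂ) : Setoid (HomPoint g E) :=
  ⟨HomPoint.Same, HomPoint.same_equivalence⟩

/-- The compactified hyperelliptic curve `y² = R(z)`: for `n = 2g + 1` it has one point
with `W = 0`, for `n = 2g + 2` it has two. -/
def HyperellipticCurve (g : ℕ) {n : ℕ} (E : Fin n → ℂ) : Type :=
  Quotient (homPointSetoid g E)

/-- The finite point `(z, y)` of the curve. -/
def finitePoint (g : ℕ) {n : ℕ} (E : Fin n → ℂ) (z y : ℂ) (h : y ^ 2 = curvePoly E z) :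
    HyperellipticCurve g E :=
  Quotient.mk (homPointSetoid g E)
    ⟨z, 1, y, by simp, by simpa [homCurvePoly, curvePoly] using h⟩

/-- A `C¹` path on the curve, parametrized by `[0, 1]` and written in homogeneous coordinates. -/
structure CurvePath (g : ℕ) {n : ℕ} (E : Fin n → ℂ) where
  Z : ℝ → ℂ
  W : ℝ → ℂ
  Y : ℝ → ℂ
  smooth_Z : ContDiffOn ℝ 1 Z (Set.Icc 0 1)
  smooth_W : ContDiffOn ℝ 1 W (Set.Icc 0 1)
  smooth_Y : ContDiffOn ℝ 1 Y (Set.Icc 0 1)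
  nonzero : ∀ s ∈ Set.Icc (0 : ℝ) 1, ¬(Z s = 0 ∧ W s = 0)
  eqn : ∀ s ∈ Set.Icc (0 : ℝ) 1, Y s ^ 2 = homCurvePoly g E (Z s) (W s)

/-- The starting point of a path. -/
def CurvePath.source {g n : ℕ} {E : Fin n → ℂ} (γ : CurvePath g E) : HyperellipticCurve g E :=
  Quotient.mk (homPointSetoid g E)
    ⟨γ.Z 0, γ.W 0, γ.Y 0, γ.nonzero 0 (by simp), γ.eqn 0 (by simp)⟩

/-- The end point of a path. -/
def CurvePath.target {g n : ℕ} {E : Fin n → ℂ} (γ : CurvePath g E) : HyperellipticCurve g E :=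
  Quotient.mk (homPointSetoid g E)
    ⟨γ.Z 1, γ.W 1, γ.Y 1, γ.nonzero 1 (by simp), γ.eqn 1 (by simp)⟩

/-- The pullback of the holomorphic differential `z ^ ℓ dz / y` (`ℓ = 0, …, g - 1`) along a
path `s ↦ (Z s : W s : Y s)`, as a density in `s`. With `z = Z / W`, `y = Y / W ^ (g + 1)` one
has `z ^ ℓ dz / y = Z ^ ℓ W ^ (g - 1 - ℓ) (W dZ - Z dW) / Y`, also at the points at infinity.
Where `Y = 0` the quotient is read as `0`; for a `C¹` path this alters the true pullback
at most at isolated parameters, since both vanish at a limit of zeros of `Y`. -/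
noncomputable def formDensity (g : ℕ) (l : Fin g) (Z W Y : ℝ → ℂ) (s : ℝ) : ℂ :=
  Z s ^ (l : ℕ) * W s ^ (g - 1 - (l : ℕ)) * (deriv Z s * W s - Z s * deriv W s) / Y s

/-- The integral of `z ^ ℓ dz / y` along a path. -/
noncomputable def CurvePath.integral {g n : ℕ} {E : Fin n → ℂ} (γ : CurvePath g E)
    (l : Fin g) : ℂ :=
  ∫ s in (0 : ℝ)..1, formDensity g l γ.Z γ.W γ.Y s

/-- Closed paths `a_1, …, a_g, b_1, …, b_g` that form a basis of the first homology of the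
curve. Here closed paths are homologous iff every holomorphic differential has the same
integral over both (first homology is torsion free and is separated by these periods). -/
structure IsHomologyBasis {g n : ℕ} {E : Fin n → ℂ} (a b : Fin g → CurvePath g E) : Prop where
  closed_a : ∀ j, (a j).source = (a j).target
  closed_b : ∀ j, (b j).source = (b j).target
  basis : ∀ γ : CurvePath g E, γ.source = γ.target →
    ∃! k : (Fin g → ℤ) × (Fin g → ℤ), ∀ l : Fin g,
      γ.integral l = ∑ j, (k.1 j : ℂ) * (a j).integral l + ∑ j, (k.2 j : ℂ) * (b j).integral l

/-- A nonsingular hyperelliptic curve together with a homology basis, the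
holomorphic differentials `dω_j = ∑_ℓ c_{j,ℓ} z ^ ℓ dz / y` normalized by `∫_{a_k} dω_j = δ_{jk}`,
and a base point. -/
structure MarkedCurve (g n : ℕ) where
  E : Fin n → ℂ
  E_injective : Function.Injective E
  a : Fin g → CurvePath g E
  b : Fin g → CurvePath g E
  isBasis : IsHomologyBasis a b
  c : Matrix (Fin g) (Fin g) ℂ
  normalized : ∀ j k, ∑ l, c j l * (a k).integral l = if j = k then 1 else 0
  P₀ : HyperellipticCurve g E

namespace MarkedCurve

/-- `∫_γ dω_k`. -/
noncomputable def abelianIntegral {g n : ℕ} (C : MarkedCurve g n) (γ : CurvePath g C.E)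
    (k : Fin g) : ℂ :=
  ∑ l, C.c k l * γ.integral l

/-- `τ_{j,k} = ∫_{b_j} dω_k`. -/
noncomputable def tau {g n : ℕ} (C : MarkedCurve g n) (j k : Fin g) : ℂ :=
  C.abelianIntegral (C.b j) k

/-- The period lattice of `dω_1, …, dω_g`: the integer combinations of the
period vectors `(δ_{jk})_k` and `(τ_{j,k})_k` of the cycles `a_j` and `b_j`. -/
noncomputable def periodLattice {g n : ℕ} (C : MarkedCurve g n) : AddSubgroup (Fin g → ℂ) where
  carrier := {v | ∃ p q : Fin g → ℤ, ∀ k, v k = (p k : ℂ) + ∑ j, (q j : ℂ) * C.tau j k}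
  zero_mem' := ⟨0, 0, by simp⟩
  add_mem' := by
    rintro v w ⟨p, q, h⟩ ⟨p', q', h'⟩
    refine ⟨p + p', q + q', fun k => ?_⟩
    simp only [Pi.add_apply, h k, h' k, Int.cast_add, add_mul, Finset.sum_add_distrib]
    ring
  neg_mem' := by
    rintro v ⟨p, q, h⟩
    refine ⟨-p, -q, fun k => ?_⟩
    simp only [Pi.neg_apply, h k, Int.cast_neg, neg_mul, Finset.sum_neg_distrib]
    ring

/-- The Jacobi variety. -/
abbrev Jacobian {g n : ℕ} (C : MarkedCurve g n) : Type := (Fin g → ℂ) ⧸ C.periodLattice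

open Classical in
/-- The Abel map `P ↦ (∫_{P₀}^P dω_1, …, ∫_{P₀}^P dω_g)` modulo the period lattice. -/
noncomputable def abelMap {g n : ℕ} (C : MarkedCurve g n) (P : HyperellipticCurve g C.E) :
    C.Jacobian :=
  if h : ∃ γ : CurvePath g C.E, γ.source = C.P₀ ∧ γ.target = P then
    QuotientAddGroup.mk (C.abelianIntegral h.choose)
  else 0

/-- The pullback of `dω_k` along a moving finite point `s ↦ (μ s, y s)` of the curve. -/
noncomputable def omegaDensity {g n : ℕ} (C : MarkedCurve g n) (k : Fin g) (μ y : ℝ → ℂ)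
    (s : ℝ) : ℂ :=
  ∑ l, C.c k l * formDensity g l μ (fun _ => 1) y s

end MarkedCurve

/-! ## Symmetric functions -/

/-- The coefficient of `z ^ (-k)` in `(∏ (1 - E_m / z)) ^ (-1/2)`. -/
noncomputable def cCoeff {n : ℕ} (E : Fin n → ℂ) (k : ℕ) : ℂ :=
  ∑ j ∈ Finset.piAntidiag (Finset.univ : Finset (Fin n)) k,
    ∏ m, ((Nat.doubleFactorial (2 * j m - 1) : ℂ) / (2 ^ (j m) * (Nat.factorial (j m) : ℂ))
      * E m ^ (j m))

/-- `Φ_k^{(j)}(μ)`: `(-1) ^ k` times the `k`-th elementary symmetric function of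
the `μ_ℓ` with `ℓ ≠ j`. -/
noncomputable def Phi {g : ℕ} (k : ℕ) (j : Fin g) (μ : Fin g → ℂ) : ℂ :=
  (-1) ^ k * ∑ s ∈ Finset.powersetCard k (Finset.univ.erase j), ∏ i ∈ s, μ i

/-- `∏_{ℓ ≠ j} (μ_j - μ_ℓ)`. -/
noncomputable def diffProd {g : ℕ} (μ : Fin g → ℂ) (j : Fin g) : ℂ :=
  ∏ l ∈ Finset.univ.erase j, (μ j - μ l)

/-- The constants `d_{r,k} = ∑_{s=0}^{r-k} c̃_s c_{r-k-s}(E)` for `k ≤ r`, and `0` for `k > r`. -/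
noncomputable def dCoeff {n : ℕ} (E : Fin n → ℂ) (ct : ℕ → ℂ) (r k : ℕ) : ℂ :=
  if k ≤ r then ∑ s ∈ Finset.range (r - k + 1), ct s * cCoeff E (r - k - s) else 0

/-- The constants for the combined sine-Gordon and mKdV hierarchy, where `ρ = α̃ / α` (or
`β̃ / β`): `d_{r-1,k}` (absent for `r = 0`), with `ρ` subtracted for `k = g - 1`. -/
noncomputable def sgCoeff {n : ℕ} (E : Fin n → ℂ) (ct : ℕ → ℂ) (ρ : ℂ) (g r k : ℕ) : ℂ :=
  (if 1 ≤ r then dCoeff E ct (r - 1) k else 0) - (if k + 1 = g then ρ else 0)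

/-! ## Flows of divisors and their linearization -/

/-- The point `(μ, y)` moves on the curve `y² = R(z)` with velocity `dz / y = v` at time `s`.
Since `dz / y = 2 dy / R'(z)`, this is `μ' = v y` and `y' = v R'(μ) / 2`. The second equation
follows from the first where `y ≠ 0`; at a branch point it is the equation in
the local coordinate `y`. -/
def MovesAt {n : ℕ} (E : Fin n → ℂ) (μ y : ℝ → ℂ) (v : ℂ) (s : ℝ) : Prop :=
  HasDerivAt μ (v * y s) s ∧ HasDerivAt y (v * deriv (curvePoly E) (μ s) / 2) s

/-- The points `(μ_j, y_j)`, `j = 1, …, g`, lie on the curve for all parameters in `Ω`. -/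
def OnCurve {g n : ℕ} (E : Fin n → ℂ) (Ω : Set (ℝ × ℝ)) (μ y : Fin g → ℝ → ℝ → ℂ) : Prop :=
  ∀ x t, (x, t) ∈ Ω → ∀ j, y j x t ^ 2 = curvePoly E (μ j x t)

/-- One-parameter version of `OnCurve`. -/
def OnCurveOne {g n : ℕ} (E : Fin n → ℂ) (J : Set ℝ) (μ y : Fin g → ℝ → ℂ) : Prop :=
  ∀ t ∈ J, ∀ j, y j t ^ 2 = curvePoly E (μ j t)

/-- The first equations of the Dubrovin systems in `x`:
`∂_x μ_j = -2 i y_j / ∏_{ℓ ≠ j} (μ_j - μ_ℓ)`, on the curve. -/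
def DubrovinX {g n : ℕ} (E : Fin n → ℂ) (Ω : Set (ℝ × ℝ)) (μ y : Fin g → ℝ → ℝ → ℂ) : Prop :=
  ∀ x t, (x, t) ∈ Ω → ∀ j,
    MovesAt E (fun x' => μ j x' t) (fun x' => y j x' t)
      (-2 * Complex.I / diffProd (fun l => μ l x t) j) x

/-- The Dubrovin equations in `t`: `∂_t μ_j = y_j v_j / ∏_{ℓ ≠ j} (μ_j - μ_ℓ)`, on the
curve, where the factor `v_j` depends on the hierarchy. -/
def DubrovinT {g n : ℕ} (E : Fin n → ℂ) (Ω : Set (ℝ × ℝ)) (μ y v : Fin g → ℝ → ℝ → ℂ) : Prop :=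
  ∀ x t, (x, t) ∈ Ω → ∀ j,
    MovesAt E (fun t' => μ j x t') (fun t' => y j x t')
      (v j x t / diffProd (fun l => μ l x t) j) t

/-- The Abel map linearizes the two-parameter motion of the divisor of the points
`(μ_j, y_j)`, with constant velocities `A` in `x` and `B` in `t`. -/
structure Linearizes {g n : ℕ} (C : MarkedCurve g n) (Ω : Set (ℝ × ℝ))
    (μ y : Fin g → ℝ → ℝ → ℂ) (hy : OnCurve C.E Ω μ y) (A B : Fin g → ℂ) : Prop where
  /-- `∂_x ∑_j ∫^{(μ_j, y_j)} dω_k = A_k`, the integral being continued along the flow. -/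
  deriv_x : ∀ k x₀ x t, (∀ s ∈ Set.uIcc x₀ x, (s, t) ∈ Ω) →
    HasDerivAt (fun ξ => ∑ j, ∫ s in x₀..ξ,
      C.omegaDensity k (fun x' => μ j x' t) (fun x' => y j x' t) s) (A k) x
  /-- `∂_t ∑_j ∫^{(μ_j, y_j)} dω_k = B_k`, the integral being continued along the flow. -/
  deriv_t : ∀ k x t₀ t, (∀ s ∈ Set.uIcc t₀ t, (x, s) ∈ Ω) →
    HasDerivAt (fun θ => ∑ j, ∫ s in t₀..θ,
      C.omegaDensity k (fun t' => μ j x t') (fun t' => y j x t') s) (B k) t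
  /-- The image of the divisor in the Jacobi variety is linear in `x` and `t`. -/
  abel : ∀ x₀ t₀ x t (h₀ : (x₀, t₀) ∈ Ω) (h : (x, t) ∈ Ω),
    ∑ j, C.abelMap (finitePoint g C.E (μ j x t) (y j x t) (hy x t h j)) =
      ∑ j, C.abelMap (finitePoint g C.E (μ j x₀ t₀) (y j x₀ t₀) (hy x₀ t₀ h₀ j)) +
        (QuotientAddGroup.mk (fun k => ((x - x₀ : ℝ) : ℂ) * A k + ((t - t₀ : ℝ) : ℂ) * B k) :
          C.Jacobian)

/-- One-parameter version of `Linearizes`. -/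
structure LinearizesOne {g n : ℕ} (C : MarkedCurve g n) (J : Set ℝ)
    (μ y : Fin g → ℝ → ℂ) (hy : OnCurveOne C.E J μ y) (B : Fin g → ℂ) : Prop where
  deriv_t : ∀ k t₀ t, (∀ s ∈ Set.uIcc t₀ t, s ∈ J) →
    HasDerivAt (fun θ => ∑ j, ∫ s in t₀..θ, C.omegaDensity k (μ j) (y j) s) (B k) t
  abel : ∀ t₀ t (h₀ : t₀ ∈ J) (h : t ∈ J),
    ∑ j, C.abelMap (finitePoint g C.E (μ j t) (y j t) (hy t h j)) =
      ∑ j, C.abelMap (finitePoint g C.E (μ j t₀) (y j t₀) (hy t₀ h₀ j)) +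
        (QuotientAddGroup.mk (fun k => ((t - t₀ : ℝ) : ℂ) * B k) : C.Jacobian)

/-- `-2 i c_{k,g}`, the velocity in `x`. -/
noncomputable def rateX {g n : ℕ} (C : MarkedCurve g n) (k : Fin g) : ℂ :=
  -2 * Complex.I * C.c k ⟨g - 1, Nat.sub_lt (Nat.zero_lt_of_lt k.isLt) Nat.one_pos⟩

/-- `κ ∑_{ℓ=1}^g c_{k,ℓ} d_{g-ℓ}`; here `ℓ` is counted from `0`. -/
noncomputable def rateT {g n : ℕ} (C : MarkedCurve g n) (κ : ℂ) (d : ℕ → ℂ) (k : Fin g) : ℂ :=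
  κ * ∑ l : Fin g, C.c k l * d (g - 1 - (l : ℕ))

/-! ## The KdV hierarchy -/

/-- The derivation `V_k ↦ V_{k+1}` of the ring of differential polynomials in `V`, where the
variable `V_k` stands for `∂_x^k V`. -/
noncomputable def kdvD : Derivation ℂ (MvPolynomial ℕ ℂ) (MvPolynomial ℕ ℂ) :=
  MvPolynomial.mkDerivation ℂ (fun k => MvPolynomial.X (k + 1))

/-- `f_0, f_1, …` are the differential polynomials of the KdV recursion with integration
constants `c_1, c_2, …` (and `c_0 = 1`). -/
structure IsKdVSeq (c : ℕ → ℂ) (f : ℕ → MvPolynomial ℕ ℂ) : Prop where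
  zero : f 0 = 1
  step : ∀ j, kdvD (f (j + 1)) =
    -(MvPolynomial.C (1 / 4) * kdvD (kdvD (kdvD (f j)))) + MvPolynomial.X 0 * kdvD (f j)
      + MvPolynomial.C (1 / 2) * MvPolynomial.X 1 * f j
  const : ∀ j, MvPolynomial.constantCoeff (f j) = c j

/-- The function `f_j(x, t)` obtained from a differential polynomial `f_j` and a
potential `V(x, t)`. -/
noncomputable def kdvCoeff (f : ℕ → MvPolynomial ℕ ℂ) (V : ℝ → ℝ → ℂ) (j : ℕ) (x t : ℝ) : ℂ :=
  MvPolynomial.eval (fun k => iteratedDeriv k (fun x' => V x' t) x) (f j)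

/-- `F_r(z, x, t) = ∑_{j=0}^r f_{r-j}(x, t) z^j`. -/
noncomputable def kdvF (f : ℕ → MvPolynomial ℕ ℂ) (V : ℝ → ℝ → ℂ) (r : ℕ) (z : ℂ)
    (x t : ℝ) : ℂ :=
  ∑ j ∈ Finset.range (r + 1), kdvCoeff f V (r - j) x t * z ^ j

/-- `u(x, t)` is smooth in `x` at the points of `Ω`. -/
def SmoothX (Ω : Set (ℝ × ℝ)) (u : ℝ → ℝ → ℂ) : Prop :=
  ∀ x t, (x, t) ∈ Ω → ContDiffAt ℝ ∞ (fun x' => u x' t) x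

/-- For each `t`, the function `V(·, t)` is a solution of the stationary `g`-th KdV equation
`f_{g+1,x} = 0` with associated curve `y² = R(z)`. -/
structure IsStationaryKdV (g : ℕ) {n : ℕ} (E : Fin n → ℂ) (Ω : Set (ℝ × ℝ))
    (f : ℕ → MvPolynomial ℕ ℂ) (V : ℝ → ℝ → ℂ) : Prop where
  smooth : SmoothX Ω V
  stationary : ∀ x t, (x, t) ∈ Ω → deriv (fun x' => kdvCoeff f V (g + 1) x' t) x = 0
  curve : ∀ x t, (x, t) ∈ Ω → ∀ z : ℂ,
    1 / 2 * iteratedDeriv 2 (fun x' => kdvF f V g z x' t) x * kdvF f V g z x t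
      - 1 / 4 * deriv (fun x' => kdvF f V g z x' t) x ^ 2
      - (V x t - z) * kdvF f V g z x t ^ 2 = curvePoly E z

/-! ## The AKNS hierarchy -/

/-- The derivation of the ring of differential polynomials in `p` and `q`; the variables
`Sum.inl k` and `Sum.inr k` stand for `∂_x^k p` and `∂_x^k q`. -/
noncomputable def aknsD : Derivation ℂ (MvPolynomial (ℕ ⊕ ℕ) ℂ) (MvPolynomial (ℕ ⊕ ℕ) ℂ) :=
  MvPolynomial.mkDerivation ℂ
    (Sum.elim (fun k => MvPolynomial.X (Sum.inl (k + 1)))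
      (fun k => MvPolynomial.X (Sum.inr (k + 1))))

/-- The differential polynomials `f_ℓ, g_ℓ, h_ℓ` of the AKNS recursion, with integration
constants `c_1, c_2, …` (and `c_0 = 1`). -/
structure IsAKNSSeq (c : ℕ → ℂ) (f g h : ℕ → MvPolynomial (ℕ ⊕ ℕ) ℂ) : Prop where
  f_zero : f 0 = -(MvPolynomial.C Complex.I * MvPolynomial.X (Sum.inr 0))
  g_zero : g 0 = 1
  h_zero : h 0 = MvPolynomial.C Complex.I * MvPolynomial.X (Sum.inl 0)
  f_step : ∀ l, f (l + 1) = MvPolynomial.C (Complex.I / 2) * aknsD (f l)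
    - MvPolynomial.C Complex.I * MvPolynomial.X (Sum.inr 0) * g (l + 1)
  g_step : ∀ l, aknsD (g (l + 1)) =
    MvPolynomial.X (Sum.inl 0) * f l + MvPolynomial.X (Sum.inr 0) * h l
  h_step : ∀ l, h (l + 1) = -(MvPolynomial.C (Complex.I / 2) * aknsD (h l))
    + MvPolynomial.C Complex.I * MvPolynomial.X (Sum.inl 0) * g (l + 1)
  const : ∀ l, MvPolynomial.constantCoeff (g l) = c l

/-- The function of `(x, t)` obtained from the `j`-th differential polynomial of a sequence
and the functions `p, q`. -/
noncomputable def aknsCoeff (f : ℕ → MvPolynomial (ℕ ⊕ ℕ) ℂ) (p q : ℝ → ℝ → ℂ) (j : ℕ)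
    (x t : ℝ) : ℂ :=
  MvPolynomial.eval (Sum.elim (fun k => iteratedDeriv k (fun x' => p x' t) x)
    (fun k => iteratedDeriv k (fun x' => q x' t) x)) (f j)

/-- `∑_{ℓ=0}^r f_{r-ℓ}(x, t) z^ℓ`; this gives `F_r`, `H_r`, and (with `g_ℓ` in place of `f_ℓ`
and `r` replaced by `r + 1`) `G_{r+1}`. -/
noncomputable def aknsPoly (f : ℕ → MvPolynomial (ℕ ⊕ ℕ) ℂ) (p q : ℝ → ℝ → ℂ) (r : ℕ) (z : ℂ)
    (x t : ℝ) : ℂ :=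
  ∑ l ∈ Finset.range (r + 1), aknsCoeff f p q (r - l) x t * z ^ l

/-- For each `t`, the pair `(p(·, t), q(·, t))` is a solution of the stationary `gen`-th AKNS
equation `f_{gen+1} = h_{gen+1} = 0` with associated curve `y² = R(z)`. -/
structure IsStationaryAKNS (gen : ℕ) {n : ℕ} (E : Fin n → ℂ) (Ω : Set (ℝ × ℝ))
    (f g h : ℕ → MvPolynomial (ℕ ⊕ ℕ) ℂ) (p q : ℝ → ℝ → ℂ) : Prop where
  smooth_p : SmoothX Ω p
  smooth_q : SmoothX Ω q
  stationary_f : ∀ x t, (x, t) ∈ Ω → aknsCoeff f p q (gen + 1) x t = 0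
  stationary_h : ∀ x t, (x, t) ∈ Ω → aknsCoeff h p q (gen + 1) x t = 0
  curve : ∀ x t, (x, t) ∈ Ω → ∀ z : ℂ,
    aknsPoly g p q (gen + 1) z x t ^ 2 - aknsPoly f p q gen z x t * aknsPoly h p q gen z x t =
      curvePoly E z

/-! ## The Toda hierarchy -/

/-- The shift by `m` on polynomials in the variables `Sum.inl k` and `Sum.inr k`, which stand
for `a(n + k)` and `b(n + k)`. -/
noncomputable def todaShift (m : ℤ) :
    MvPolynomial (ℤ ⊕ ℤ) ℂ →ₐ[ℂ] MvPolynomial (ℤ ⊕ ℤ) ℂ :=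
  MvPolynomial.rename (Sum.map (fun k => k + m) (fun k => k + m))

/-- The difference polynomials `f_j, g_j` of the Toda recursion, with summation constants
`c_1, c_2, …` (and `c_0 = 1`). -/
structure IsTodaSeq (c : ℕ → ℂ) (f g : ℕ → MvPolynomial (ℤ ⊕ ℤ) ℂ) : Prop where
  f_zero : f 0 = 1
  g_zero : g 0 = -MvPolynomial.C (c 1)
  f_step : ∀ j, 2 * f (j + 1) + g j + todaShift (-1) (g j)
    + 2 * MvPolynomial.X (Sum.inr 0) * f j = 0
  g_step : ∀ j, g (j + 1) - todaShift (-1) (g (j + 1))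
    + 2 * (MvPolynomial.X (Sum.inl 0) ^ 2 * todaShift 1 (f j)
      - MvPolynomial.X (Sum.inl (-1)) ^ 2 * todaShift (-1) (f j))
    + MvPolynomial.X (Sum.inr 0) * (g j - todaShift (-1) (g j)) = 0
  const : ∀ j, MvPolynomial.constantCoeff (f j) = c j

/-- The function of `(n, t)` obtained from the `j`-th difference polynomial of a sequence and
the functions `a, b`. -/
noncomputable def todaCoeff (f : ℕ → MvPolynomial (ℤ ⊕ ℤ) ℂ) (a b : ℤ → ℝ → ℂ) (j : ℕ)
    (n : ℤ) (t : ℝ) : ℂ :=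
  MvPolynomial.eval (Sum.elim (fun k => a (n + k) t) (fun k => b (n + k) t)) (f j)

/-- `F_r(z, n, t) = ∑_{j=0}^r f_{r-j}(n, t) z^j`. -/
noncomputable def todaF (f : ℕ → MvPolynomial (ℤ ⊕ ℤ) ℂ) (a b : ℤ → ℝ → ℂ) (r : ℕ) (z : ℂ)
    (n : ℤ) (t : ℝ) : ℂ :=
  ∑ j ∈ Finset.range (r + 1), todaCoeff f a b (r - j) n t * z ^ j

/-- `G_{r+1}(z, n, t) = -z^{r+1} + ∑_{j=0}^r g_{r-j}(n, t) z^j + f_{r+1}(n, t)`. -/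
noncomputable def todaG (f g : ℕ → MvPolynomial (ℤ ⊕ ℤ) ℂ) (a b : ℤ → ℝ → ℂ) (r : ℕ) (z : ℂ)
    (n : ℤ) (t : ℝ) : ℂ :=
  -z ^ (r + 1) + ∑ j ∈ Finset.range (r + 1), todaCoeff g a b (r - j) n t * z ^ j
    + todaCoeff f a b (r + 1) n t

/-- For each `t`, the pair `(a(·, t), b(·, t))` is a solution of the stationary `gen`-th Toda
equation with associated curve `y² = R(z)`. -/
structure IsStationaryToda (gen : ℕ) {m : ℕ} (E : Fin m → ℂ) (J : Set ℝ)
    (f g : ℕ → MvPolynomial (ℤ ⊕ ℤ) ℂ) (a b : ℤ → ℝ → ℂ) : Prop where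
  stationary_a : ∀ n, ∀ t ∈ J,
    todaCoeff g a b gen (n + 1) t + todaCoeff g a b gen n t
      + todaCoeff f a b (gen + 1) (n + 1) t + todaCoeff f a b (gen + 1) n t
      + 2 * b (n + 1) t * todaCoeff f a b gen (n + 1) t = 0
  stationary_b : ∀ n, ∀ t ∈ J,
    b n t * (todaCoeff g a b gen n t + todaCoeff f a b (gen + 1) n t)
      + a n t ^ 2 * todaCoeff f a b gen (n + 1) t
      - a (n - 1) t ^ 2 * todaCoeff f a b gen (n - 1) t
      + b n t ^ 2 * todaCoeff f a b gen n t = 0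
  curve : ∀ n, ∀ t ∈ J, ∀ z : ℂ,
    todaG f g a b gen z n t ^ 2
      - 4 * a n t ^ 2 * todaF f a b gen z n t * todaF f a b gen z (n + 1) t = curvePoly E z

/-! ## The combined sine-Gordon and mKdV hierarchy -/

/-- `-(u_x² + 2 ε i u_xx) / 4`; this is `w_+` for `ε = 1` and `w_-` for `ε = -1`. -/
noncomputable def sgW (ε : ℂ) (u : ℝ → ℝ → ℂ) (x t : ℝ) : ℂ :=
  -(1 / 4) * (deriv (fun x' => u x' t) x ^ 2
    + 2 * ε * Complex.I * iteratedDeriv 2 (fun x' => u x' t) x)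

/-- `∑_{j=0}^r f_{r-j} z^j`, where `f_0, …, f_{r-1}` are given by the KdV recursion with `w_±`
in place of `V`, and `f_r = α e^{-iu}` (for `ε = 1`) or `f_r = α e^{iu}` (for `ε = -1`). This is
`F_r` for `ε = 1`, and `H_r` for `ε = -1`, with `β` in place of `α`. -/
noncomputable def sgPoly (ε : ℂ) (f : ℕ → MvPolynomial ℕ ℂ) (α : ℂ) (u : ℝ → ℝ → ℂ) (r : ℕ)
    (z : ℂ) (x t : ℝ) : ℂ :=
  α * Complex.exp (-ε * Complex.I * u x t)
    + ∑ j ∈ Finset.range r, kdvCoeff f (sgW ε u) j x t * z ^ (r - j)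

/-- `G_{g-1} = ∑_{j=0}^{g-1} g_{g-1-j} z^j` with `g_j = (i / 2) (f_{j,x} + i u_x f_j)`. -/
noncomputable def sgG (f : ℕ → MvPolynomial ℕ ℂ) (u : ℝ → ℝ → ℂ) (g : ℕ) (z : ℂ)
    (x t : ℝ) : ℂ :=
  ∑ j ∈ Finset.range g, Complex.I / 2 *
    (deriv (fun x' => kdvCoeff f (sgW 1 u) j x' t) x
      + Complex.I * deriv (fun x' => u x' t) x * kdvCoeff f (sgW 1 u) j x t) * z ^ (g - 1 - j)

/-- For each `t`, the function `u(·, t)` is a solution of the stationary `g`-th sGmKdV equation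
(that is, of the zero curvature equations with `u_{xt} = 0`) with associated curve
`y² = R(z)`, where `E_0 = 0`. -/
structure IsStationarySG (g : ℕ) (E : Fin (2 * g + 1) → ℂ) (Ω : Set (ℝ × ℝ))
    (f : ℕ → MvPolynomial ℕ ℂ) (α β : ℂ) (u : ℝ → ℝ → ℂ) : Prop where
  E_zero : E 0 = 0
  smooth : SmoothX Ω u
  zeroCurvature_G : ∀ x t, (x, t) ∈ Ω → ∀ z : ℂ,
    -2 * Complex.I * deriv (fun x' => sgG f u g z x' t) x
      - 2 * (sgPoly (-1) f β u g z x t - sgPoly 1 f α u g z x t) = 0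
  zeroCurvature_F : ∀ x t, (x, t) ∈ Ω → ∀ z : ℂ,
    deriv (fun x' => sgPoly 1 f α u g z x' t) x =
      -Complex.I * deriv (fun x' => u x' t) x * sgPoly 1 f α u g z x t
        - 2 * Complex.I * z * sgG f u g z x t
  zeroCurvature_H : ∀ x t, (x, t) ∈ Ω → ∀ z : ℂ,
    deriv (fun x' => sgPoly (-1) f β u g z x' t) x =
      Complex.I * deriv (fun x' => u x' t) x * sgPoly (-1) f β u g z x t
        + 2 * Complex.I * z * sgG f u g z x t
  curve : ∀ x t, (x, t) ∈ Ω → ∀ z : ℂ,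
    z ^ 2 * sgG f u g z x t ^ 2 + z * sgPoly 1 f α u g z x t * sgPoly (-1) f β u g z x t =
      curvePoly E z

/-!
The proof has an algebraic and a geometric half.

**Algebra.** Put the recursion coefficients into a generating series in `ζ = 1 / z`. The recursions
have quadratic first integrals (`IsKdVSeq.first_integral`, `IsAKNSSeq.first_integral`,
`IsTodaSeq.first_integral`): a quadratic expression in the generating series is killed by the
derivation (or fixed by the shift), hence is a constant, namely the square of the series of
integration constants. The polynomial `F_g` of the stationary solution, read in descending powers of
`z`, satisfies the same quadratic equation with `∏ (1 - E_m ζ)` on the right. Such equations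
determine their solution up to a constant series (`kdv_series_unique`, `akns_series_unique`,
`toda_series_unique`), so the generating series for the constants `c̃` is
`(∑ c̃_l ζ ^ l) ∏ (1 - E_m ζ) ^ (-1/2) ∏ (1 - μ_l ζ)` (`kdvSeries_eq`, `aknsSeries_eq`,
`todaSeriesF_eq`). Dividing by `1 - μ_j ζ` and comparing coefficients of `ζ ^ r` gives
`F̃_r(μ_j) = ∑ d_{r,k} Φ_k^{(j)}(μ)` (`eval_at_root_of_series_eq`). In the combined sine-Gordon and
mKdV case the zero curvature equations reduce `F_g` and `H_g` to the KdV curve equation with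
potentials `w_±` (`kdv_curve_of_zeroCurvature`), and the lowest coefficient is expressed by the
product of the zeros (`sg_eval_at_root`).

**Geometry.** All Dubrovin velocities are therefore of the form
`κ ∑_k d_k Φ_k^{(j)}(μ) / ∏_{l ≠ j} (μ_j - μ_l)`. Along the flow `z ^ l dz / y` pulls back to
`μ_j ^ l` times this velocity, up to a null set of parameters (`ae_formDensity_eq`), and by Lagrange
interpolation the sum over `j` is the constant `κ d_{g-1-l}` (`sum_pow_mul_flowVelocity`). So the
sum of the abelian integrals along the flow is linear in time. The Abel map is defined by some
path from the base point; that it changes along a path by the integral over the path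
(`MarkedCurve.abelMap_target`) follows by closing up paths, which requires concatenating `C¹`
paths on the curve, the integrability of the holomorphic differentials along them
(`BranchPoints.intervalIntegrable_formDensity`), and the path-connectedness of the curve
(`BranchPoints.exists_path`). In two variables the linear law holds on small squares, and spreads
over the connected set `Ω` since a locally constant function on it is constant.
-/

/-! ### Symmetric functions and Lagrange interpolation -/

section SymmetricFunctions

open Polynomial

theorem Phi_eq_zero_of_le {g k : ℕ} (h : g ≤ k) (j : Fin g) (μ : Fin g → ℂ) : Phi k j μ = 0 := by
  have hc : (Finset.univ.erase j).card < k := by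
    rw [Finset.card_erase_of_mem (Finset.mem_univ j), Finset.card_univ, Fintype.card_fin]
    have := j.pos
    omega
  rw [Phi, Finset.powersetCard_eq_empty.2 hc]
  simp

theorem Phi_zero {g : ℕ} (j : Fin g) (μ : Fin g → ℂ) : Phi 0 j μ = 1 := by
  simp [Phi]

theorem Phi_top {g : ℕ} (j : Fin g) (μ : Fin g → ℂ) :
    Phi (g - 1) j μ = (-1) ^ (g - 1) * ∏ l ∈ Finset.univ.erase j, μ l := by
  have hc : (Finset.univ.erase j).card = g - 1 := by simp
  rw [Phi, ← hc, Finset.powersetCard_self]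
  simp

theorem prod_erase_X_sub_C {g : ℕ} (j : Fin g) (μ : Fin g → ℂ) :
    ∏ l ∈ Finset.univ.erase j, (X - C (μ l)) =
      ∑ k ∈ Finset.range g, C (Phi k j μ) * X ^ (g - 1 - k) := by
  have hg := j.pos
  have hc : (Finset.univ.erase j).card = g - 1 := by simp
  have h : ∏ l ∈ Finset.univ.erase j, (X - C (μ l)) =
      ∏ l ∈ Finset.univ.erase j, (C (-μ l) + X) := by
    refine Finset.prod_congr rfl fun l _ => ?_
    rw [C_neg]; ring
  rw [h, Finset.prod_add, Finset.sum_powerset, hc, Nat.sub_add_cancel hg]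
  refine Finset.sum_congr rfl fun k _ => ?_
  rw [Phi, C_mul, map_sum, Finset.mul_sum, Finset.sum_mul]
  refine Finset.sum_congr rfl fun s hs => ?_
  obtain ⟨hs, hk⟩ := Finset.mem_powersetCard.1 hs
  rw [Finset.prod_const, Finset.card_sdiff_of_subset hs, hc, hk]
  simp only [C_neg, Finset.prod_neg, hk, map_prod, map_pow, C_1]

theorem prod_erase_one_sub {g : ℕ} (j : Fin g) (μ : Fin g → ℂ) :
    ∏ l ∈ Finset.univ.erase j, (1 - C (μ l) * X) =
      ∑ k ∈ Finset.range g, C (Phi k j μ) * X ^ k := by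
  have hg := j.pos
  have hc : (Finset.univ.erase j).card = g - 1 := by simp
  have h : ∏ l ∈ Finset.univ.erase j, (1 - C (μ l) * X) =
      ∏ l ∈ Finset.univ.erase j, (1 + C (-μ l) * X) := by
    refine Finset.prod_congr rfl fun l _ => ?_
    rw [C_neg]; ring
  rw [h, Finset.prod_one_add, Finset.sum_powerset, hc, Nat.sub_add_cancel hg]
  refine Finset.sum_congr rfl fun k _ => ?_
  rw [Phi, C_mul, map_sum, Finset.mul_sum, Finset.sum_mul]
  refine Finset.sum_congr rfl fun s hs => ?_
  obtain ⟨hs, hk⟩ := Finset.mem_powersetCard.1 hs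
  simp only [C_neg, neg_mul, Finset.prod_neg, Finset.prod_mul_distrib, Finset.prod_const, hk,
    map_prod, map_pow, C_1]
  ring

theorem diffProd_ne_zero {g : ℕ} {μ : Fin g → ℂ} (hμ : Function.Injective μ) (j : Fin g) :
    diffProd μ j ≠ 0 := by
  refine Finset.prod_ne_zero_iff.2 fun l hl => sub_ne_zero.2 fun h => ?_
  exact (Finset.mem_erase.1 hl).1 (hμ h).symm

/-- Lagrange interpolation of `z ^ l` at the nodes `μ_j`, read off coefficientwise. -/
theorem sum_pow_mul_Phi_div_diffProd {g : ℕ} {μ : Fin g → ℂ} (hμ : Function.Injective μ)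
    {l k : ℕ} (hl : l < g) (hk : k < g) :
    ∑ j, μ j ^ l * (Phi k j μ / diffProd μ j) = if l + k + 1 = g then 1 else 0 := by
  have hint : (X ^ l : ℂ[X]) = ∑ j : Fin g, C (μ j ^ l / diffProd μ j) *
      ∏ i ∈ Finset.univ.erase j, (X - C (μ i)) := by
    have h := Lagrange.eq_interpolate (s := Finset.univ) (v := μ) (f := (X ^ l : ℂ[X]))
      hμ.injOn (by simpa using hl)
    rw [h, Lagrange.interpolate_apply]
    refine Finset.sum_congr rfl fun j _ => ?_
    rw [Lagrange.basis, div_eq_mul_inv, C_mul, mul_assoc]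
    congr 1
    · simp
    · simp only [Lagrange.basisDivisor, Finset.prod_mul_distrib]
      rw [diffProd, ← Finset.prod_inv_distrib, map_prod]
  have hcoeff := congrArg (fun p => coeff p (g - 1 - k)) hint
  simp only [coeff_X_pow, finsetSum_coeff, coeff_C_mul] at hcoeff
  have h1 : ∀ j : Fin g, coeff (∏ i ∈ Finset.univ.erase j, (X - C (μ i))) (g - 1 - k)
      = Phi k j μ := by
    intro j
    rw [prod_erase_X_sub_C, finsetSum_coeff, Finset.sum_eq_single k]
    · simp
    · intro b hb hbk
      rw [coeff_C_mul, coeff_X_pow, if_neg, mul_zero]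
      have := Finset.mem_range.1 hb
      omega
    · intro h
      exact absurd (Finset.mem_range.2 hk) h
  simp only [h1] at hcoeff
  rw [show (∑ j, μ j ^ l * (Phi k j μ / diffProd μ j)) =
    ∑ j, μ j ^ l / diffProd μ j * Phi k j μ from
      Finset.sum_congr rfl fun j _ => by ring, ← hcoeff]
  congr 1
  simp only [eq_iff_iff]
  omega

end SymmetricFunctions

/-! ### The series of `R` to the power `-1/2` -/

section InverseSquareRoot

open PowerSeries

/-- The binomial series of `(1 - ζ) ^ (-1/2)`. -/
noncomputable def binomialSeriesNegHalf : PowerSeries ℂ :=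
  mk fun j => (Nat.doubleFactorial (2 * j - 1) : ℂ) / (2 ^ j * (Nat.factorial j : ℂ))

theorem coeff_succ_binomialSeriesNegHalf (j : ℕ) :
    2 * ((j : ℂ) + 1) * coeff (j + 1) binomialSeriesNegHalf =
      (2 * j + 1) * coeff j binomialSeriesNegHalf := by
  have h : Nat.doubleFactorial (2 * (j + 1) - 1) =
      (2 * j + 1) * Nat.doubleFactorial (2 * j - 1) := by
    rcases j with _ | j
    · simp
    · rw [show 2 * (j + 1 + 1) - 1 = (2 * j + 1) + 2 by omega, Nat.doubleFactorial_add_two,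
        show 2 * (j + 1) - 1 = 2 * j + 1 by omega]
      ring
  have hj : (j : ℂ) + 1 ≠ 0 := by exact_mod_cast Nat.succ_ne_zero j
  have hf : (Nat.factorial j : ℂ) ≠ 0 := by exact_mod_cast Nat.factorial_ne_zero j
  rw [binomialSeriesNegHalf, coeff_mk, coeff_mk, h, Nat.factorial_succ]
  push_cast
  field_simp
  ring

/-- Both sides have constant coefficient `1`, and the left side has derivative `0`. -/
theorem binomialSeriesNegHalf_sq_mul : binomialSeriesNegHalf ^ 2 * (1 - X) = 1 := by
  have hode : C (2 : ℂ) * (1 - X) * d⁄dX ℂ binomialSeriesNegHalf = binomialSeriesNegHalf := by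
    ext n
    rw [mul_assoc, coeff_C_mul, sub_mul, one_mul, map_sub]
    rcases n with _ | n
    · have := coeff_succ_binomialSeriesNegHalf 0
      simp only [coeff_derivative, coeff_zero_X_mul]
      push_cast at this ⊢
      linear_combination this
    · have := coeff_succ_binomialSeriesNegHalf (n + 1)
      simp only [coeff_derivative, coeff_succ_X_mul]
      push_cast at this ⊢
      linear_combination this
  refine derivative.ext ?_ ?_
  · have h2 : (C (2 : ℂ) : PowerSeries ℂ) = 2 := map_ofNat C 2
    rw [h2] at hode
    rw [Derivation.leibniz, Derivation.leibniz_pow, map_sub, derivative_X, derivative_one]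
    simp only [smul_eq_mul, nsmul_eq_mul]
    push_cast
    linear_combination binomialSeriesNegHalf * hode
  · simp [binomialSeriesNegHalf]

/-- The series `∑ c_k(E) ζ ^ k`, that is, `∏ (1 - E_m ζ) ^ (-1/2)`. -/
noncomputable def invSqrtSeries {n : ℕ} (E : Fin n → ℂ) : PowerSeries ℂ := mk (cCoeff E)

theorem invSqrtSeries_eq_prod {n : ℕ} (E : Fin n → ℂ) :
    invSqrtSeries E = ∏ m, rescale (E m) binomialSeriesNegHalf := by
  ext k
  rw [invSqrtSeries, coeff_mk, coeff_prod, cCoeff, Finset.finsuppAntidiag, Finset.sum_map,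
    ← Finset.sum_attach]
  refine Finset.sum_congr rfl fun l _ => Finset.prod_congr rfl fun m _ => ?_
  rw [coeff_rescale, binomialSeriesNegHalf, coeff_mk, mul_comm]
  rfl

/-- The polynomial `∏ (1 - E_m ζ)` as a power series: `R` in the variable `ζ = 1 / z`. -/
noncomputable def reversedCurve {n : ℕ} (E : Fin n → ℂ) : PowerSeries ℂ := ∏ m, (1 - C (E m) * X)

theorem invSqrtSeries_sq_mul {n : ℕ} (E : Fin n → ℂ) :
    invSqrtSeries E ^ 2 * reversedCurve E = 1 := by
  rw [invSqrtSeries_eq_prod, reversedCurve, ← Finset.prod_pow, ← Finset.prod_mul_distrib]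
  refine Finset.prod_eq_one fun m _ => ?_
  have h := congrArg (rescale (E m)) binomialSeriesNegHalf_sq_mul
  simpa using h

theorem constantCoeff_invSqrtSeries {n : ℕ} (E : Fin n → ℂ) :
    constantCoeff (invSqrtSeries E) = 1 := by
  rw [invSqrtSeries_eq_prod, map_prod]
  refine Finset.prod_eq_one fun m _ => ?_
  rw [← coeff_zero_eq_constantCoeff_apply, coeff_rescale]
  simp [binomialSeriesNegHalf]

theorem dCoeff_eq_coeff {n : ℕ} (E : Fin n → ℂ) (ct : ℕ → ℂ) {r k : ℕ} (hk : k ≤ r) :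
    dCoeff E ct r k = coeff (r - k) (mk ct * invSqrtSeries E) := by
  rw [dCoeff, if_pos hk, coeff_mul, Finset.Nat.sum_antidiagonal_eq_sum_range_succ
    (fun i j => coeff i (mk ct) * coeff j (invSqrtSeries E))]
  simp [invSqrtSeries]

/-- With `F̃ = c̃ R ^ (-1/2) ∏ (1 - μ_l ζ)` as series in `ζ`, the value at `z = μ_j` of
`∑ f̃_l z ^ (r - l)` is the coefficient of `ζ ^ r` in `F̃ / (1 - μ_j ζ)`. -/
theorem eval_at_root_of_series_eq {n g : ℕ} (E : Fin n → ℂ) (ct : ℕ → ℂ) (μ : Fin g → ℂ)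
    (r : ℕ) (j : Fin g) {f : ℕ → ℂ}
    (hf : mk f = mk ct * invSqrtSeries E * ∏ l, (1 - C (μ l) * X)) :
    ∑ l ∈ Finset.range (r + 1), f (r - l) * μ j ^ l =
      ∑ k ∈ Finset.range (min r g + 1), dCoeff E ct r k * Phi k j μ := by
  have hgeom : (1 - C (μ j) * X) * mk (fun l => μ j ^ l) = 1 := by
    ext k
    rw [sub_mul, one_mul, mul_assoc, map_sub, coeff_C_mul, coeff_mk]
    rcases k with _ | k
    · simp
    · rw [coeff_succ_X_mul, coeff_mk, coeff_one, if_neg (Nat.succ_ne_zero k)]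
      ring
  have hprod : mk f * mk (fun l => μ j ^ l) = mk ct * invSqrtSeries E *
      ∑ k ∈ Finset.range g, C (Phi k j μ) * X ^ k := by
    have h := congrArg (Polynomial.toPowerSeries) (prod_erase_one_sub j μ)
    rw [← Polynomial.coeToPowerSeries.ringHom_apply, ← Polynomial.coeToPowerSeries.ringHom_apply,
      map_prod, map_sum] at h
    simp only [map_sub, map_one, map_mul, map_pow, Polynomial.coeToPowerSeries.ringHom_apply,
      Polynomial.coe_C, Polynomial.coe_X] at h
    rw [← h, hf, ← Finset.mul_prod_erase Finset.univ _ (Finset.mem_univ j)]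
    linear_combination mk ct * invSqrtSeries E *
      (∏ x ∈ Finset.univ.erase j, (1 - C (μ x) * X)) * hgeom
  have hc := congrArg (coeff r) hprod
  rw [mul_comm (mk f), coeff_mul, Finset.Nat.sum_antidiagonal_eq_sum_range_succ
    (fun a b => coeff a (mk fun l => μ j ^ l) * coeff b (mk f))] at hc
  simp only [coeff_mk] at hc
  rw [Finset.sum_congr rfl fun l _ => mul_comm (f (r - l)) (μ j ^ l), hc, Finset.mul_sum, map_sum]
  have hterm : ∀ k, coeff r (mk ct * invSqrtSeries E * (C (Phi k j μ) * X ^ k)) =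
      dCoeff E ct r k * Phi k j μ := by
    intro k
    rw [show mk ct * invSqrtSeries E * (C (Phi k j μ) * X ^ k) =
      C (Phi k j μ) * (mk ct * invSqrtSeries E * X ^ k) by ring, coeff_C_mul, coeff_mul_X_pow']
    by_cases hk : k ≤ r
    · rw [if_pos hk, dCoeff_eq_coeff E ct hk, mul_comm]
    · rw [if_neg hk, dCoeff, if_neg hk]; simp
  simp only [hterm]
  symm
  -- the terms with `k = g` or `k > r` vanish, so both ranges can be cut to their intersection
  have hcut : ∀ s : Finset ℕ, Finset.range (min (r + 1) g) ⊆ s →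
      ∑ k ∈ s, dCoeff E ct r k * Phi k j μ =
        ∑ k ∈ Finset.range (min (r + 1) g), dCoeff E ct r k * Phi k j μ := by
    intro s hs
    refine (Finset.sum_subset hs fun k _ hk => ?_).symm
    rw [Finset.mem_range, not_lt, min_le_iff] at hk
    rcases hk with hk | hk
    · rw [dCoeff, if_neg (by omega), zero_mul]
    · rw [Phi_eq_zero_of_le hk, mul_zero]
  rw [hcut (Finset.range (min r g + 1)), hcut (Finset.range g)]
  · exact fun x hx => by simp only [Finset.mem_range] at hx ⊢; omega
  · exact fun x hx => by simp only [Finset.mem_range] at hx ⊢; omega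

end InverseSquareRoot

/-! ### Rings of differential and difference polynomials -/

section DifferentialPolynomials

open MvPolynomial

/-- The derivation of a polynomial ring that sends each variable `X_i` to the variable
`X_{s i}`. -/
noncomputable def shiftD {σ : Type*} (s : σ → σ) :
    Derivation ℂ (MvPolynomial σ ℂ) (MvPolynomial σ ℂ) :=
  mkDerivation ℂ fun i => X (s i)

@[simp]
theorem shiftD_X {σ : Type*} (s : σ → σ) (i : σ) : shiftD s (X i) = X (s i) :=
  mkDerivation_X _ _ _

theorem kdvD_eq_shiftD : kdvD = shiftD Nat.succ := rfl

theorem aknsD_eq_shiftD : aknsD = shiftD (Sum.map Nat.succ Nat.succ) := by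
  rw [aknsD, shiftD]
  congr 1
  funext i
  cases i <;> rfl

theorem constantCoeff_shiftD {σ : Type*} (s : σ → σ) (P : MvPolynomial σ ℂ) :
    constantCoeff (shiftD s P) = 0 := by
  induction P using MvPolynomial.induction_on with
  | C a => simp [shiftD]
  | add p q hp hq => rw [map_add, map_add, hp, hq, add_zero]
  | mul_X p i hp => rw [Derivation.leibniz, shiftD_X]; simp [hp]

/-- The chain rule for a differential polynomial evaluated at a jet. -/
theorem hasDerivAt_eval_shiftD {σ : Type*} {s : σ → σ} {v : σ → ℝ → ℂ} {x : ℝ}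
    (hv : ∀ i, HasDerivAt (v i) (v (s i) x) x) (P : MvPolynomial σ ℂ) :
    HasDerivAt (fun x' => eval (fun i => v i x') P)
      (eval (fun i => v i x) (shiftD s P)) x := by
  induction P using MvPolynomial.induction_on with
  | C a => simpa [shiftD] using hasDerivAt_const x a
  | add p q hp hq =>
    simp only [map_add]
    exact hp.add hq
  | mul_X p i hp =>
    have h := hp.mul (hv i)
    rw [show eval (fun i => v i x) (shiftD s (p * X i)) =
      eval (fun i => v i x) (shiftD s p) * v i x + eval (fun i => v i x) p * v (s i) x by
        rw [Derivation.leibniz, shiftD_X]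
        simp only [smul_eq_mul, map_add, map_mul, eval_X]
        ring]
    simp only [map_mul, eval_X]
    exact h

theorem pderiv_comp_shiftD {σ : Type*} {s : σ → σ} (hs : Function.Injective s) (i : σ)
    (P : MvPolynomial σ ℂ) :
    pderiv (s i) (shiftD s P) = shiftD s (pderiv (s i) P) + pderiv i P := by
  classical
  induction P using MvPolynomial.induction_on with
  | C a => simp [shiftD]
  | add p q hp hq => simp only [map_add, hp, hq]; ring
  | mul_X p j hp =>
    have h1 : pderiv (s i) (X (s j) : MvPolynomial σ ℂ) = pderiv i (X j) := by
      simp only [pderiv_X, Pi.single_apply, hs.eq_iff]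
    have h2 : shiftD s (pderiv (s i) (X j : MvPolynomial σ ℂ)) = 0 := by
      rw [pderiv_X, Pi.single_apply]
      split_ifs <;> simp
    simp only [Derivation.leibniz, shiftD_X, map_add, smul_eq_mul, hp, h1, h2]
    ring

theorem eq_C_of_forall_pderiv_eq_zero {σ : Type*} {P : MvPolynomial σ ℂ}
    (h : ∀ i, pderiv i P = 0) : P = C (constantCoeff P) := by
  classical
  ext m
  rw [coeff_C, constantCoeff_eq]
  split_ifs with hm
  · rw [hm]
  · obtain ⟨i, hi⟩ : ∃ i, m i ≠ 0 := by
      by_contra! hcon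
      exact hm (Finsupp.ext fun i => (hcon i).symm)
    have hle : Finsupp.single i 1 ≤ m := by
      rw [Finsupp.single_le_iff]; omega
    have h1 := coeff_pderiv (i := i) P (m - Finsupp.single i 1)
    rw [h i, coeff_zero, tsub_add_cancel_of_le hle] at h1
    refine (mul_eq_zero.1 h1.symm).resolve_right ?_
    exact Nat.cast_add_one_ne_zero _

/-- A differential polynomial with vanishing total derivative is constant: by
`∂_{s i} D = D ∂_{s i} + ∂_i`, the vanishing of a partial derivative descends from the variables
that do not occur to all others. -/
theorem eq_C_of_shiftD_eq_zero {σ : Type*} {s : σ → σ} (hs : Function.Injective s)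
    (horb : ∀ i, Function.Injective fun n : ℕ => s^[n] i) {P : MvPolynomial σ ℂ}
    (hP : shiftD s P = 0) : P = C (constantCoeff P) := by
  refine eq_C_of_forall_pderiv_eq_zero fun i => ?_
  have hdesc : ∀ j, pderiv (s j) P = 0 → pderiv j P = 0 := by
    intro j hj
    have h := pderiv_comp_shiftD hs j P
    rwa [hP, hj, map_zero, map_zero, zero_add, eq_comm] at h
  obtain ⟨n, hn⟩ : ∃ n, s^[n] i ∉ P.vars := by
    by_contra! hcon
    exact Set.infinite_range_of_injective (horb i)
      (P.vars.finite_toSet.subset (by rintro _ ⟨n, rfl⟩; exact hcon n))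
  have hback : ∀ n, pderiv (s^[n] i) P = 0 → pderiv i P = 0 := by
    intro n
    induction n with
    | zero => exact id
    | succ n ih =>
      intro h
      rw [Function.iterate_succ_apply'] at h
      exact ih (hdesc _ h)
  exact hback n (pderiv_eq_zero_of_notMem_vars hn)

theorem eq_C_of_kdvD_eq_zero {P : MvPolynomial ℕ ℂ} (hP : kdvD P = 0) :
    P = C (constantCoeff P) := by
  refine eq_C_of_shiftD_eq_zero Nat.succ_injective (fun i m n h => ?_) hP
  simpa [Nat.succ_iterate] using h

theorem eq_C_of_aknsD_eq_zero {P : MvPolynomial (ℕ ⊕ ℕ) ℂ} (hP : aknsD P = 0) :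
    P = C (constantCoeff P) := by
  rw [aknsD_eq_shiftD] at hP
  refine eq_C_of_shiftD_eq_zero (Nat.succ_injective.sumMap Nat.succ_injective)
    (fun i m n h => ?_) hP
  have hl : ∀ (n k : ℕ), (Sum.map Nat.succ Nat.succ)^[n] (Sum.inl k : ℕ ⊕ ℕ) =
      Sum.inl (k + n) := by
    intro n k
    induction n with
    | zero => rfl
    | succ n ih => rw [Function.iterate_succ_apply', ih]; rfl
  have hr : ∀ (n k : ℕ), (Sum.map Nat.succ Nat.succ)^[n] (Sum.inr k : ℕ ⊕ ℕ) =
      Sum.inr (k + n) := by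
    intro n k
    induction n with
    | zero => rfl
    | succ n ih => rw [Function.iterate_succ_apply', ih]; rfl
  rcases i with k | k
  · simpa [hl] using h
  · simpa [hr] using h

/-- A shift-invariant polynomial in finitely many lattice variables is constant, since the
finite set of its variables would be shift-invariant too. -/
theorem eq_C_of_todaShift_eq {P : MvPolynomial (ℤ ⊕ ℤ) ℂ} (hP : todaShift (-1) P = P) :
    P = C (constantCoeff P) := by
  classical
  let s : ℤ ⊕ ℤ → ℤ ⊕ ℤ := Sum.map (fun k => k + 1) (fun k => k + 1)
  have hl : ∀ (n : ℕ) (k : ℤ), s^[n] (Sum.inl k) = Sum.inl (k + n) := by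
    intro n k
    induction n with
    | zero => simp
    | succ n ih => rw [Function.iterate_succ_apply', ih]; simp [s]; ring
  have hr : ∀ (n : ℕ) (k : ℤ), s^[n] (Sum.inr k) = Sum.inr (k + n) := by
    intro n k
    induction n with
    | zero => simp
    | succ n ih => rw [Function.iterate_succ_apply', ih]; simp [s]; ring
  have horb : ∀ i, Function.Injective fun n : ℕ => s^[n] i := by
    rintro (k | k) m n h
    · simpa [hl] using h
    · simpa [hr] using h
  have hinv : ∀ i ∈ P.vars, s i ∈ P.vars := by
    intro i hi
    rw [← hP] at hi
    obtain ⟨j, hj, rfl⟩ := Finset.mem_image.1 (vars_rename _ P hi)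
    convert hj
    rcases j with k | k <;> simp [s]
  have hempty : P.vars = ∅ := by
    refine Finset.eq_empty_of_forall_notMem fun i hi => ?_
    have hmem : ∀ n, s^[n] i ∈ P.vars := by
      intro n
      induction n with
      | zero => exact hi
      | succ n ih => rw [Function.iterate_succ_apply']; exact hinv _ ih
    exact Set.infinite_range_of_injective (horb i)
      (P.vars.finite_toSet.subset (by rintro _ ⟨n, rfl⟩; exact hmem n))
  exact eq_C_of_forall_pderiv_eq_zero fun i =>
    pderiv_eq_zero_of_notMem_vars (by simp [hempty])

theorem eval_todaShift (a b : ℤ → ℂ) (m n : ℤ) (P : MvPolynomial (ℤ ⊕ ℤ) ℂ) :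
    eval (Sum.elim (fun k => a (n + k)) fun k => b (n + k)) (todaShift m P) =
      eval (Sum.elim (fun k => a (n + m + k)) fun k => b (n + m + k)) P := by
  rw [todaShift, eval_rename]
  congr 2
  funext i
  rcases i with k | k <;> simp [add_assoc, add_comm m]

theorem constantCoeff_todaShift (m : ℤ) (P : MvPolynomial (ℤ ⊕ ℤ) ℂ) :
    constantCoeff (todaShift m P) = constantCoeff P := by
  rw [todaShift, constantCoeff_rename]

end DifferentialPolynomials

/-! ### Derivations acting on the coefficients of power series -/

section CoefficientDerivation

open PowerSeries

/-- A derivation of `A`, acting on each coefficient of a power series over `A`. -/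
noncomputable def coeffDerivation {A : Type*} [CommRing A] [Algebra ℂ A] (D : Derivation ℂ A A) :
    Derivation ℂ (PowerSeries A) (PowerSeries A) where
  toFun a := mk fun l => D (coeff l a)
  map_add' a b := by ext; simp
  map_smul' c a := by ext; simp
  map_one_eq_zero' := by
    ext l
    simp only [LinearMap.coe_mk, AddHom.coe_mk, coeff_mk, coeff_one, map_zero]
    split_ifs <;> simp
  leibniz' a b := by
    ext l
    simp only [LinearMap.coe_mk, AddHom.coe_mk, coeff_mk, coeff_mul, map_add, smul_eq_mul,
      map_sum, Derivation.leibniz, Finset.sum_add_distrib]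
    congr 1
    rw [← Finset.Nat.sum_antidiagonal_swap]
    rfl

@[simp]
theorem coeff_coeffDerivation {A : Type*} [CommRing A] [Algebra ℂ A] (D : Derivation ℂ A A)
    (a : PowerSeries A) (l : ℕ) : coeff l (coeffDerivation D a) = D (coeff l a) := by
  rw [← coeff_mk l fun l => D (coeff l a)]; rfl

theorem coeffDerivation_X {A : Type*} [CommRing A] [Algebra ℂ A] (D : Derivation ℂ A A) :
    coeffDerivation D X = 0 := by
  ext l
  rw [coeff_coeffDerivation, coeff_X]
  split_ifs <;> simp

theorem coeffDerivation_C {A : Type*} [CommRing A] [Algebra ℂ A] (D : Derivation ℂ A A) (a : A) :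
    coeffDerivation D (C a) = C (D a) := by
  ext l
  rw [coeff_coeffDerivation, coeff_C, coeff_C]
  split_ifs <;> simp

end CoefficientDerivation

/-! ### The quadratic first integrals of the recursions -/

section FirstIntegrals

open PowerSeries

theorem map_eval_eq_map_constantCoeff {σ : Type*} {Q : PowerSeries (MvPolynomial σ ℂ)}
    (h : ∀ l, coeff l Q = MvPolynomial.C (MvPolynomial.constantCoeff (coeff l Q))) (v : σ → ℂ) :
    map (MvPolynomial.eval v) Q = map MvPolynomial.constantCoeff Q := by
  ext l
  rw [coeff_map, coeff_map, h l]
  simp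

/-- The generating series of the KdV recursion, evaluated at a point of the jet space. -/
noncomputable def kdvSeries (f : ℕ → MvPolynomial ℕ ℂ) (v : ℕ → ℂ) : PowerSeries ℂ :=
  PowerSeries.mk fun l => MvPolynomial.eval v (f l)

theorem IsKdVSeq.first_integral {c : ℕ → ℂ} {f : ℕ → MvPolynomial ℕ ℂ} (h : IsKdVSeq c f)
    (v : ℕ → ℂ) :
    X * (2 * kdvSeries f v * kdvSeries (fun l => kdvD (kdvD (f l))) v
      - kdvSeries (fun l => kdvD (f l)) v ^ 2 - 4 * C (v 0) * kdvSeries f v ^ 2)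
      + 4 * kdvSeries f v ^ 2 = 4 * PowerSeries.mk c ^ 2 := by
  let F : PowerSeries (MvPolynomial ℕ ℂ) := PowerSeries.mk f
  let D := coeffDerivation kdvD
  let V : PowerSeries (MvPolynomial ℕ ℂ) := C (MvPolynomial.X 0)
  have hV : D V = C (MvPolynomial.X 1) := by
    rw [coeffDerivation_C, kdvD_eq_shiftD, shiftD_X]
  have hX : D X = 0 := coeffDerivation_X _
  have hquarter : (4 : MvPolynomial ℕ ℂ) * MvPolynomial.C (1 / 4) = 1 := by
    rw [show (4 : MvPolynomial ℕ ℂ) = MvPolynomial.C 4 from (map_ofNat _ 4).symm, ← map_mul]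
    norm_num
  have hhalf : (4 : MvPolynomial ℕ ℂ) * MvPolynomial.C (1 / 2) = 2 := by
    rw [show (4 : MvPolynomial ℕ ℂ) = MvPolynomial.C 4 from (map_ofNat _ 4).symm, ← map_mul,
      show (2 : MvPolynomial ℕ ℂ) = MvPolynomial.C 2 from (map_ofNat _ 2).symm]
    norm_num
  have hcoe4 : (4 : PowerSeries (MvPolynomial ℕ ℂ)) = C 4 := (map_ofNat _ 4).symm
  have hcoe2 : (2 : PowerSeries (MvPolynomial ℕ ℂ)) = C 2 := (map_ofNat _ 2).symm
  have hlin : 4 * D F = X * (-(D (D (D F))) + 4 * (V * D F) + 2 * (D V * F)) := by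
    rw [hV]
    ext1 l
    rcases l with _ | l
    · rw [hcoe4, coeff_C_mul, coeff_zero_X_mul]
      simp [D, F, h.zero]
    · rw [hcoe4, hcoe2, coeff_succ_X_mul]
      simp only [coeff_C_mul, map_add, map_neg, V, D, F, coeff_coeffDerivation, coeff_mk, h.step]
      linear_combination -kdvD (kdvD (kdvD (f l))) * hquarter
        + MvPolynomial.X 1 * f l * hhalf
  let Q := X * (2 * F * D (D F) - D F ^ 2 - 4 * V * F ^ 2) + 4 * F ^ 2
  have hnum4 : D 4 = 0 := by rw [hcoe4, coeffDerivation_C, show (4 : MvPolynomial ℕ ℂ) =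
    MvPolynomial.C 4 from (map_ofNat _ 4).symm]; simp [kdvD]
  have hnum2 : D 2 = 0 := by rw [hcoe2, coeffDerivation_C, show (2 : MvPolynomial ℕ ℂ) =
    MvPolynomial.C 2 from (map_ofNat _ 2).symm]; simp [kdvD]
  have hDQ : D Q = 0 := by
    simp only [Q, map_add, map_sub, Derivation.leibniz, Derivation.leibniz_pow, smul_eq_mul, hX,
      hnum4, hnum2, nsmul_eq_mul]
    push_cast
    linear_combination 2 * F * hlin
  have hconst : ∀ l, coeff l Q = MvPolynomial.C (MvPolynomial.constantCoeff (coeff l Q)) := by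
    intro l
    refine eq_C_of_kdvD_eq_zero ?_
    rw [← coeff_coeffDerivation, show coeffDerivation kdvD Q = D Q from rfl, hDQ, map_zero]
  have heval := map_eval_eq_map_constantCoeff hconst v
  have e0 : map (MvPolynomial.eval v) F = kdvSeries f v := by
    ext; simp [F, kdvSeries]
  have e1 : map (MvPolynomial.eval v) (D F) = kdvSeries (fun l => kdvD (f l)) v := by
    ext; simp [F, kdvSeries, D]
  have e2 : map (MvPolynomial.eval v) (D (D F)) = kdvSeries (fun l => kdvD (kdvD (f l))) v := by
    ext; simp [F, kdvSeries, D]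
  have eV : map (MvPolynomial.eval v) V = C (v 0) := by simp [V]
  have c0 : map MvPolynomial.constantCoeff F = PowerSeries.mk c := by
    ext; simp [F, h.const]
  have c1 : ∀ G, map MvPolynomial.constantCoeff (D G) = 0 := by
    intro G
    ext l
    simp [D, kdvD_eq_shiftD, constantCoeff_shiftD]
  have cV : map MvPolynomial.constantCoeff V = 0 := by simp [V]
  simpa only [Q, map_add, map_mul, map_sub, map_pow, map_ofNat, map_X, e0, e1, e2, eV, c0, c1, cV,
    mul_zero, zero_mul, sub_zero, zero_pow two_ne_zero, zero_add] using heval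

/-- The generating series of a sequence of differential polynomials in `p` and `q`. -/
noncomputable def aknsSeries (f : ℕ → MvPolynomial (ℕ ⊕ ℕ) ℂ) (v : ℕ ⊕ ℕ → ℂ) : PowerSeries ℂ :=
  PowerSeries.mk fun l => MvPolynomial.eval v (f l)

theorem IsAKNSSeq.series_f {c : ℕ → ℂ} {f g h : ℕ → MvPolynomial (ℕ ⊕ ℕ) ℂ}
    (hs : IsAKNSSeq c f g h) (v : ℕ ⊕ ℕ → ℂ) :
    aknsSeries f v = X * (C (Complex.I / 2) * aknsSeries (fun l => aknsD (f l)) v)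
      - C (Complex.I * v (Sum.inr 0)) * aknsSeries g v := by
  ext l
  rcases l with _ | l
  · simp only [map_sub, coeff_zero_X_mul, coeff_C_mul, aknsSeries, coeff_mk, hs.f_zero, hs.g_zero]
    simp
  · simp only [map_sub, coeff_succ_X_mul, coeff_C_mul, aknsSeries, coeff_mk, hs.f_step]
    simp

theorem IsAKNSSeq.series_h {c : ℕ → ℂ} {f g h : ℕ → MvPolynomial (ℕ ⊕ ℕ) ℂ}
    (hs : IsAKNSSeq c f g h) (v : ℕ ⊕ ℕ → ℂ) :
    aknsSeries h v = -(X * (C (Complex.I / 2) * aknsSeries (fun l => aknsD (h l)) v))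
      + C (Complex.I * v (Sum.inl 0)) * aknsSeries g v := by
  ext l
  rcases l with _ | l
  · simp only [map_add, map_neg, coeff_zero_X_mul, coeff_C_mul, aknsSeries, coeff_mk, hs.h_zero,
      hs.g_zero]
    simp
  · simp only [map_add, map_neg, coeff_succ_X_mul, coeff_C_mul, aknsSeries, coeff_mk, hs.h_step]
    simp

theorem IsAKNSSeq.first_integral {c : ℕ → ℂ} {f g h : ℕ → MvPolynomial (ℕ ⊕ ℕ) ℂ}
    (hs : IsAKNSSeq c f g h) (v : ℕ ⊕ ℕ → ℂ) :
    aknsSeries g v ^ 2 - X ^ 2 * (aknsSeries f v * aknsSeries h v) = PowerSeries.mk c ^ 2 := by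
  let F : PowerSeries (MvPolynomial (ℕ ⊕ ℕ) ℂ) := PowerSeries.mk f
  let G : PowerSeries (MvPolynomial (ℕ ⊕ ℕ) ℂ) := PowerSeries.mk g
  let H : PowerSeries (MvPolynomial (ℕ ⊕ ℕ) ℂ) := PowerSeries.mk h
  let D := coeffDerivation aknsD
  let p : PowerSeries (MvPolynomial (ℕ ⊕ ℕ) ℂ) := C (MvPolynomial.X (Sum.inl 0))
  let q : PowerSeries (MvPolynomial (ℕ ⊕ ℕ) ℂ) := C (MvPolynomial.X (Sum.inr 0))
  let i : PowerSeries (MvPolynomial (ℕ ⊕ ℕ) ℂ) := C (MvPolynomial.C Complex.I)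
  let k : PowerSeries (MvPolynomial (ℕ ⊕ ℕ) ℂ) := C (MvPolynomial.C (Complex.I / 2))
  have hX : D X = 0 := coeffDerivation_X _
  have hi : i ^ 2 = -1 := by
    rw [← map_pow, ← map_pow, Complex.I_sq]
    simp
  have hk : 2 * k = i := by
    rw [two_mul, ← map_add, ← map_add]
    congr 2
    ring
  have hF : F = X * (k * D F) - i * q * G := by
    ext1 l
    rcases l with _ | l
    · simp only [map_sub, coeff_zero_X_mul, mul_assoc, coeff_C_mul, coeff_mk, F, G, q, i,
        hs.f_zero, hs.g_zero]
      ring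
    · simp only [map_sub, coeff_succ_X_mul, mul_assoc, coeff_C_mul, coeff_mk, F, G, q, i, k, D,
        coeff_coeffDerivation, hs.f_step]
  have hH : H = -(X * (k * D H)) + i * p * G := by
    ext1 l
    rcases l with _ | l
    · simp only [map_add, map_neg, coeff_zero_X_mul, mul_assoc, coeff_C_mul, coeff_mk, H, G, p, i,
        hs.h_zero, hs.g_zero]
      ring
    · simp only [map_add, map_neg, coeff_succ_X_mul, mul_assoc, coeff_C_mul, coeff_mk, H, G, p, i,
        k, D, coeff_coeffDerivation, hs.h_step]
  have hG : D G = X * (p * F + q * H) := by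
    ext1 l
    rcases l with _ | l
    · simp [D, G, hs.g_zero]
    · simp only [map_add, coeff_succ_X_mul, coeff_C_mul, coeff_mk, H, G, F, p, q, D,
        coeff_coeffDerivation, hs.g_step]
  let Q := G ^ 2 - X ^ 2 * (F * H)
  have hDQ : D Q = 0 := by
    simp only [Q, map_sub, Derivation.leibniz, Derivation.leibniz_pow, smul_eq_mul, hX,
      nsmul_eq_mul, hG]
    push_cast
    have hF' : X * D F = -(2 * i * F) + 2 * q * G := by
      linear_combination (2 * i) * hF + (X * D F - 2 * q * G) * hi + i * X * D F * hk
    have hH' : X * D H = 2 * i * H + 2 * p * G := by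
      linear_combination -(2 * i) * hH + (X * D H - 2 * p * G) * hi + i * X * D H * hk
    linear_combination -X * H * hF' - X * F * hH'
  have hconst : ∀ l, coeff l Q = MvPolynomial.C (MvPolynomial.constantCoeff (coeff l Q)) := by
    intro l
    refine eq_C_of_aknsD_eq_zero ?_
    rw [← coeff_coeffDerivation, show coeffDerivation aknsD Q = D Q from rfl, hDQ, map_zero]
  have heval := map_eval_eq_map_constantCoeff hconst v
  have eF : map (MvPolynomial.eval v) F = aknsSeries f v := by ext; simp [F, aknsSeries]
  have eG : map (MvPolynomial.eval v) G = aknsSeries g v := by ext; simp [G, aknsSeries]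
  have eH : map (MvPolynomial.eval v) H = aknsSeries h v := by ext; simp [H, aknsSeries]
  have cF : map MvPolynomial.constantCoeff F = 0 := by
    ext l
    rcases l with _ | l
    · simp [F, hs.f_zero]
    · simp [F, hs.f_step, aknsD_eq_shiftD, constantCoeff_shiftD]
  have cG : map MvPolynomial.constantCoeff G = PowerSeries.mk c := by ext; simp [G, hs.const]
  simpa only [Q, map_mul, map_sub, map_pow, map_X, eF, eG, eH, cF, cG, mul_zero, zero_mul,
    sub_zero] using heval

/-- The series `∑ f_j(n) ζ ^ j` of the Toda recursion at the lattice site `n`. -/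
noncomputable def todaSeriesF (f : ℕ → MvPolynomial (ℤ ⊕ ℤ) ℂ) (a b : ℤ → ℂ) (n : ℤ) :
    PowerSeries ℂ :=
  PowerSeries.mk fun l => MvPolynomial.eval (Sum.elim (fun k => a (n + k)) fun k => b (n + k)) (f l)

/-- The series `-1 + ∑ g_j(n) ζ ^ (j + 1)` of the Toda recursion at the lattice site `n`. -/
noncomputable def todaSeriesG (g : ℕ → MvPolynomial (ℤ ⊕ ℤ) ℂ) (a b : ℤ → ℂ) (n : ℤ) :
    PowerSeries ℂ :=
  X * todaSeriesF g a b n - 1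

theorem IsTodaSeq.series_linear {c : ℕ → ℂ} {f g : ℕ → MvPolynomial (ℤ ⊕ ℤ) ℂ}
    (h : IsTodaSeq c f g) (a b : ℤ → ℂ) (n : ℤ) :
    2 * ((1 + C (b n) * X) * todaSeriesF f a b n)
      + todaSeriesG g a b n + todaSeriesG g a b (n - 1) = 0 := by
  have hcoe2 : (2 : PowerSeries ℂ) = C 2 := (map_ofNat _ 2).symm
  have key : todaSeriesF f a b n + X * (C (b n) * todaSeriesF f a b n)
      + X * (C (1 / 2) * (todaSeriesF g a b n + todaSeriesF g a b (n - 1))) = 1 := by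
    ext l
    rcases l with _ | l
    · simp [todaSeriesF, h.f_zero]
    · have hl := congrArg
        (MvPolynomial.eval (Sum.elim (fun k => a (n + k)) fun k => b (n + k))) (h.f_step l)
      simp only [map_add, map_mul, eval_todaShift, MvPolynomial.eval_X, Sum.elim_inr, add_zero,
        map_ofNat, map_zero] at hl
      simp only [map_add, coeff_succ_X_mul, coeff_C_mul, todaSeriesF, coeff_mk, coeff_one,
        if_neg (Nat.succ_ne_zero l), sub_eq_add_neg]
      linear_combination hl / 2
  have hhalf : (2 : PowerSeries ℂ) * C (1 / 2) = 1 := by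
    rw [hcoe2, ← map_mul]; norm_num
  rw [todaSeriesG, todaSeriesG]
  linear_combination 2 * key
    - X * (todaSeriesF g a b n + todaSeriesF g a b (n - 1)) * hhalf

theorem IsTodaSeq.first_integral {c : ℕ → ℂ} {f g : ℕ → MvPolynomial (ℤ ⊕ ℤ) ℂ}
    (h : IsTodaSeq c f g) (a b : ℤ → ℂ) (n : ℤ) :
    todaSeriesG g a b n ^ 2 - 4 * C (a n ^ 2) * X ^ 2 *
      (todaSeriesF f a b n * todaSeriesF f a b (n + 1)) = PowerSeries.mk c ^ 2 := by
  let F : PowerSeries (MvPolynomial (ℤ ⊕ ℤ) ℂ) := PowerSeries.mk f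
  let g' : PowerSeries (MvPolynomial (ℤ ⊕ ℤ) ℂ) := PowerSeries.mk g
  let G : PowerSeries (MvPolynomial (ℤ ⊕ ℤ) ℂ) := X * g' - 1
  let S (m : ℤ) : PowerSeries (MvPolynomial (ℤ ⊕ ℤ) ℂ) →+* PowerSeries (MvPolynomial (ℤ ⊕ ℤ) ℂ) :=
    map (todaShift m).toRingHom
  let A (k : ℤ) : PowerSeries (MvPolynomial (ℤ ⊕ ℤ) ℂ) := C (MvPolynomial.X (Sum.inl k))
  let B : PowerSeries (MvPolynomial (ℤ ⊕ ℤ) ℂ) := C (MvPolynomial.X (Sum.inr 0))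
  have hS : ∀ m (P : PowerSeries (MvPolynomial (ℤ ⊕ ℤ) ℂ)) l,
      coeff l (S m P) = todaShift m (coeff l P) := fun m P l => coeff_map _ _ _
  have hSX : ∀ m, S m X = X := fun m => map_X _
  have hcoe2 : (2 : PowerSeries (MvPolynomial (ℤ ⊕ ℤ) ℂ)) = C 2 := (map_ofNat _ 2).symm
  have hlin : 2 * ((1 + B * X) * F) + G + S (-1) G = 0 := by
    have key : 2 * F + X * (2 * (B * F)) + X * (g' + S (-1) g') = 2 := by
      rw [hcoe2]
      ext1 l
      rcases l with _ | l
      · simp [F, h.f_zero]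
      · simp only [map_add, coeff_succ_X_mul, coeff_C_mul, F, B, g', hS, coeff_mk]
        rw [coeff_C, if_neg (Nat.succ_ne_zero l)]
        linear_combination h.f_step l
    simp only [G, map_sub, map_mul, map_one, hSX]
    linear_combination key
  have hquad : (1 + B * X) * (G - S (-1) G)
      + 2 * X ^ 2 * (A 0 ^ 2 * S 1 F - A (-1) ^ 2 * S (-1) F) = 0 := by
    have key : g' - S (-1) g' + X * (2 * (A 0 * (A 0 * S 1 F) - A (-1) * (A (-1) * S (-1) F))
        + B * (g' - S (-1) g')) = 0 := by
      rw [hcoe2]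
      ext1 l
      rcases l with _ | l
      · simp only [map_add, map_sub, hS, coeff_zero_X_mul, g', coeff_mk, h.g_zero]
        simp [todaShift]
      · simp only [map_add, map_sub, coeff_succ_X_mul, coeff_C_mul, F, B, g', A, hS, coeff_mk,
          map_zero]
        linear_combination h.g_step l
    simp only [G, map_sub, map_mul, map_one, hSX]
    linear_combination X * key
  let Q := G ^ 2 - 4 * A 0 ^ 2 * X ^ 2 * (F * S 1 F)
  have hSS : S (-1) (S 1 F) = F := by
    ext1 l
    rw [hS, hS, todaShift, todaShift, MvPolynomial.rename_rename]
    convert MvPolynomial.rename_id_apply _ using 2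
    congr 1
    funext i
    rcases i with k | k <;> simp
  have hSA : S (-1) (A 0) = A (-1) := by
    simp only [S, A, map_C]
    simp [todaShift]
  have hSQ : S (-1) Q = Q := by
    simp only [Q, map_sub, map_mul, map_pow, map_ofNat, hSS, hSA, hSX]
    linear_combination 2 * F * hquad - (G - S (-1) G) * hlin
  have hconst : ∀ l, coeff l Q = MvPolynomial.C (MvPolynomial.constantCoeff (coeff l Q)) := by
    intro l
    refine eq_C_of_todaShift_eq ?_
    rw [← hS, hSQ]
  have heval := map_eval_eq_map_constantCoeff hconst
    (Sum.elim (fun k => a (n + k)) fun k => b (n + k))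
  have eF : map (MvPolynomial.eval (Sum.elim (fun k => a (n + k)) fun k => b (n + k))) F =
      todaSeriesF f a b n := by ext; simp [F, todaSeriesF]
  have eF' : map (MvPolynomial.eval (Sum.elim (fun k => a (n + k)) fun k => b (n + k))) (S 1 F) =
      todaSeriesF f a b (n + 1) := by
    ext; simp [F, todaSeriesF, hS, eval_todaShift]
  have eG : map (MvPolynomial.eval (Sum.elim (fun k => a (n + k)) fun k => b (n + k))) G =
      todaSeriesG g a b n := by
    have : map (MvPolynomial.eval (Sum.elim (fun k => a (n + k)) fun k => b (n + k))) g' =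
        todaSeriesF g a b n := by ext; simp [g', todaSeriesF]
    simp only [G, map_sub, map_mul, map_X, map_one, this, todaSeriesG]
  have eA : map (MvPolynomial.eval (Sum.elim (fun k => a (n + k)) fun k => b (n + k))) (A 0) =
      C (a n) := by simp [A]
  have cA : map MvPolynomial.constantCoeff (A 0) = 0 := by simp [A]
  have hg : ∀ l, MvPolynomial.constantCoeff (g l) = -c (l + 1) := by
    intro l
    have hl := congrArg MvPolynomial.constantCoeff (h.f_step l)
    simp only [map_add, map_mul, constantCoeff_todaShift, MvPolynomial.constantCoeff_X, map_ofNat,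
      map_zero, h.const] at hl
    linear_combination hl / 2
  have hc0 : c 0 = 1 := by rw [← h.const, h.f_zero, map_one]
  have cG : map MvPolynomial.constantCoeff G = -PowerSeries.mk c := by
    ext l
    rcases l with _ | l
    · simp [G, hc0]
    · simp only [G, map_sub, map_mul, map_X, map_one, map_neg, coeff_succ_X_mul, coeff_map, g',
        coeff_mk, hg, coeff_one, if_neg (Nat.succ_ne_zero l), sub_zero]
  rw [map_pow]
  simpa only [Q, map_mul, map_sub, map_pow, map_X, map_ofNat, eF, eF', eG, eA, cA, cG, mul_zero,
    zero_mul, sub_zero, zero_pow two_ne_zero, neg_sq] using heval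

end FirstIntegrals

/-! ### Polynomials in `z` as series in `1 / z` -/

section Reversal

open PowerSeries

/-- The polynomial `∑_{k ≤ g} b_k ζ ^ k`, which is `ζ ^ g ∑ b_k z ^ (g - k)` for `ζ = 1 / z`. -/
noncomputable def reversedPoly (g : ℕ) (b : ℕ → ℂ) : Polynomial ℂ :=
  ∑ k ∈ Finset.range (g + 1), Polynomial.C (b k) * Polynomial.X ^ k

/-- The polynomial `∑_{k ≤ g} b_k ζ ^ k` as a power series. -/
noncomputable def reversedSeries (g : ℕ) (b : ℕ → ℂ) : PowerSeries ℂ := reversedPoly g b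

theorem coe_reversedPoly (g : ℕ) (b : ℕ → ℂ) :
    (reversedPoly g b : PowerSeries ℂ) = reversedSeries g b := rfl

theorem coeff_reversedSeries (g : ℕ) (b : ℕ → ℂ) (k : ℕ) :
    coeff k (reversedSeries g b) = if k ≤ g then b k else 0 := by
  rw [reversedSeries, Polynomial.coeff_coe, reversedPoly, Polynomial.finsetSum_coeff]
  simp only [Polynomial.coeff_C_mul, Polynomial.coeff_X_pow, mul_ite, mul_one, mul_zero,
    Finset.sum_ite_eq, Finset.mem_range, Nat.lt_succ_iff]

theorem constantCoeff_reversedSeries (g : ℕ) (b : ℕ → ℂ) :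
    constantCoeff (reversedSeries g b) = b 0 := by
  rw [← coeff_zero_eq_constantCoeff_apply, coeff_reversedSeries, if_pos (Nat.zero_le g)]

theorem eval_reversedPoly (g : ℕ) (b : ℕ → ℂ) {ζ : ℂ} (hζ : ζ ≠ 0) :
    (reversedPoly g b).eval ζ =
      ζ ^ g * ∑ j ∈ Finset.range (g + 1), b (g - j) * ζ⁻¹ ^ j := by
  rw [reversedPoly, Polynomial.eval_finsetSum,
    ← Finset.sum_flip, Finset.mul_sum]
  refine Finset.sum_congr rfl fun j hj => ?_
  have hj : j ≤ g := Nat.lt_succ_iff.1 (Finset.mem_range.1 hj)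
  rw [Polynomial.eval_mul, Polynomial.eval_pow, Polynomial.eval_C, Polynomial.eval_X, inv_pow,
    mul_left_comm, ← pow_sub₀ ζ hζ hj]

theorem eval_prod_one_sub {n : ℕ} (E : Fin n → ℂ) {ζ : ℂ} (hζ : ζ ≠ 0) :
    (∏ m, (1 - Polynomial.C (E m) * Polynomial.X)).eval ζ = ζ ^ n * ∏ m, (ζ⁻¹ - E m) := by
  rw [Polynomial.eval_prod]
  calc ∏ m, (1 - Polynomial.C (E m) * Polynomial.X).eval ζ = ∏ m, (ζ * (ζ⁻¹ - E m)) := by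
        refine Finset.prod_congr rfl fun m _ => ?_
        simp only [Polynomial.eval_sub, Polynomial.eval_one, Polynomial.eval_mul,
          Polynomial.eval_C, Polynomial.eval_X, mul_sub, mul_inv_cancel₀ hζ, mul_comm]
    _ = _ := by rw [Finset.prod_mul_distrib]; simp

theorem coe_prod_one_sub {n : ℕ} (E : Fin n → ℂ) :
    ((∏ m, (1 - Polynomial.C (E m) * Polynomial.X) : Polynomial ℂ) : PowerSeries ℂ) =
      reversedCurve E := by
  rw [reversedCurve, ← Polynomial.coeToPowerSeries.ringHom_apply, map_prod]
  simp

theorem polynomial_eq_of_forall_ne_zero {p q : Polynomial ℂ}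
    (h : ∀ ζ : ℂ, ζ ≠ 0 → p.eval ζ = q.eval ζ) : p = q := by
  refine Polynomial.eq_of_infinite_eval_eq p q (Set.Infinite.mono (s := {0}ᶜ) ?_ ?_)
  · exact fun ζ hζ => h ζ hζ
  · exact (Set.finite_singleton 0).infinite_compl

/-- A polynomial `∑ b_k z ^ (g - k) = b_0 ∏ (z - μ_j)`, read as a series in `ζ = 1 / z`. -/
theorem reversedSeries_eq_prod {g : ℕ} {b : ℕ → ℂ} {κ : ℂ} {μ : Fin g → ℂ}
    (h : ∀ z : ℂ, ∑ j ∈ Finset.range (g + 1), b (g - j) * z ^ j = κ * ∏ j, (z - μ j)) :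
    reversedSeries g b = C κ * ∏ j, (1 - C (μ j) * X) := by
  rw [reversedSeries, ← reversedCurve, ← coe_prod_one_sub, ← Polynomial.coe_C, ← Polynomial.coe_mul]
  congr 1
  refine polynomial_eq_of_forall_ne_zero fun ζ hζ => ?_
  rw [eval_reversedPoly g b hζ, h, Polynomial.eval_mul, Polynomial.eval_C,
    eval_prod_one_sub μ hζ]
  ring

theorem sum_leading_coeff {g : ℕ} {b : ℕ → ℂ} {κ : ℂ} {μ : Fin g → ℂ}
    (h : ∀ z : ℂ, ∑ j ∈ Finset.range (g + 1), b (g - j) * z ^ j = κ * ∏ j, (z - μ j)) :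
    b 0 = κ := by
  have h1 := congrArg constantCoeff (reversedSeries_eq_prod h)
  rw [constantCoeff_reversedSeries, map_mul, map_prod] at h1
  simpa using h1

end Reversal

/-! ### Uniqueness of the solutions of the quadratic equations -/

section Uniqueness

open PowerSeries

/-- At `x`, the coefficients of the series `a` have the coefficients of `a'` as derivatives. -/
def HasCoeffDerivAt (a : ℝ → PowerSeries ℂ) (a' : PowerSeries ℂ) (x : ℝ) : Prop :=
  ∀ l, HasDerivAt (fun x' => coeff l (a x')) (coeff l a') x

theorem HasCoeffDerivAt.const_mul {a : ℝ → PowerSeries ℂ} {a' : PowerSeries ℂ} {x : ℝ}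
    (h : HasCoeffDerivAt a a' x) (κ : PowerSeries ℂ) :
    HasCoeffDerivAt (fun x' => κ * a x') (κ * a') x := by
  intro l
  simp only [coeff_mul]
  exact HasDerivAt.fun_sum fun i _ => (h i.2).const_mul _

theorem HasCoeffDerivAt.X_pow_dvd {U : Set ℝ} (hU : IsOpen U) {a b a' b' : ℝ → PowerSeries ℂ}
    (ha : ∀ x ∈ U, HasCoeffDerivAt a (a' x) x) (hb : ∀ x ∈ U, HasCoeffDerivAt b (b' x) x)
    {m : ℕ} (h : ∀ x ∈ U, X ^ m ∣ a x - b x) : ∀ x ∈ U, X ^ m ∣ a' x - b' x := by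
  intro x hx
  rw [X_pow_dvd_iff]
  intro l hl
  have hd := (ha x hx l).sub (hb x hx l)
  have h0 : (fun x' => coeff l (a x')) - (fun x' => coeff l (b x')) =ᶠ[nhds x] fun _ => 0 := by
    filter_upwards [hU.mem_nhds hx] with x' hx'
    simpa using X_pow_dvd_iff.1 (h x' hx') l hl
  rw [map_sub]
  exact (hd.congr_of_eventuallyEq h0.symm).unique (hasDerivAt_const x 0)

theorem dvd_of_dvd_mul_of_constantCoeff_ne_zero {a e u : PowerSeries ℂ}
    (hu : constantCoeff u ≠ 0) (h : a ∣ e * u) : a ∣ e :=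
  (isUnit_iff_constantCoeff.2 (isUnit_iff_ne_zero.2 hu)).dvd_mul_right.1 h

theorem eq_of_forall_X_pow_dvd_sub {a b : PowerSeries ℂ} (h : ∀ m, X ^ m ∣ a - b) : a = b := by
  rw [← sub_eq_zero]
  ext l
  exact X_pow_dvd_iff.1 (h (l + 1)) l (Nat.lt_succ_self l)

/-- The quadratic KdV equation determines a series with constant coefficient `1`: up to terms
with a factor `ζ`, the difference `e` of two solutions satisfies `8 e = 0`. -/
theorem kdv_series_unique {U : Set ℝ} (hU : IsOpen U) {V : ℝ → ℂ} {s : PowerSeries ℂ}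
    {a a' a'' b b' b'' : ℝ → PowerSeries ℂ}
    (ha : ∀ x ∈ U, HasCoeffDerivAt a (a' x) x) (ha' : ∀ x ∈ U, HasCoeffDerivAt a' (a'' x) x)
    (hb : ∀ x ∈ U, HasCoeffDerivAt b (b' x) x) (hb' : ∀ x ∈ U, HasCoeffDerivAt b' (b'' x) x)
    (ha0 : ∀ x ∈ U, constantCoeff (a x) = 1) (hb0 : ∀ x ∈ U, constantCoeff (b x) = 1)
    (hae : ∀ x ∈ U, X * (2 * a x * a'' x - a' x ^ 2 - 4 * C (V x) * a x ^ 2) + 4 * a x ^ 2 = s)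
    (hbe : ∀ x ∈ U, X * (2 * b x * b'' x - b' x ^ 2 - 4 * C (V x) * b x ^ 2) + 4 * b x ^ 2 = s) :
    ∀ x ∈ U, a x = b x := by
  have key : ∀ m, ∀ x ∈ U, X ^ m ∣ a x - b x := by
    intro m
    induction m with
    | zero => simp
    | succ m ih =>
      intro x hx
      have h1 := HasCoeffDerivAt.X_pow_dvd hU ha hb ih
      have h2 := HasCoeffDerivAt.X_pow_dvd hU ha' hb' h1
      refine dvd_of_dvd_mul_of_constantCoeff_ne_zero (u := 4 * (a x + b x)) ?_ ?_
      · rw [map_mul, map_add, ha0 x hx, hb0 x hx, map_ofNat]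
        norm_num
      · have heq : (a x - b x) * (4 * (a x + b x)) =
            X * ((a x - b x) * (4 * C (V x) * (a x + b x) - 2 * a'' x)
              - (a'' x - b'' x) * (2 * b x) + (a' x - b' x) * (a' x + b' x)) := by
          linear_combination hae x hx - hbe x hx
        rw [heq, pow_succ']
        exact mul_dvd_mul_left X (dvd_add (dvd_sub (Dvd.dvd.mul_right (ih x hx) _)
          (Dvd.dvd.mul_right (h2 x hx) _)) (Dvd.dvd.mul_right (h1 x hx) _))
  exact fun x hx => eq_of_forall_X_pow_dvd_sub fun m => key m x hx

/-- The AKNS equations for `f` and `h`, with the quadratic first integral, determine the series: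
one power of `ζ` is gained alternately for `g` and for `f, h`. -/
theorem akns_series_unique {U : Set ℝ} (hU : IsOpen U) {p q : ℝ → ℂ} {k : ℂ} {s : PowerSeries ℂ}
    {a a' b c c' α α' β γ γ' : ℝ → PowerSeries ℂ}
    (ha : ∀ x ∈ U, HasCoeffDerivAt a (a' x) x) (hc : ∀ x ∈ U, HasCoeffDerivAt c (c' x) x)
    (hα : ∀ x ∈ U, HasCoeffDerivAt α (α' x) x) (hγ : ∀ x ∈ U, HasCoeffDerivAt γ (γ' x) x)
    (hb0 : ∀ x ∈ U, constantCoeff (b x) = 1) (hβ0 : ∀ x ∈ U, constantCoeff (β x) = 1)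
    (hae : ∀ x ∈ U, a x = X * (C k * a' x) - C (q x) * b x)
    (hαe : ∀ x ∈ U, α x = X * (C k * α' x) - C (q x) * β x)
    (hce : ∀ x ∈ U, c x = -(X * (C k * c' x)) + C (p x) * b x)
    (hγe : ∀ x ∈ U, γ x = -(X * (C k * γ' x)) + C (p x) * β x)
    (hbe : ∀ x ∈ U, b x ^ 2 - X ^ 2 * (a x * c x) = s)
    (hβe : ∀ x ∈ U, β x ^ 2 - X ^ 2 * (α x * γ x) = s) :
    ∀ x ∈ U, a x = α x ∧ c x = γ x := by
  have key : ∀ m, ∀ x ∈ U, X ^ m ∣ a x - α x ∧ X ^ m ∣ c x - γ x ∧ X ^ (m + 1) ∣ b x - β x := by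
    intro m
    induction m with
    | zero =>
      intro x hx
      refine ⟨by simp, by simp, ?_⟩
      rw [zero_add, pow_one, X_dvd_iff, map_sub, hb0 x hx, hβ0 x hx, sub_self]
    | succ m ih =>
      intro x hx
      have h1 := HasCoeffDerivAt.X_pow_dvd hU ha hα (fun x hx => (ih x hx).1) x hx
      have h2 := HasCoeffDerivAt.X_pow_dvd hU hc hγ (fun x hx => (ih x hx).2.1) x hx
      have h3 := (ih x hx).2.2
      have ea : X ^ (m + 1) ∣ a x - α x := by
        have : a x - α x = X * (a' x - α' x) * C k - (b x - β x) * C (q x) := by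
          linear_combination hae x hx - hαe x hx
        rw [this]
        refine dvd_sub (Dvd.dvd.mul_right ?_ _) (Dvd.dvd.mul_right h3 _)
        rw [pow_succ']
        exact mul_dvd_mul_left X h1
      have ec : X ^ (m + 1) ∣ c x - γ x := by
        have : c x - γ x = (b x - β x) * C (p x) - X * (c' x - γ' x) * C k := by
          linear_combination hce x hx - hγe x hx
        rw [this]
        refine dvd_sub (Dvd.dvd.mul_right h3 _) (Dvd.dvd.mul_right ?_ _)
        rw [pow_succ']
        exact mul_dvd_mul_left X h2
      refine ⟨ea, ec, ?_⟩
      refine dvd_of_dvd_mul_of_constantCoeff_ne_zero (u := b x + β x) ?_ ?_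
      · rw [map_add, hb0 x hx, hβ0 x hx]
        norm_num
      · have heq : (b x - β x) * (b x + β x) =
            X * ((a x - α x) * (X * c x) + (c x - γ x) * (X * α x)) := by
          linear_combination hbe x hx - hβe x hx
        rw [heq, pow_succ']
        exact mul_dvd_mul_left X (dvd_add (Dvd.dvd.mul_right ea _) (Dvd.dvd.mul_right ec _))
  exact fun x hx => ⟨eq_of_forall_X_pow_dvd_sub fun m => (key m x hx).1,
    eq_of_forall_X_pow_dvd_sub fun m => (key m x hx).2.1⟩

/-- The linear Toda equation and the quadratic first integral determine the two series at
all lattice sites. -/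
theorem toda_series_unique {A b : ℤ → ℂ} {s : PowerSeries ℂ} {F G Φ Γ : ℤ → PowerSeries ℂ}
    (hG0 : ∀ n, constantCoeff (G n) = -1) (hΓ0 : ∀ n, constantCoeff (Γ n) = -1)
    (hFl : ∀ n, 2 * ((1 + C (b n) * X) * F n) + G n + G (n - 1) = 0)
    (hΦl : ∀ n, 2 * ((1 + C (b n) * X) * Φ n) + Γ n + Γ (n - 1) = 0)
    (hFq : ∀ n, G n ^ 2 - 4 * C (A n) * X ^ 2 * (F n * F (n + 1)) = s)
    (hΦq : ∀ n, Γ n ^ 2 - 4 * C (A n) * X ^ 2 * (Φ n * Φ (n + 1)) = s) (n : ℤ) :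
    F n = Φ n := by
  have hlin : ∀ m, (∀ n, X ^ m ∣ G n - Γ n) → ∀ n, X ^ m ∣ F n - Φ n := by
    intro m h n
    refine dvd_of_dvd_mul_of_constantCoeff_ne_zero (u := 2 * (1 + C (b n) * X)) ?_ ?_
    · rw [map_mul, map_ofNat]
      simp
    · have heq : (F n - Φ n) * (2 * (1 + C (b n) * X)) =
          -((G n - Γ n) + (G (n - 1) - Γ (n - 1))) := by
        linear_combination hFl n - hΦl n
      rw [heq]
      exact (dvd_add (h n) (h (n - 1))).neg_right
  have key : ∀ m, ∀ n, X ^ m ∣ G n - Γ n := by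
    intro m
    induction m with
    | zero => simp
    | succ m ih =>
      intro n
      refine dvd_of_dvd_mul_of_constantCoeff_ne_zero (u := G n + Γ n) ?_ ?_
      · rw [map_add, hG0, hΓ0]
        norm_num
      · have heq : (G n - Γ n) * (G n + Γ n) =
            X * ((F n - Φ n) * (4 * C (A n) * X * F (n + 1)) +
              (F (n + 1) - Φ (n + 1)) * (4 * C (A n) * X * Φ n)) := by
          linear_combination hFq n - hΦq n
        rw [heq, pow_succ']
        exact mul_dvd_mul_left X (dvd_add (Dvd.dvd.mul_right (hlin m ih n) _)
          (Dvd.dvd.mul_right (hlin m ih (n + 1)) _))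
  exact eq_of_forall_X_pow_dvd_sub fun m => hlin m (key m) n

end Uniqueness

/-! ### Comparison of the infinite series with the spectral polynomials -/

section Comparison

open PowerSeries

theorem hasCoeffDerivAt_reversedSeries {g : ℕ} {b b' : ℕ → ℝ → ℂ} {x : ℝ}
    (h : ∀ k ≤ g, HasDerivAt (b k) (b' k x) x) :
    HasCoeffDerivAt (fun x => (reversedSeries g fun k => b k x))
      (reversedSeries g fun k => b' k x) x := by
  intro k
  simp only [coeff_reversedSeries]
  split_ifs with hk
  · exact h k hk
  · exact hasDerivAt_const x 0

theorem hasCoeffDerivAt_kdvSeries {v : ℕ → ℝ → ℂ} {x : ℝ}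
    (hv : ∀ k, HasDerivAt (v k) (v (k + 1) x) x) (f : ℕ → MvPolynomial ℕ ℂ) :
    HasCoeffDerivAt (fun x => kdvSeries f fun k => v k x)
      (kdvSeries (fun l => kdvD (f l)) fun k => v k x) x := by
  intro l
  simp only [kdvSeries, coeff_mk, kdvD_eq_shiftD]
  exact hasDerivAt_eval_shiftD hv _

/-- If a monic polynomial `F` in `z` of degree `g` satisfies the KdV curve equation, then the
generating series of the KdV recursion is `c̃ R ^ (-1/2) F` as a series in `1 / z`. -/
theorem kdvSeries_eq {g : ℕ} {U : Set ℝ} (hU : IsOpen U) (E : Fin (2 * g + 1) → ℂ)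
    {ct : ℕ → ℂ} {ft : ℕ → MvPolynomial ℕ ℂ} (hft : IsKdVSeq ct ft) {v b b' b'' : ℕ → ℝ → ℂ}
    (hv : ∀ x ∈ U, ∀ k, HasDerivAt (v k) (v (k + 1) x) x)
    (hb : ∀ x ∈ U, ∀ k ≤ g, HasDerivAt (b k) (b' k x) x)
    (hb' : ∀ x ∈ U, ∀ k ≤ g, HasDerivAt (b' k) (b'' k x) x)
    (hb0 : ∀ x ∈ U, b 0 x = 1)
    (hcurve : ∀ x ∈ U, ∀ z : ℂ,
      1 / 2 * (∑ j ∈ Finset.range (g + 1), b'' (g - j) x * z ^ j) *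
          (∑ j ∈ Finset.range (g + 1), b (g - j) x * z ^ j)
        - 1 / 4 * (∑ j ∈ Finset.range (g + 1), b' (g - j) x * z ^ j) ^ 2
        - (v 0 x - z) * (∑ j ∈ Finset.range (g + 1), b (g - j) x * z ^ j) ^ 2 =
          curvePoly E z) :
    ∀ x ∈ U, kdvSeries ft (fun k => v k x) =
      mk ct * invSqrtSeries E * (reversedSeries g fun k => b k x) := by
  have hct : ct 0 = 1 := by rw [← hft.const, hft.zero, map_one]
  have hred : ∀ x ∈ U,
      X * (2 * (reversedSeries g (fun k => b k x)) * reversedSeries g (fun k => b'' k x)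
        - (reversedSeries g (fun k => b' k x)) ^ 2
        - 4 * C (v 0 x) * (reversedSeries g (fun k => b k x)) ^ 2)
        + 4 * (reversedSeries g (fun k => b k x)) ^ 2 = 4 * reversedCurve E := by
    intro x hx
    have hpoly : Polynomial.X * (2 * reversedPoly g (fun k => b k x) *
          reversedPoly g (fun k => b'' k x) - reversedPoly g (fun k => b' k x) ^ 2
        - 4 * Polynomial.C (v 0 x) * reversedPoly g (fun k => b k x) ^ 2)
        + 4 * reversedPoly g (fun k => b k x) ^ 2 =
        4 * ∏ m, (1 - Polynomial.C (E m) * Polynomial.X) := by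
      refine polynomial_eq_of_forall_ne_zero fun ζ hζ => ?_
      have h := hcurve x hx ζ⁻¹
      simp only [Polynomial.eval_add, Polynomial.eval_sub, Polynomial.eval_mul,
        Polynomial.eval_pow, Polynomial.eval_X, Polynomial.eval_C, Polynomial.eval_ofNat,
        eval_reversedPoly g _ hζ, eval_prod_one_sub E hζ]
      rw [curvePoly] at h
      have hz : ζ * ζ⁻¹ = 1 := mul_inv_cancel₀ hζ
      linear_combination 4 * ζ ^ (2 * g + 1) * h - 4 * ζ ^ (2 * g) *
        (∑ j ∈ Finset.range (g + 1), b (g - j) x * ζ⁻¹ ^ j) ^ 2 * hz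
    have h := congrArg (Polynomial.toPowerSeries) hpoly
    simp only [← Polynomial.coeToPowerSeries.ringHom_apply, map_add, map_sub, map_mul, map_pow,
      map_ofNat] at h
    simpa only [Polynomial.coeToPowerSeries.ringHom_apply, Polynomial.coe_X, Polynomial.coe_C,
      coe_reversedPoly, coe_prod_one_sub] using h
  refine kdv_series_unique (V := v 0) (s := 4 * mk ct ^ 2) hU
    (fun x hx => hasCoeffDerivAt_kdvSeries (hv x hx) ft)
    (fun x hx => hasCoeffDerivAt_kdvSeries (hv x hx) _)
    (fun x hx => (hasCoeffDerivAt_reversedSeries (hb x hx)).const_mul _)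
    (fun x hx => (hasCoeffDerivAt_reversedSeries (hb' x hx)).const_mul _) ?_ ?_
    (fun x _ => hft.first_integral _) ?_
  · intro x _
    rw [← coeff_zero_eq_constantCoeff_apply, kdvSeries, coeff_mk, hft.zero, map_one]
  · intro x hx
    rw [map_mul, map_mul, constantCoeff_invSqrtSeries, constantCoeff_reversedSeries, hb0 x hx,
      ← coeff_zero_eq_constantCoeff_apply, coeff_mk, hct]
    norm_num
  · intro x hx
    linear_combination (mk ct * invSqrtSeries E) ^ 2 * hred x hx
      + 4 * mk ct ^ 2 * invSqrtSeries_sq_mul E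

theorem hasCoeffDerivAt_aknsSeries {v : ℕ ⊕ ℕ → ℝ → ℂ} {x : ℝ}
    (hv : ∀ i, HasDerivAt (v i) (v (Sum.map Nat.succ Nat.succ i) x) x)
    (f : ℕ → MvPolynomial (ℕ ⊕ ℕ) ℂ) :
    HasCoeffDerivAt (fun x => aknsSeries f fun i => v i x)
      (aknsSeries (fun l => aknsD (f l)) fun i => v i x) x := by
  intro l
  simp only [aknsSeries, coeff_mk, aknsD_eq_shiftD]
  exact hasDerivAt_eval_shiftD hv _

/-- The generating series of the AKNS recursion are `c̃ R ^ (-1/2) F` and `c̃ R ^ (-1/2) H`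
as series in `1 / z`. -/
theorem aknsSeries_eq {gen : ℕ} {U : Set ℝ} (hU : IsOpen U) (E : Fin (2 * gen + 2) → ℂ)
    {c ct : ℕ → ℂ} {f g h ft gt ht : ℕ → MvPolynomial (ℕ ⊕ ℕ) ℂ}
    (hs : IsAKNSSeq c f g h) (hst : IsAKNSSeq ct ft gt ht) {v : ℕ ⊕ ℕ → ℝ → ℂ}
    (hv : ∀ x ∈ U, ∀ i, HasDerivAt (v i) (v (Sum.map Nat.succ Nat.succ i) x) x)
    (hf : ∀ x ∈ U, MvPolynomial.eval (fun i => v i x) (f (gen + 1)) = 0)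
    (hh : ∀ x ∈ U, MvPolynomial.eval (fun i => v i x) (h (gen + 1)) = 0)
    (hcurve : ∀ x ∈ U, ∀ z : ℂ,
      (∑ j ∈ Finset.range (gen + 1 + 1),
          MvPolynomial.eval (fun i => v i x) (g (gen + 1 - j)) * z ^ j) ^ 2
        - (∑ j ∈ Finset.range (gen + 1),
            MvPolynomial.eval (fun i => v i x) (f (gen - j)) * z ^ j) *
          (∑ j ∈ Finset.range (gen + 1),
            MvPolynomial.eval (fun i => v i x) (h (gen - j)) * z ^ j) = curvePoly E z) :
    ∀ x ∈ U, aknsSeries ft (fun i => v i x) = mk ct * invSqrtSeries E *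
        (reversedSeries gen fun k => MvPolynomial.eval (fun i => v i x) (f k)) ∧
      aknsSeries ht (fun i => v i x) = mk ct * invSqrtSeries E *
        (reversedSeries gen fun k => MvPolynomial.eval (fun i => v i x) (h k)) := by
  have hct : ct 0 = 1 := by rw [← hst.const, hst.g_zero, map_one]
  have hFe : ∀ x ∈ U,
      (reversedSeries gen (fun k => MvPolynomial.eval (fun i => v i x) (f k))) =
      X * (C (Complex.I / 2) *
        reversedSeries gen (fun k => MvPolynomial.eval (fun i => v i x) (aknsD (f k))))
      - C (Complex.I * v (Sum.inr 0) x) *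
        reversedSeries (gen + 1) (fun k => MvPolynomial.eval (fun i => v i x) (g k)) := by
    intro x hx
    ext l
    rcases l with _ | l
    · rw [map_sub, coeff_zero_X_mul, coeff_C_mul, coeff_reversedSeries, coeff_reversedSeries]
      simp [hs.f_zero, hs.g_zero]
    · have h1 := congrArg (MvPolynomial.eval fun i => v i x) (hs.f_step l)
      simp only [map_sub, map_mul, MvPolynomial.eval_C, MvPolynomial.eval_X] at h1
      rw [map_sub, coeff_succ_X_mul, coeff_C_mul, coeff_C_mul, coeff_reversedSeries,
        coeff_reversedSeries, coeff_reversedSeries]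
      rcases lt_trichotomy l gen with hl | rfl | hl
      · rw [if_pos (by omega), if_pos (by omega), if_pos (by omega), h1]
      · rw [if_neg (by omega), if_pos le_rfl, if_pos le_rfl, ← h1, hf x hx]
      · rw [if_neg (by omega), if_neg (by omega), if_neg (by omega)]
        simp
  have hHe : ∀ x ∈ U,
      (reversedSeries gen (fun k => MvPolynomial.eval (fun i => v i x) (h k))) =
      -(X * (C (Complex.I / 2) *
        reversedSeries gen (fun k => MvPolynomial.eval (fun i => v i x) (aknsD (h k)))))
      + C (Complex.I * v (Sum.inl 0) x) *
        reversedSeries (gen + 1) (fun k => MvPolynomial.eval (fun i => v i x) (g k)) := by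
    intro x hx
    ext l
    rcases l with _ | l
    · rw [map_add, map_neg, coeff_zero_X_mul, coeff_C_mul, coeff_reversedSeries,
        coeff_reversedSeries]
      simp [hs.h_zero, hs.g_zero]
    · have h1 := congrArg (MvPolynomial.eval fun i => v i x) (hs.h_step l)
      simp only [map_add, map_neg, map_mul, MvPolynomial.eval_C, MvPolynomial.eval_X] at h1
      rw [map_add, map_neg, coeff_succ_X_mul, coeff_C_mul, coeff_C_mul, coeff_reversedSeries,
        coeff_reversedSeries, coeff_reversedSeries]
      rcases lt_trichotomy l gen with hl | rfl | hl
      · rw [if_pos (by omega), if_pos (by omega), if_pos (by omega), h1]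
      · rw [if_neg (by omega), if_pos le_rfl, if_pos le_rfl, ← h1, hh x hx]
      · rw [if_neg (by omega), if_neg (by omega), if_neg (by omega)]
        simp
  have hGe : ∀ x ∈ U,
      (reversedSeries (gen + 1) (fun k => MvPolynomial.eval (fun i => v i x) (g k)) :
        PowerSeries ℂ) ^ 2 - X ^ 2 *
      ((reversedSeries gen (fun k => MvPolynomial.eval (fun i => v i x) (f k))) *
        reversedSeries gen (fun k => MvPolynomial.eval (fun i => v i x) (h k))) =
      reversedCurve E := by
    intro x hx
    have hpoly : reversedPoly (gen + 1) (fun k => MvPolynomial.eval (fun i => v i x) (g k)) ^ 2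
        - Polynomial.X ^ 2 *
          (reversedPoly gen (fun k => MvPolynomial.eval (fun i => v i x) (f k)) *
            reversedPoly gen (fun k => MvPolynomial.eval (fun i => v i x) (h k))) =
        ∏ m, (1 - Polynomial.C (E m) * Polynomial.X) := by
      refine polynomial_eq_of_forall_ne_zero fun ζ hζ => ?_
      have h := hcurve x hx ζ⁻¹
      simp only [Polynomial.eval_sub, Polynomial.eval_mul,
        Polynomial.eval_pow, Polynomial.eval_X, eval_reversedPoly _ _ hζ, eval_prod_one_sub E hζ]
      rw [curvePoly] at h
      linear_combination ζ ^ (2 * gen + 2) * h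
    have h := congrArg (Polynomial.toPowerSeries) hpoly
    simp only [← Polynomial.coeToPowerSeries.ringHom_apply (R := ℂ), map_sub, map_mul, map_pow]
      at h
    simpa only [Polynomial.coeToPowerSeries.ringHom_apply, Polynomial.coe_X,
      coe_reversedPoly, coe_prod_one_sub] using h
  have hderiv : ∀ P : ℕ → MvPolynomial (ℕ ⊕ ℕ) ℂ, ∀ x ∈ U, HasCoeffDerivAt
      (fun x => mk ct * invSqrtSeries E *
        (reversedSeries gen (fun k => MvPolynomial.eval (fun i => v i x) (P k))))
      (mk ct * invSqrtSeries E *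
        reversedSeries gen (fun k => MvPolynomial.eval (fun i => v i x) (aknsD (P k)))) x := by
    intro P x hx
    refine (hasCoeffDerivAt_reversedSeries
      (b' := fun k x => MvPolynomial.eval (fun i => v i x) (aknsD (P k)))
      fun k _ => ?_).const_mul _
    rw [aknsD_eq_shiftD]
    exact hasDerivAt_eval_shiftD (hv x hx) _
  refine akns_series_unique (k := Complex.I / 2) (s := mk ct ^ 2)
    (p := fun x => Complex.I * v (Sum.inl 0) x) (q := fun x => Complex.I * v (Sum.inr 0) x)
    (b := fun x => aknsSeries gt fun i => v i x)
    (β := fun x => mk ct * invSqrtSeries E *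
      reversedSeries (gen + 1) (fun k => MvPolynomial.eval (fun i => v i x) (g k))) hU
    (fun x hx => hasCoeffDerivAt_aknsSeries (hv x hx) ft)
    (fun x hx => hasCoeffDerivAt_aknsSeries (hv x hx) ht)
    (hderiv f) (hderiv h) ?_ ?_ (fun x _ => hst.series_f _) ?_ (fun x _ => hst.series_h _) ?_
    (fun x _ => hst.first_integral _) ?_
  · intro x _
    rw [← coeff_zero_eq_constantCoeff_apply, aknsSeries, coeff_mk, hst.g_zero, map_one]
  · intro x hx
    rw [map_mul, map_mul, constantCoeff_invSqrtSeries, constantCoeff_reversedSeries,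
      ← coeff_zero_eq_constantCoeff_apply, coeff_mk, hct, hs.g_zero, map_one]
    norm_num
  · intro x hx
    linear_combination mk ct * invSqrtSeries E * hFe x hx
  · intro x hx
    linear_combination mk ct * invSqrtSeries E * hHe x hx
  · intro x hx
    linear_combination (mk ct * invSqrtSeries E) ^ 2 * hGe x hx
      + mk ct ^ 2 * invSqrtSeries_sq_mul E

/-- The generating series of the Toda recursion is `c̃ R ^ (-1/2) F` as a series in `1 / z`,
at every lattice site. -/
theorem todaSeriesF_eq {gen : ℕ} (E : Fin (2 * gen + 2) → ℂ)
    {c ct : ℕ → ℂ} {f g ft gt : ℕ → MvPolynomial (ℤ ⊕ ℤ) ℂ}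
    (hs : IsTodaSeq c f g) (hst : IsTodaSeq ct ft gt) {J : Set ℝ} {a b : ℤ → ℝ → ℂ}
    (hstat : IsStationaryToda gen E J f g a b) {t : ℝ} (ht : t ∈ J) (n : ℤ) :
    todaSeriesF ft (fun k => a k t) (fun k => b k t) n = mk ct * invSqrtSeries E *
      (reversedSeries gen fun k => todaCoeff f a b k n t) := by
  have hct : ct 0 = 1 := by rw [← hst.const, hst.f_zero, map_one]
  let F : ℤ → PowerSeries ℂ := fun n => reversedSeries gen fun k => todaCoeff f a b k n t
  let G : ℤ → PowerSeries ℂ := fun n =>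
    X * (reversedSeries gen fun k => todaCoeff g a b k n t) - 1
      + C (todaCoeff f a b (gen + 1) n t) * X ^ (gen + 1)
  have hlin : ∀ n, 2 * ((1 + C (b n t) * X) * F n) + G n + G (n - 1) = 0 := by
    intro n
    have hcoe2 : (2 : PowerSeries ℂ) = C 2 := (map_ofNat _ 2).symm
    have key : 2 * F n + X * (2 * (C (b n t) * F n))
        + X * ((reversedSeries gen fun k => todaCoeff g a b k n t)
          + (reversedSeries gen fun k => todaCoeff g a b k (n - 1) t))
        + C (todaCoeff f a b (gen + 1) n t) * X ^ (gen + 1)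
        + C (todaCoeff f a b (gen + 1) (n - 1) t) * X ^ (gen + 1) = 2 := by
      rw [hcoe2]
      ext l
      rcases l with _ | l
      · simp [F, constantCoeff_reversedSeries, todaCoeff, hs.f_zero]
      · have hl := congrArg
          (MvPolynomial.eval (Sum.elim (fun k => a (n + k) t) fun k => b (n + k) t)) (hs.f_step l)
        have hsh := eval_todaShift (fun k => a k t) (fun k => b k t) (-1) n (g l)
        simp only [map_add, map_mul, hsh, MvPolynomial.eval_X, Sum.elim_inr, add_zero,
          map_ofNat, map_zero] at hl
        simp only [map_add, coeff_succ_X_mul, coeff_C_mul, F, coeff_reversedSeries, coeff_X_pow,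
          add_left_inj]
        rw [coeff_C, if_neg (Nat.succ_ne_zero l)]
        rcases lt_trichotomy l gen with hl' | rfl | hl'
        · rw [if_pos (by omega), if_pos (by omega), if_pos (by omega), if_pos (by omega),
            if_neg (by omega : l ≠ gen)]
          simp only [todaCoeff, sub_eq_add_neg]
          linear_combination hl
        · have h1 := hstat.stationary_a (n - 1) t ht
          rw [sub_add_cancel] at h1
          rw [if_neg (by omega), if_pos le_rfl, if_pos le_rfl, if_pos le_rfl, if_pos rfl]
          linear_combination h1
        · rw [if_neg (by omega), if_neg (by omega), if_neg (by omega), if_neg (by omega),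
            if_neg (by omega : l ≠ gen)]
          simp
    simp only [G]
    linear_combination key
  have hquad : ∀ n, G n ^ 2 - 4 * C (a n t ^ 2) * X ^ 2 * (F n * F (n + 1)) = reversedCurve E := by
    intro n
    have hpoly : (Polynomial.X * (reversedPoly gen fun k => todaCoeff g a b k n t) - 1
        + Polynomial.C (todaCoeff f a b (gen + 1) n t) * Polynomial.X ^ (gen + 1)) ^ 2
        - 4 * Polynomial.C (a n t ^ 2) * Polynomial.X ^ 2 *
          ((reversedPoly gen fun k => todaCoeff f a b k n t) *
            (reversedPoly gen fun k => todaCoeff f a b k (n + 1) t)) =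
        ∏ m, (1 - Polynomial.C (E m) * Polynomial.X) := by
      refine polynomial_eq_of_forall_ne_zero fun ζ hζ => ?_
      have h := hstat.curve n t ht ζ⁻¹
      simp only [Polynomial.eval_add, Polynomial.eval_sub, Polynomial.eval_mul,
        Polynomial.eval_pow, Polynomial.eval_X, Polynomial.eval_C, Polynomial.eval_ofNat,
        Polynomial.eval_one, eval_reversedPoly _ _ hζ, eval_prod_one_sub E hζ]
      rw [curvePoly, todaG, todaF, todaF] at h
      have hz : ζ ^ (gen + 1) * ζ⁻¹ ^ (gen + 1) = 1 := by
        rw [← mul_pow, mul_inv_cancel₀ hζ, one_pow]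
      have hG : ζ * (ζ ^ gen * ∑ j ∈ Finset.range (gen + 1),
            todaCoeff g a b (gen - j) n t * ζ⁻¹ ^ j) - 1
          + todaCoeff f a b (gen + 1) n t * ζ ^ (gen + 1) =
          ζ ^ (gen + 1) * (-ζ⁻¹ ^ (gen + 1) + ∑ j ∈ Finset.range (gen + 1),
            todaCoeff g a b (gen - j) n t * ζ⁻¹ ^ j + todaCoeff f a b (gen + 1) n t) := by
        linear_combination hz
      rw [hG]
      linear_combination ζ ^ (2 * gen + 2) * h
    have h := congrArg (Polynomial.toPowerSeries) hpoly
    simp only [← Polynomial.coeToPowerSeries.ringHom_apply (R := ℂ), map_add, map_sub, map_mul,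
      map_pow, map_ofNat, map_one] at h
    simpa only [Polynomial.coeToPowerSeries.ringHom_apply, Polynomial.coe_X, Polynomial.coe_C,
      coe_reversedPoly, coe_prod_one_sub, map_pow] using h
  have hF0 : ∀ n, constantCoeff (todaSeriesG gt (fun k => a k t) (fun k => b k t) n) = -1 := by
    intro n
    simp [todaSeriesG]
  have hG0 : ∀ n, constantCoeff (mk ct * invSqrtSeries E * G n) = -1 := by
    intro n
    rw [map_mul, map_mul, constantCoeff_invSqrtSeries,
      ← coeff_zero_eq_constantCoeff_apply, coeff_mk, hct]
    simp [G]
  have hlin' : ∀ n, 2 * ((1 + C (b n t) * X) * (mk ct * invSqrtSeries E * F n))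
      + mk ct * invSqrtSeries E * G n + mk ct * invSqrtSeries E * G (n - 1) = 0 := by
    intro n
    linear_combination mk ct * invSqrtSeries E * hlin n
  have hquad' : ∀ n, (mk ct * invSqrtSeries E * G n) ^ 2 - 4 * C (a n t ^ 2) * X ^ 2 *
      (mk ct * invSqrtSeries E * F n * (mk ct * invSqrtSeries E * F (n + 1))) = mk ct ^ 2 := by
    intro n
    linear_combination (mk ct * invSqrtSeries E) ^ 2 * hquad n
      + mk ct ^ 2 * invSqrtSeries_sq_mul E
  exact toda_series_unique hF0 hG0 (fun n => hst.series_linear _ _ n) hlin'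
    (fun n => hst.first_integral _ _ n) hquad' n

end Comparison

/-! ### Operations on paths on the curve -/

section Paths

open Set

theorem formDensity_reparam {g : ℕ} (l : Fin g) {Z W Y Z₁ W₁ Y₁ : ℝ → ℂ} {κ : ℂ} (hκ : κ ≠ 0)
    {φ : ℝ → ℝ} {φ' s : ℝ} (hφ : HasDerivAt φ φ' s)
    (hZd : DifferentiableAt ℝ Z (φ s)) (hWd : DifferentiableAt ℝ W (φ s))
    (hZ : Z₁ =ᶠ[nhds s] fun t => κ * Z (φ t)) (hW : W₁ =ᶠ[nhds s] fun t => κ * W (φ t))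
    (hY : Y₁ s = κ ^ (g + 1) * Y (φ s)) :
    formDensity g l Z₁ W₁ Y₁ s = φ' • formDensity g l Z W Y (φ s) := by
  have dZ : deriv Z₁ s = κ * (φ' • deriv Z (φ s)) :=
    ((hZd.hasDerivAt.scomp s hφ).const_mul κ |>.congr_of_eventuallyEq hZ).deriv
  have dW : deriv W₁ s = κ * (φ' • deriv W (φ s)) :=
    ((hWd.hasDerivAt.scomp s hφ).const_mul κ |>.congr_of_eventuallyEq hW).deriv
  have hpow : κ ^ (g + 1) = κ ^ (l : ℕ) * κ ^ (g - 1 - (l : ℕ)) * κ ^ 2 := by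
    rw [← pow_add, ← pow_add]
    congr 1
    have := l.isLt
    omega
  rw [formDensity, formDensity, dZ, dW, hZ.eq_of_nhds, hW.eq_of_nhds, hY]
  simp only [Complex.real_smul]
  by_cases hY0 : Y (φ s) = 0
  · simp [hY0]
  · rw [← mul_div_assoc, div_eq_div_iff (mul_ne_zero (pow_ne_zero _ hκ) hY0) hY0, hpow]
    ring

namespace CurvePath

variable {g n : ℕ} {E : Fin n → ℂ}

theorem differentiableAt_Z (γ : CurvePath g E) {s : ℝ} (hs : s ∈ Ioo (0 : ℝ) 1) :
    DifferentiableAt ℝ γ.Z s :=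
  (γ.smooth_Z.differentiableOn one_ne_zero).differentiableAt (Icc_mem_nhds hs.1 hs.2)

theorem differentiableAt_W (γ : CurvePath g E) {s : ℝ} (hs : s ∈ Ioo (0 : ℝ) 1) :
    DifferentiableAt ℝ γ.W s :=
  (γ.smooth_W.differentiableOn one_ne_zero).differentiableAt (Icc_mem_nhds hs.1 hs.2)

theorem homCurvePoly_smul (hn : n ≤ 2 * g + 2) (E : Fin n → ℂ) (κ Z W : ℂ) :
    homCurvePoly g E (κ * Z) (κ * W) = (κ ^ (g + 1)) ^ 2 * homCurvePoly g E Z W := by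
  have h : ∏ m, (κ * Z - E m * (κ * W)) = κ ^ n * ∏ m, (Z - E m * W) := by
    calc ∏ m, (κ * Z - E m * (κ * W)) = ∏ m, (κ * (Z - E m * W)) :=
          Finset.prod_congr rfl fun m _ => by ring
      _ = _ := by rw [Finset.prod_mul_distrib]; simp
  have hpow : (κ ^ (g + 1)) ^ 2 = κ ^ (2 * g + 2 - n) * κ ^ n := by
    rw [← pow_mul, ← pow_add]
    congr 1
    omega
  rw [homCurvePoly, homCurvePoly, h, hpow, mul_pow]
  ring

/-- The reversed path. -/
def reverse (γ : CurvePath g E) : CurvePath g E where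
  Z s := γ.Z (1 - s)
  W s := γ.W (1 - s)
  Y s := γ.Y (1 - s)
  smooth_Z := γ.smooth_Z.comp (contDiff_const.sub contDiff_id).contDiffOn
    fun _ hs => ⟨sub_nonneg.2 hs.2, sub_le_self _ hs.1⟩
  smooth_W := γ.smooth_W.comp (contDiff_const.sub contDiff_id).contDiffOn
    fun _ hs => ⟨sub_nonneg.2 hs.2, sub_le_self _ hs.1⟩
  smooth_Y := γ.smooth_Y.comp (contDiff_const.sub contDiff_id).contDiffOn
    fun _ hs => ⟨sub_nonneg.2 hs.2, sub_le_self _ hs.1⟩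
  nonzero s hs := γ.nonzero (1 - s) ⟨sub_nonneg.2 hs.2, sub_le_self _ hs.1⟩
  eqn s hs := γ.eqn (1 - s) ⟨sub_nonneg.2 hs.2, sub_le_self _ hs.1⟩

theorem reverse_source (γ : CurvePath g E) : γ.reverse.source = γ.target := by
  simp only [source, target, reverse, sub_zero]
  rfl

theorem reverse_target (γ : CurvePath g E) : γ.reverse.target = γ.source := by
  simp only [source, target, reverse, sub_self]
  rfl

theorem reverse_integral (γ : CurvePath g E) (l : Fin g) :
    γ.reverse.integral l = -γ.integral l := by
  have h : ∀ s, formDensity g l γ.reverse.Z γ.reverse.W γ.reverse.Y s =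
      -formDensity g l γ.Z γ.W γ.Y (1 - s) := by
    intro s
    simp only [formDensity, reverse, deriv_comp_const_sub]
    ring
  simp only [integral, h, intervalIntegral.integral_neg]
  rw [intervalIntegral.integral_comp_sub_left (fun s => formDensity g l γ.Z γ.W γ.Y s)]
  simp

/-- If a path is, on `(p, q)`, a monotone reparametrization of `γ` up to a constant rescaling of
the homogeneous coordinates, then its integral over `[p, q]` is that of `γ`. -/
theorem integral_reparam (γ : CurvePath g E) (l : Fin g) {Z W Y : ℝ → ℂ} {κ : ℂ} (hκ : κ ≠ 0)
    {φ : ℝ → ℝ} (hφ : Differentiable ℝ φ) (hmono : Monotone φ) {p q : ℝ} (hpq : p ≤ q)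
    (hp : φ p = 0) (hq : φ q = 1) (hmaps : ∀ s ∈ Ioo p q, φ s ∈ Ioo (0 : ℝ) 1)
    (hZ : ∀ s ∈ Ioo p q, Z s = κ * γ.Z (φ s)) (hW : ∀ s ∈ Ioo p q, W s = κ * γ.W (φ s))
    (hY : ∀ s ∈ Ioo p q, Y s = κ ^ (g + 1) * γ.Y (φ s)) :
    ∫ s in p..q, formDensity g l Z W Y s = γ.integral l := by
  have h := MeasureTheory.integral_Icc_deriv_smul_of_deriv_nonneg (f := φ) (f' := deriv φ)
    (g := formDensity g l γ.Z γ.W γ.Y) hφ.continuous.continuousOn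
    (fun s _ => (hφ s).hasDerivAt) (fun s _ => hmono.deriv_nonneg) hpq
  rw [hp, hq, MeasureTheory.integral_Icc_eq_integral_Ioc,
    MeasureTheory.integral_Icc_eq_integral_Ioc,
    ← intervalIntegral.integral_of_le hpq, ← intervalIntegral.integral_of_le zero_le_one] at h
  rw [integral, ← h]
  rw [intervalIntegral.integral_of_le hpq, intervalIntegral.integral_of_le hpq,
    MeasureTheory.integral_Ioc_eq_integral_Ioo, MeasureTheory.integral_Ioc_eq_integral_Ioo]
  refine MeasureTheory.setIntegral_congr_fun measurableSet_Ioo fun s hs => ?_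
  have hnhds : Ioo p q ∈ nhds s := Ioo_mem_nhds hs.1 hs.2
  exact formDensity_reparam l hκ (hφ s).hasDerivAt (γ.differentiableAt_Z (hmaps s hs))
    (γ.differentiableAt_W (hmaps s hs)) (Filter.mem_of_superset hnhds hZ)
    (Filter.mem_of_superset hnhds hW) (hY s hs)

end CurvePath

/-- The homogenized curve polynomial splits as `∏ (β_i Z - α_i W)` with `2 g + 2` different
zeros `(α_i : β_i)` on the projective line; these are the branch points. -/
structure BranchPoints (g : ℕ) {n : ℕ} (E : Fin n → ℂ) (α β : Fin (2 * g + 2) → ℂ) : Prop where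
  factor : ∀ Z W, homCurvePoly g E Z W = ∏ i, (β i * Z - α i * W)
  le : n ≤ 2 * g + 2
  distinct : ∀ i j, i ≠ j → α i * β j - α j * β i ≠ 0

theorem exists_branchPoints_odd {g : ℕ} {E : Fin (2 * g + 1) → ℂ} (hE : Function.Injective E) :
    ∃ α β, BranchPoints g E α β := by
  refine ⟨Fin.cons (-1) E, Fin.cons 0 fun _ => 1, fun Z W => ?_, by omega, ?_⟩
  · rw [homCurvePoly, Fin.prod_univ_succ (n := 2 * g + 1)]
    simp
  · intro i j
    refine Fin.cases ?_ (fun i => ?_) i <;> refine Fin.cases ?_ (fun j => ?_) j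
    · simp
    · simp
    · simp
    · intro h
      simpa [sub_eq_zero, hE.eq_iff] using h

theorem exists_branchPoints_even {g : ℕ} {E : Fin (2 * g + 2) → ℂ} (hE : Function.Injective E) :
    ∃ α β, BranchPoints g E α β := by
  refine ⟨E, fun _ => 1, fun Z W => ?_, le_rfl, ?_⟩
  · simp [homCurvePoly]
  · intro i j h
    simpa [sub_eq_zero, hE.eq_iff] using h

namespace BranchPoints

variable {g n : ℕ} {E : Fin n → ℂ} {α β : Fin (2 * g + 2) → ℂ}

/-- Two different linear factors have no common zero. -/
theorem eq_zero_of_eq_zero (h : BranchPoints g E α β) {i j : Fin (2 * g + 2)} (hij : i ≠ j)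
    {Z W : ℂ} (hi : β i * Z - α i * W = 0) (hj : β j * Z - α j * W = 0) : Z = 0 ∧ W = 0 := by
  have hd := h.distinct i j hij
  constructor
  · refine (mul_eq_zero.1 (?_ : (α i * β j - α j * β i) * Z = 0)).resolve_left hd
    linear_combination α i * hj - α j * hi
  · refine (mul_eq_zero.1 (?_ : (α i * β j - α j * β i) * W = 0)).resolve_left hd
    linear_combination β i * hj - β j * hi

/-- With `ℓ_i = β_i Z - α_i W` and `K_m = ∏_{i ≠ m} ℓ_i`, differentiating `Y² = ℓ_m K_m` shows
that `K_m² (Z' W - Z W')` is `Y` times a continuous function. Since the `K_m` have no common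
zero, the density is bounded, zeros of `Y` included. -/
theorem intervalIntegrable_formDensity (h : BranchPoints g E α β) (γ : CurvePath g E)
    (l : Fin g) :
    IntervalIntegrable (formDensity g l γ.Z γ.W γ.Y) MeasureTheory.volume 0 1 := by
  set I : Set ℝ := Icc 0 1 with hI
  let L : Fin (2 * g + 2) → ℝ → ℂ := fun i s => β i * γ.Z s - α i * γ.W s
  let K : Fin (2 * g + 2) → ℝ → ℂ := fun m s => ∏ i ∈ Finset.univ.erase m, L i s
  have hL : ∀ i, ContDiffOn ℝ 1 (L i) I := fun i =>
    (contDiffOn_const.mul γ.smooth_Z).sub (contDiffOn_const.mul γ.smooth_W)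
  have hK : ∀ m, ContDiffOn ℝ 1 (K m) I := fun m => contDiffOn_prod fun i _ => hL i
  have hcont : ∀ f : ℝ → ℂ, ContDiffOn ℝ 1 f I → ContinuousOn (derivWithin f I) I := fun f hf =>
    hf.continuousOn_derivWithin (uniqueDiffOn_Icc zero_lt_one) le_rfl
  have hder : ∀ f : ℝ → ℂ, ContDiffOn ℝ 1 f I → ∀ s ∈ Ioo (0 : ℝ) 1,
      HasDerivAt f (derivWithin f I s) s := fun f hf s hs =>
    (hf.differentiableOn one_ne_zero s (Ioo_subset_Icc_self hs)).hasDerivWithinAt.hasDerivAt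
      (Icc_mem_nhds hs.1 hs.2)
  have hYK : ∀ m, ∀ s ∈ I, γ.Y s ^ 2 = L m s * K m s := by
    intro m s hs
    rw [γ.eqn s hs, h.factor]
    exact (Finset.mul_prod_erase Finset.univ (fun i => L i s) (Finset.mem_univ m)).symm
  have hbound : ∀ m, ∃ c : ℝ, ∀ s ∈ Ioo (0 : ℝ) 1,
      ‖formDensity g l γ.Z γ.W γ.Y s‖ * ‖K m s‖ ^ 2 ≤ c := by
    intro m
    obtain ⟨k, hk⟩ := exists_ne m
    have hd := h.distinct m k hk.symm
    let N : ℝ → ℂ := fun s => γ.Z s ^ (l : ℕ) * γ.W s ^ (g - 1 - (l : ℕ)) *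
      (2 * derivWithin γ.Y I s * K m s * L k s - γ.Y s * derivWithin (K m) I s * L k s
        - γ.Y s * K m s * derivWithin (L k) I s)
    have hN : ContinuousOn N I := by
      have hZ := γ.smooth_Z.continuousOn
      have hW := γ.smooth_W.continuousOn
      have hY := γ.smooth_Y.continuousOn
      have hKc := (hK m).continuousOn
      have hLc := (hL k).continuousOn
      have hY' := hcont _ γ.smooth_Y
      have hK' := hcont _ (hK m)
      have hL' := hcont _ (hL k)
      fun_prop
    obtain ⟨c, hc⟩ := isCompact_Icc.exists_bound_of_continuousOn hN
    refine ⟨c / ‖α m * β k - α k * β m‖, fun s hs => ?_⟩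
    have hsI : s ∈ I := Ioo_subset_Icc_self hs
    rw [le_div_iff₀ (norm_pos_iff.2 hd)]
    refine le_trans ?_ (hc s hsI)
    rw [← norm_pow, ← norm_mul, ← norm_mul]
    by_cases hY0 : γ.Y s = 0
    · rw [formDensity, hY0]
      simp
    refine le_of_eq (congrArg _ ?_)
    have hZ' := hder _ γ.smooth_Z s hs
    have hW' := hder _ γ.smooth_W s hs
    have hY' := hder _ γ.smooth_Y s hs
    have hK' := hder _ (hK m) s hs
    have hLder : ∀ i, derivWithin (L i) I s =
        β i * derivWithin γ.Z I s - α i * derivWithin γ.W I s := fun i =>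
      (hder _ (hL i) s hs).unique ((hZ'.const_mul (β i)).sub (hW'.const_mul (α i)))
    have hrel : 2 * γ.Y s * derivWithin γ.Y I s =
        derivWithin (L m) I s * K m s + L m s * derivWithin (K m) I s := by
      have h1 := hY'.fun_pow 2
      have h2 := (hder _ (hL m) s hs).mul hK'
      have heq : (fun t => γ.Y t ^ 2) =ᶠ[nhds s] L m * K m :=
        Filter.mem_of_superset (Icc_mem_nhds hs.1 hs.2) (hYK m)
      have h3 := (h2.congr_of_eventuallyEq heq).unique h1
      rw [h3]
      simp
    have hYKs := hYK m s hsI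
    rw [formDensity, hZ'.deriv, hW'.deriv, div_mul_eq_mul_div, div_mul_eq_mul_div,
      div_eq_iff hY0]
    simp only [N]
    rw [hLder] at hrel ⊢
    simp only [L] at hrel hYKs ⊢
    linear_combination γ.Z s ^ (l : ℕ) * γ.W s ^ (g - 1 - (l : ℕ)) *
      (-K m s * (β k * γ.Z s - α k * γ.W s) * hrel
        + (derivWithin (K m) I s * (β k * γ.Z s - α k * γ.W s)
          + K m s * (β k * derivWithin γ.Z I s - α k * derivWithin γ.W I s)) * hYKs)
  choose c hc using hbound
  have hS : ContinuousOn (fun s => ∑ m, ‖K m s‖ ^ 2) I :=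
    continuousOn_finsetSum _ fun m _ => ((hK m).continuousOn.norm).pow 2
  obtain ⟨s₀, hs₀, hmin⟩ := isCompact_Icc.exists_isMinOn (nonempty_Icc.2 zero_le_one) hS
  have hpos : 0 < ∑ m, ‖K m s₀‖ ^ 2 := by
    obtain ⟨m, hm⟩ : ∃ m, K m s₀ ≠ 0 := by
      by_contra! hcon
      obtain ⟨i, -, hi⟩ := Finset.prod_eq_zero_iff.1 (hcon 0)
      obtain ⟨j, hj, hj0⟩ := Finset.prod_eq_zero_iff.1 (hcon i)
      exact γ.nonzero s₀ hs₀ (h.eq_zero_of_eq_zero (Finset.mem_erase.1 hj).1 hj0 hi)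
    refine Finset.sum_pos' (fun _ _ => by positivity) ⟨m, Finset.mem_univ m, ?_⟩
    have := norm_pos_iff.2 hm
    positivity
  have hmeas : MeasureTheory.AEStronglyMeasurable (formDensity g l γ.Z γ.W γ.Y)
      (MeasureTheory.volume.restrict (Ioo (0 : ℝ) 1)) := by
    have hm : ∀ f : ℝ → ℂ, ContDiffOn ℝ 1 f I →
        AEMeasurable f (MeasureTheory.volume.restrict (Ioo (0 : ℝ) 1)) := fun f hf =>
      (hf.continuousOn.mono Ioo_subset_Icc_self).aemeasurable measurableSet_Ioo
    have hZ := hm _ γ.smooth_Z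
    have hW := hm _ γ.smooth_W
    have hY := hm _ γ.smooth_Y
    exact ((((hZ.pow_const _).mul (hW.pow_const _)).mul
      (((measurable_deriv γ.Z).aemeasurable.mul hW).sub
        (hZ.mul (measurable_deriv γ.W).aemeasurable))).div hY).aestronglyMeasurable
  rw [intervalIntegrable_iff_integrableOn_Ioo_of_le zero_le_one]
  refine MeasureTheory.Integrable.of_bound hmeas ((∑ m, c m) / ∑ m, ‖K m s₀‖ ^ 2) ?_
  refine (MeasureTheory.ae_restrict_iff' measurableSet_Ioo).2 (Filter.Eventually.of_forall ?_)
  intro s hs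
  rw [le_div_iff₀ hpos]
  calc ‖formDensity g l γ.Z γ.W γ.Y s‖ * ∑ m, ‖K m s₀‖ ^ 2
      ≤ ‖formDensity g l γ.Z γ.W γ.Y s‖ * ∑ m, ‖K m s‖ ^ 2 :=
        mul_le_mul_of_nonneg_left (hmin (Ioo_subset_Icc_self hs)) (norm_nonneg _)
    _ ≤ ∑ m, c m := by
        rw [Finset.mul_sum]
        exact Finset.sum_le_sum fun m _ => hc m s hs

end BranchPoints

end Paths

/-! ### Concatenation of paths and connectedness of the curve -/

section Connectedness

open Set

namespace BranchPoints

variable {g n : ℕ} {E : Fin n → ℂ} {α β : Fin (2 * g + 2) → ℂ}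

/-- Two paths with a common end point can be joined to a `C¹` path: both are slowed down to
velocity zero at the junction, and the homogeneous coordinates of the first are rescaled. -/
theorem exists_concatenation (h : BranchPoints g E α β) (γ δ : CurvePath g E)
    (hγδ : γ.target = δ.source) :
    ∃ ε : CurvePath g E, ε.source = γ.source ∧ ε.target = δ.target ∧
      ∀ l, ε.integral l = γ.integral l + δ.integral l := by
  obtain ⟨κ, hκ, hZ, hW, hY⟩ : HomPoint.Same _ _ := Quotient.exact hγδ
  simp only at hZ hW hY
  let a : ℝ → ℝ := fun s => Real.smoothTransition (2 * s)
  let b : ℝ → ℝ := fun s => Real.smoothTransition (2 * s - 1)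
  have ha : ContDiff ℝ 1 a := Real.smoothTransition.contDiff.comp (contDiff_const.mul contDiff_id)
  have hb : ContDiff ℝ 1 b :=
    Real.smoothTransition.contDiff.comp ((contDiff_const.mul contDiff_id).sub contDiff_const)
  have hamono : Monotone a := Real.smoothTransition.monotone.comp fun s t hst => by
    linarith
  have hbmono : Monotone b := Real.smoothTransition.monotone.comp fun s t hst => by
    linarith
  have haI : ∀ s, a s ∈ Icc (0 : ℝ) 1 := fun s =>
    ⟨Real.smoothTransition.nonneg _, Real.smoothTransition.le_one _⟩
  have hbI : ∀ s, b s ∈ Icc (0 : ℝ) 1 := fun s =>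
    ⟨Real.smoothTransition.nonneg _, Real.smoothTransition.le_one _⟩
  have ha1 : ∀ s, 1 / 2 ≤ s → a s = 1 := fun s hs =>
    Real.smoothTransition.one_of_one_le (by linarith)
  have hb0 : ∀ s, s ≤ 1 / 2 → b s = 0 := fun s hs =>
    Real.smoothTransition.zero_of_nonpos (by linarith)
  have ha0 : a 0 = 0 := by simp [a]
  have hb1 : b 1 = 1 := by
    simp only [b]
    norm_num
  let Z : ℝ → ℂ := fun s => κ * γ.Z (a s) + (δ.Z (b s) - δ.Z 0)
  let W : ℝ → ℂ := fun s => κ * γ.W (a s) + (δ.W (b s) - δ.W 0)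
  let Y : ℝ → ℂ := fun s => κ ^ (g + 1) * γ.Y (a s) + (δ.Y (b s) - δ.Y 0)
  have hZl : ∀ s, s ≤ 1 / 2 → Z s = κ * γ.Z (a s) := fun s hs => by simp [Z, hb0 s hs]
  have hWl : ∀ s, s ≤ 1 / 2 → W s = κ * γ.W (a s) := fun s hs => by simp [W, hb0 s hs]
  have hYl : ∀ s, s ≤ 1 / 2 → Y s = κ ^ (g + 1) * γ.Y (a s) := fun s hs => by
    simp [Y, hb0 s hs]
  have hZr : ∀ s, 1 / 2 ≤ s → Z s = δ.Z (b s) := fun s hs => by simp [Z, ha1 s hs, ← hZ]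
  have hWr : ∀ s, 1 / 2 ≤ s → W s = δ.W (b s) := fun s hs => by simp [W, ha1 s hs, ← hW]
  have hYr : ∀ s, 1 / 2 ≤ s → Y s = δ.Y (b s) := fun s hs => by simp [Y, ha1 s hs, ← hY]
  have hsm : ∀ (κ : ℂ) (u v : ℝ → ℂ), ContDiffOn ℝ 1 u (Icc 0 1) → ContDiffOn ℝ 1 v (Icc 0 1) →
      ContDiffOn ℝ 1 (fun s => κ * u (a s) + (v (b s) - v 0)) (Icc 0 1) := fun κ u v hu hv =>
    (contDiffOn_const.mul (hu.comp ha.contDiffOn fun s _ => haI s)).add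
      ((hv.comp hb.contDiffOn fun s _ => hbI s).sub contDiffOn_const)
  let ε : CurvePath g E :=
    { Z := Z
      W := W
      Y := Y
      smooth_Z := hsm _ _ _ γ.smooth_Z δ.smooth_Z
      smooth_W := hsm _ _ _ γ.smooth_W δ.smooth_W
      smooth_Y := hsm _ _ _ γ.smooth_Y δ.smooth_Y
      nonzero := by
        intro s _
        rcases le_total s (1 / 2) with hs | hs
        · rw [hZl s hs, hWl s hs]
          simpa [hκ] using γ.nonzero (a s) (haI s)
        · rw [hZr s hs, hWr s hs]
          exact δ.nonzero (b s) (hbI s)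
      eqn := by
        intro s _
        rcases le_total s (1 / 2) with hs | hs
        · rw [hZl s hs, hWl s hs, hYl s hs, CurvePath.homCurvePoly_smul h.le, mul_pow,
            γ.eqn (a s) (haI s)]
        · rw [hZr s hs, hWr s hs, hYr s hs]
          exact δ.eqn (b s) (hbI s) }
  refine ⟨ε, ?_, ?_, fun l => ?_⟩
  · refine (Quotient.sound (?_ : HomPoint.Same _ _)).symm
    refine ⟨κ, hκ, ?_, ?_, ?_⟩
    · simpa only [ha0] using hZl 0 (by norm_num)
    · simpa only [ha0] using hWl 0 (by norm_num)
    · simpa only [ha0] using hYl 0 (by norm_num)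
  · refine (Quotient.sound (?_ : HomPoint.Same _ _)).symm
    refine ⟨1, one_ne_zero, ?_, ?_, ?_⟩
    · simpa only [hb1, one_mul] using hZr 1 (by norm_num)
    · simpa only [hb1, one_mul] using hWr 1 (by norm_num)
    · simpa only [hb1, one_mul, one_pow] using hYr 1 (by norm_num)
  · have hint := h.intervalIntegrable_formDensity ε l
    rw [CurvePath.integral, ← intervalIntegral.integral_add_adjacent_intervals (b := 1 / 2)
      (hint.mono_set (by
        rw [uIcc_of_le (by norm_num), uIcc_of_le (by norm_num)]
        exact Icc_subset_Icc_right (by norm_num)))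
      (hint.mono_set (by
        rw [uIcc_of_le (by norm_num), uIcc_of_le (by norm_num)]
        exact Icc_subset_Icc_left (by norm_num)))]
    congr 1
    · refine γ.integral_reparam l hκ (ha.differentiable one_ne_zero) hamono (by norm_num) ha0
        (ha1 _ le_rfl) (fun s hs => ⟨?_, ?_⟩) (fun s hs => hZl s hs.2.le)
        (fun s hs => hWl s hs.2.le) (fun s hs => hYl s hs.2.le)
      · exact Real.smoothTransition.pos_of_pos (by linarith [hs.1])
      · exact Real.smoothTransition.lt_one_of_lt_one (by linarith [hs.2])
    · refine δ.integral_reparam l one_ne_zero (hb.differentiable one_ne_zero) hbmono (by norm_num)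
        (hb0 _ le_rfl) hb1 (fun s hs => ⟨?_, ?_⟩) (fun s hs => ?_) (fun s hs => ?_)
        (fun s hs => ?_)
      · exact Real.smoothTransition.pos_of_pos (by linarith [hs.1])
      · exact Real.smoothTransition.lt_one_of_lt_one (by linarith [hs.2])
      · rw [one_mul]; exact hZr s hs.1.le
      · rw [one_mul]; exact hWr s hs.1.le
      · rw [one_pow, one_mul]; exact hYr s hs.1.le

/-- The branch point with index `m` as a point of the curve. -/
def branchPoint (h : BranchPoints g E α β) (m : Fin (2 * g + 2)) : HyperellipticCurve g E :=
  Quotient.mk (homPointSetoid g E)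
    { Z := α m
      W := β m
      Y := 0
      nonzero := by
        rintro ⟨h1, h2⟩
        obtain ⟨k, hk⟩ := exists_ne m
        exact h.distinct m k hk.symm (by rw [h1, h2]; ring)
      eqn := by
        rw [h.factor, Finset.prod_eq_zero (Finset.mem_univ m) (by ring)]
        ring }

/-- Finitely many nonzero complex numbers can be rotated away from the negative real axis by a
common factor. -/
theorem exists_mul_mem_slitPlane {ι : Type*} (s : Finset ι) {c : ι → ℂ}
    (hc : ∀ i ∈ s, c i ≠ 0) : ∃ κ : ℂ, κ ≠ 0 ∧ ∀ i ∈ s, κ * c i ∈ Complex.slitPlane := by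
  classical
  obtain ⟨t, ht⟩ := Infinite.exists_notMem_finset (s.image fun i => -(c i).im / (c i).re)
  refine ⟨1 + t * Complex.I, ?_, fun i hi => ?_⟩
  · intro h
    have := congrArg Complex.re h
    simp at this
  · refine Complex.mem_slitPlane_iff.2 (Or.inr ?_)
    have him : ((1 + t * Complex.I) * c i).im = (c i).im + t * (c i).re := by
      simp
    rw [him]
    intro h0
    by_cases hre : (c i).re = 0
    · rw [hre, mul_zero, add_zero] at h0
      exact hc i hi (Complex.ext hre h0)
    · refine ht (Finset.mem_image.2 ⟨i, hi, ?_⟩)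
      rw [div_eq_iff hre]
      linarith

/-- A point that is no other branch point is joined to the branch point `v = (α_m, β_m)` by a
path over the segment `v + s² (p - v)`, for suitably rescaled homogeneous coordinates `p`. Along
it `Y² / s²` is a constant times a product of factors `1 + s² (w - 1)` in the slit plane, and
`Y` is given by the principal square roots of these. -/
theorem exists_path_from_branchPoint (h : BranchPoints g E α β) (m : Fin (2 * g + 2))
    (p : HomPoint g E) (hp : ∀ k ≠ m, β k * p.Z - α k * p.W ≠ 0) :
    ∃ γ : CurvePath g E, γ.source = h.branchPoint m ∧
      γ.target = Quotient.mk (homPointSetoid g E) p := by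
  have hv : ∀ k ∈ Finset.univ.erase m, β k * α m - α k * β m ≠ 0 := fun k hk => by
    have := h.distinct m k (Finset.mem_erase.1 hk).1.symm
    rwa [mul_comm (α m) (β k)] at this
  obtain ⟨κ, hκ, hslit⟩ := exists_mul_mem_slitPlane (Finset.univ.erase m)
    (c := fun k => (β k * p.Z - α k * p.W) / (β k * α m - α k * β m))
    fun k hk => div_ne_zero (hp k (Finset.mem_erase.1 hk).1) (hv k hk)
  let w : Fin (2 * g + 2) → ℂ := fun k =>
    κ * ((β k * p.Z - α k * p.W) / (β k * α m - α k * β m))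
  let u : Fin (2 * g + 2) → ℝ → ℂ := fun k s => 1 + (s : ℂ) ^ 2 * (w k - 1)
  have hu : ∀ k ∈ Finset.univ.erase m, ∀ s ∈ Icc (0 : ℝ) 1, u k s ∈ Complex.slitPlane := by
    intro k hk s hs
    have h2 : s ^ 2 ≤ 1 := pow_le_one₀ hs.1 hs.2
    have := Complex.starConvex_one_slitPlane (hslit k hk) (sub_nonneg.2 h2) (sq_nonneg s)
      (sub_add_cancel 1 _)
    convert this using 1
    simp only [u, w, Complex.real_smul]
    push_cast
    ring
  have hu1 : ∀ k, u k 1 = w k := fun k => by simp [u]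
  let q : ℝ → ℂ := fun s => ∏ k ∈ Finset.univ.erase m, Complex.exp (Complex.log (u k s) / 2)
  have hq : ∀ s ∈ Icc (0 : ℝ) 1, q s ^ 2 = ∏ k ∈ Finset.univ.erase m, u k s := by
    intro s hs
    rw [← Finset.prod_pow]
    refine Finset.prod_congr rfl fun k hk => ?_
    rw [← Complex.exp_nat_mul]
    push_cast
    rw [mul_div_cancel₀ _ two_ne_zero, Complex.exp_log (Complex.slitPlane_ne_zero (hu k hk s hs))]
  have hq1 : q 1 ≠ 0 := Finset.prod_ne_zero_iff.2 fun k _ => Complex.exp_ne_zero _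
  let Z : ℝ → ℂ := fun s => α m + (s : ℂ) ^ 2 * (κ * p.Z - α m)
  let W : ℝ → ℂ := fun s => β m + (s : ℂ) ^ 2 * (κ * p.W - β m)
  let Y : ℝ → ℂ := fun s => s * (κ ^ (g + 1) * p.Y / q 1) * q s
  have hlin : ∀ k ∈ Finset.univ.erase m, ∀ s, β k * Z s - α k * W s =
      (β k * α m - α k * β m) * u k s := by
    intro k hk s
    have := hv k hk
    simp only [Z, W, u, w]
    field_simp
    ring
  have hlinm : ∀ s, β m * Z s - α m * W s = (s : ℂ) ^ 2 * (κ * (β m * p.Z - α m * p.W)) := by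
    intro s
    simp only [Z, W]
    ring
  have hofReal : ContDiff ℝ 1 fun s : ℝ => (s : ℂ) := Complex.ofRealCLM.contDiff
  have hsm : ∀ a b : ℂ, ContDiffOn ℝ 1 (fun s : ℝ => a + (s : ℂ) ^ 2 * b) (Icc 0 1) := fun a b =>
    (contDiff_const.add ((hofReal.pow 2).mul contDiff_const)).contDiffOn
  have hlog : ∀ k ∈ Finset.univ.erase m,
      ContDiffOn ℝ 1 (fun s => Complex.log (u k s)) (Icc 0 1) := fun k hk s hs =>
    ((Complex.contDiffAt_log (hu k hk s hs)).restrict_scalars ℝ).comp_contDiffWithinAt s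
      (hsm 1 (w k - 1) s hs)
  have hqs : ContDiffOn ℝ 1 q (Icc 0 1) := contDiffOn_prod fun k hk =>
    ((hlog k hk).div_const 2).cexp
  have hval : (κ ^ (g + 1) * p.Y) ^ 2 = κ * (β m * p.Z - α m * p.W) *
      ((∏ k ∈ Finset.univ.erase m, (β k * α m - α k * β m)) * q 1 ^ 2) := by
    rw [hq 1 (right_mem_Icc.2 zero_le_one), mul_pow, p.eqn, ← CurvePath.homCurvePoly_smul h.le,
      h.factor, ← Finset.mul_prod_erase Finset.univ _ (Finset.mem_univ m),
      ← Finset.prod_mul_distrib]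
    congr 1
    · ring
    · refine Finset.prod_congr rfl fun k hk => ?_
      have := hlin k hk 1
      simp only [Z, W, Complex.ofReal_one] at this
      rw [← this]
      ring
  let γ : CurvePath g E :=
    { Z := Z
      W := W
      Y := Y
      smooth_Z := hsm _ _
      smooth_W := hsm _ _
      smooth_Y := (hofReal.contDiffOn.mul contDiffOn_const).mul hqs
      nonzero := by
        rintro s hs ⟨hZ0, hW0⟩
        obtain ⟨k, hk⟩ := exists_ne m
        have hk' : k ∈ Finset.univ.erase m := Finset.mem_erase.2 ⟨hk, Finset.mem_univ k⟩
        have hk0 := hlin k hk' s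
        rw [hZ0, hW0, mul_zero, mul_zero, sub_zero] at hk0
        exact mul_ne_zero (hv k hk') (Complex.slitPlane_ne_zero (hu k hk' s hs)) hk0.symm
      eqn := by
        intro s hs
        rw [h.factor, ← Finset.mul_prod_erase Finset.univ _ (Finset.mem_univ m), hlinm,
          Finset.prod_congr rfl fun k hk => hlin k hk s, Finset.prod_mul_distrib, ← hq s hs]
        simp only [Y]
        rw [mul_pow, mul_pow, div_pow, hval]
        field_simp }
  refine ⟨γ, Quotient.sound ⟨1, one_ne_zero, ?_, ?_, ?_⟩,
    (Quotient.sound (?_ : HomPoint.Same _ _)).symm⟩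
  · simp [γ, Z]
  · simp [γ, W]
  · simp [γ, Y]
  · refine ⟨κ, hκ, ?_, ?_, ?_⟩
    · simp [γ, Z]
    · simp [γ, W]
    · simp only [γ, Y, Complex.ofReal_one, one_mul]
      field_simp

/-- Any two points of the curve are joined by a `C¹` path. -/
theorem exists_path (h : BranchPoints g E α β) (P Q : HyperellipticCurve g E) :
    ∃ γ : CurvePath g E, γ.source = P ∧ γ.target = Q := by
  have hsymm : ∀ P Q : HyperellipticCurve g E,
      (∃ γ : CurvePath g E, γ.source = P ∧ γ.target = Q) →
        ∃ γ : CurvePath g E, γ.source = Q ∧ γ.target = P := by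
    rintro P Q ⟨γ, h1, h2⟩
    exact ⟨γ.reverse, γ.reverse_source.trans h2, γ.reverse_target.trans h1⟩
  have htrans : ∀ P Q R : HyperellipticCurve g E,
      (∃ γ : CurvePath g E, γ.source = P ∧ γ.target = Q) →
        (∃ γ : CurvePath g E, γ.source = Q ∧ γ.target = R) →
          ∃ γ : CurvePath g E, γ.source = P ∧ γ.target = R := by
    rintro P Q R ⟨γ, h1, h2⟩ ⟨δ, h3, h4⟩
    obtain ⟨ε, h5, h6, -⟩ := h.exists_concatenation γ δ (h2.trans h3.symm)
    exact ⟨ε, h5.trans h1, h6.trans h4⟩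
  -- a point over no branch point is joined to every branch point
  obtain ⟨z, hz⟩ := Infinite.exists_notMem_finset (Finset.univ.image fun i => α i / β i)
  obtain ⟨y, hy⟩ := IsAlgClosed.exists_pow_nat_eq (homCurvePoly g E z 1) two_pos
  let c : HomPoint g E := ⟨z, 1, y, by simp, hy⟩
  have hc : ∀ k, β k * c.Z - α k * c.W ≠ 0 := by
    intro k hk
    have hk : β k * z - α k = 0 := by simpa [c] using hk
    by_cases hβ : β k = 0
    · obtain ⟨i, hi⟩ := exists_ne k
      rw [hβ, zero_mul, zero_sub, neg_eq_zero] at hk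
      exact h.distinct k i hi.symm (by rw [hβ, hk]; ring)
    · refine hz (Finset.mem_image.2 ⟨k, Finset.mem_univ k, ?_⟩)
      rw [div_eq_iff hβ]
      linear_combination -hk
  have hjoin : ∀ P : HyperellipticCurve g E, ∃ γ : CurvePath g E,
      γ.source = Quotient.mk (homPointSetoid g E) c ∧ γ.target = P := by
    intro P
    obtain ⟨p, rfl⟩ := Quotient.exists_rep P
    obtain ⟨m, hm⟩ : ∃ m, ∀ k ≠ m, β k * p.Z - α k * p.W ≠ 0 := by
      by_cases hcase : ∃ m, β m * p.Z - α m * p.W = 0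
      · obtain ⟨m, hm⟩ := hcase
        exact ⟨m, fun k hk hk0 => p.nonzero (h.eq_zero_of_eq_zero hk hk0 hm)⟩
      · exact ⟨0, fun k _ hk0 => hcase ⟨k, hk0⟩⟩
    exact htrans _ _ _ (hsymm _ _ (h.exists_path_from_branchPoint m c fun k _ => hc k))
      (h.exists_path_from_branchPoint m p hm)
  exact htrans _ _ _ (hsymm _ _ (hjoin P)) (hjoin Q)

end BranchPoints

end Connectedness

/-! ### The Abel map along a path -/

namespace MarkedCurve

variable {g n : ℕ} {α β : Fin (2 * g + 2) → ℂ}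

theorem abelianIntegral_mem_periodLattice (C : MarkedCurve g n) (γ : CurvePath g C.E)
    (hγ : γ.source = γ.target) : C.abelianIntegral γ ∈ C.periodLattice := by
  obtain ⟨k, hk, -⟩ := C.isBasis.basis γ hγ
  refine ⟨k.1, k.2, fun j => ?_⟩
  simp only [abelianIntegral, tau, hk, mul_add, Finset.mul_sum, Finset.sum_add_distrib]
  congr 1
  · rw [Finset.sum_comm]
    have h : ∀ i, ∑ l, C.c j l * ((k.1 i : ℂ) * (C.a i).integral l) =
        (k.1 i : ℂ) * if j = i then 1 else 0 := by
      intro i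
      rw [← C.normalized j i, Finset.mul_sum]
      exact Finset.sum_congr rfl fun l _ => by ring
    simp [h]
  · rw [Finset.sum_comm]
    refine Finset.sum_congr rfl fun i _ => Finset.sum_congr rfl fun l _ => by ring

/-- The Abel map of the end point of a path differs from that of its starting point by the
integral over the path. -/
theorem abelMap_target (C : MarkedCurve g n) (h : BranchPoints g C.E α β)
    (γ : CurvePath g C.E) :
    C.abelMap γ.target = C.abelMap γ.source + QuotientAddGroup.mk (C.abelianIntegral γ) := by
  have hs := h.exists_path C.P₀ γ.source
  have ht := h.exists_path C.P₀ γ.target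
  rw [abelMap, abelMap, dif_pos hs, dif_pos ht]
  obtain ⟨hs1, hs2⟩ := hs.choose_spec
  obtain ⟨ht1, ht2⟩ := ht.choose_spec
  generalize hs.choose = σ at hs1 hs2 ⊢
  generalize ht.choose = τ at ht1 ht2 ⊢
  obtain ⟨ε, h1, h2, h3⟩ := h.exists_concatenation σ γ hs2
  obtain ⟨ϖ, h4, h5, h6⟩ := h.exists_concatenation τ.reverse ε
    (τ.reverse_target.trans (ht1.trans (hs1.symm.trans h1.symm)))
  have hϖ := C.abelianIntegral_mem_periodLattice ϖ
    (h4.trans (τ.reverse_source.trans (ht2.trans (h2.symm.trans h5.symm))))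
  have heq : C.abelianIntegral ϖ =
      -C.abelianIntegral τ + (C.abelianIntegral σ + C.abelianIntegral γ) := by
    funext k
    simp only [abelianIntegral, Pi.add_apply, Pi.neg_apply, h6, h3, CurvePath.reverse_integral,
      mul_add, mul_neg, Finset.sum_add_distrib, Finset.sum_neg_distrib]
  rw [heq] at hϖ
  exact QuotientAddGroup.eq.2 hϖ

end MarkedCurve

/-! ### Linearization of divisor flows -/

section DivisorFlows

open Set MeasureTheory

theorem deriv_curvePoly_ne_zero {n : ℕ} {E : Fin n → ℂ} (hE : Function.Injective E) {z : ℂ}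
    (hz : curvePoly E z = 0) : deriv (curvePoly E) z ≠ 0 := by
  obtain ⟨m, -, hm⟩ := Finset.prod_eq_zero_iff.1 hz
  have hz : z = E m := sub_eq_zero.1 hm
  have hfact : curvePoly E = fun w => (w - E m) * ∏ k ∈ Finset.univ.erase m, (w - E k) := by
    funext w
    exact (Finset.mul_prod_erase Finset.univ (fun k => w - E k) (Finset.mem_univ m)).symm
  have hd : HasDerivAt (curvePoly E) (∏ k ∈ Finset.univ.erase m, (z - E k)) z := by
    have h1 : DifferentiableAt ℂ (fun w => ∏ k ∈ Finset.univ.erase m, (w - E k)) z := by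
      fun_prop
    rw [hfact]
    exact (((hasDerivAt_id z).sub_const (E m)).mul h1.hasDerivAt).congr_deriv (by simp [hz])
  rw [hd.deriv, Finset.prod_ne_zero_iff]
  intro k hk
  rw [hz, sub_ne_zero]
  exact fun h => (Finset.mem_erase.1 hk).1 (hE h).symm

/-- Where the moving point passes through a branch point with nonzero velocity, `y` has nonzero
derivative; such parameters are isolated. At a branch point with zero velocity both sides
vanish. -/
theorem ae_formDensity_eq {g n : ℕ} {E : Fin n → ℂ} (hE : Function.Injective E) (l : Fin g)
    {μ y v : ℝ → ℂ} {A : Set ℝ} (hcurve : ∀ s ∈ A, y s ^ 2 = curvePoly E (μ s))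
    (hmove : ∀ s ∈ A, MovesAt E μ y (v s) s) :
    ∀ᵐ s, s ∈ A → formDensity g l μ (fun _ => 1) y s = μ s ^ (l : ℕ) * v s := by
  let B : Set ℝ := {s | s ∈ A ∧ y s = 0 ∧ v s ≠ 0}
  have hB : B.Countable := by
    refine (countable_setOfPred_isolated_right_within (s := B)).mono ?_
    rintro s ⟨hs, hy, hv⟩
    refine ⟨⟨hs, hy, hv⟩, ?_⟩
    have hR : curvePoly E (μ s) = 0 := by rw [← hcurve s hs, hy]; ring
    have hd : v s * deriv (curvePoly E) (μ s) / 2 ≠ 0 :=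
      div_ne_zero (mul_ne_zero hv (deriv_curvePoly_ne_zero hE hR)) two_ne_zero
    have hne := (hmove s hs).2.eventually_ne (c := 0) hd
    refine Filter.empty_mem_iff_bot.1 ?_
    filter_upwards [hne.filter_mono (nhdsWithin_mono s fun z hz => ne_of_gt hz.2),
      self_mem_nhdsWithin] with z hz hz'
    exact hz hz'.1.2.1
  filter_upwards [compl_mem_ae_iff.2 (hB.measure_zero volume)] with s hs hsA
  have hd : deriv μ s = v s * y s := (hmove s hsA).1.deriv
  rw [formDensity, hd]
  by_cases hy : y s = 0
  · have hv : v s = 0 := by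
      by_contra hv
      exact hs ⟨hsA, hy, hv⟩
    simp [hy, hv]
  · simp
    field_simp

/-- The velocities `κ ∑_k d_k Φ_k^{(j)}(m) / ∏_{l ≠ j} (m_j - m_l)`. -/
noncomputable def flowVelocity {g : ℕ} (κ : ℂ) (d : ℕ → ℂ) (m : Fin g → ℂ) (j : Fin g) : ℂ :=
  κ * (∑ k ∈ Finset.range g, d k * Phi k j m) / diffProd m j

theorem sum_pow_mul_flowVelocity {g : ℕ} (κ : ℂ) (d : ℕ → ℂ) {m : Fin g → ℂ}
    (hm : Function.Injective m) (l : Fin g) :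
    ∑ j, m j ^ (l : ℕ) * flowVelocity κ d m j = κ * d (g - 1 - l) := by
  have h : ∀ j, m j ^ (l : ℕ) * flowVelocity κ d m j =
      ∑ k ∈ Finset.range g, κ * d k * (m j ^ (l : ℕ) * (Phi k j m / diffProd m j)) := by
    intro j
    rw [flowVelocity, Finset.mul_sum, Finset.sum_div, Finset.mul_sum]
    exact Finset.sum_congr rfl fun k _ => by ring
  have hl := l.isLt
  simp only [h]
  rw [Finset.sum_comm, Finset.sum_eq_single (g - 1 - l)]
  · rw [← Finset.mul_sum, sum_pow_mul_Phi_div_diffProd hm hl (by omega), if_pos (by omega),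
      mul_one]
  · intro k hk hne
    rw [← Finset.mul_sum, sum_pow_mul_Phi_div_diffProd hm hl (Finset.mem_range.1 hk),
      if_neg (by omega), mul_zero]
  · intro h
    exact absurd (Finset.mem_range.2 (by omega)) h

theorem continuousOn_flowVelocity {g : ℕ} (κ : ℂ) (d : ℕ → ℂ) {μ : Fin g → ℝ → ℂ} {A : Set ℝ}
    (hμ : ∀ j, ContinuousOn (μ j) A) (hinj : ∀ s ∈ A, Function.Injective fun j => μ j s)
    (j : Fin g) : ContinuousOn (fun s => flowVelocity κ d (fun l => μ l s) j) A := by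
  refine ContinuousOn.div (continuousOn_const.mul (continuousOn_finsetSum _ fun k _ =>
    continuousOn_const.mul ?_)) ?_ fun s hs => diffProd_ne_zero (hinj s hs) j
  · exact continuousOn_const.mul (continuousOn_finsetSum _ fun s _ =>
      continuousOn_finsetProd _ fun i _ => hμ i)
  · exact continuousOn_finsetProd _ fun i _ => (hμ j).sub (hμ i)

/-- Pairwise different points `(μ_j, y_j)` of the curve move with the velocities
`flowVelocity κ d` at the parameters in `A`. -/
structure IsDivisorFlow {g n : ℕ} (E : Fin n → ℂ) (κ : ℂ) (d : ℕ → ℂ) (A : Set ℝ)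
    (μ y : Fin g → ℝ → ℂ) : Prop where
  injective : ∀ s ∈ A, Function.Injective fun j => μ j s
  onCurve : OnCurveOne E A μ y
  moves : ∀ s ∈ A, ∀ j, MovesAt E (μ j) (y j) (flowVelocity κ d (fun l => μ l s) j) s

theorem contDiffOn_one_of_hasDerivAt {f f' : ℝ → ℂ}
    (hf : ∀ s ∈ Icc (0 : ℝ) 1, HasDerivAt f (f' s) s) (hf' : ContinuousOn f' (Icc 0 1)) :
    ContDiffOn ℝ 1 f (Icc 0 1) := by
  have hu : UniqueDiffOn ℝ (Icc (0 : ℝ) 1) := uniqueDiffOn_Icc one_pos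
  refine (contDiffOn_one_iff_derivWithin hu).2
    ⟨fun s hs => (hf s hs).differentiableAt.differentiableWithinAt, hf'.congr fun s hs => ?_⟩
  exact (hf s hs).hasDerivWithinAt.derivWithin (hu s hs)

namespace IsDivisorFlow

variable {g n : ℕ} {E : Fin n → ℂ} {κ : ℂ} {d : ℕ → ℂ} {A : Set ℝ} {μ y : Fin g → ℝ → ℂ}

theorem mono (h : IsDivisorFlow E κ d A μ y) {B : Set ℝ} (hBA : B ⊆ A) :
    IsDivisorFlow E κ d B μ y :=
  ⟨fun s hs => h.injective s (hBA hs), fun s hs => h.onCurve s (hBA hs),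
    fun s hs => h.moves s (hBA hs)⟩

theorem continuousOn_μ (h : IsDivisorFlow E κ d A μ y) (j : Fin g) : ContinuousOn (μ j) A :=
  fun s hs => (h.moves s hs j).1.continuousAt.continuousWithinAt

theorem continuousOn_y (h : IsDivisorFlow E κ d A μ y) (j : Fin g) : ContinuousOn (y j) A :=
  fun s hs => (h.moves s hs j).2.continuousAt.continuousWithinAt

theorem continuousOn_velocity (h : IsDivisorFlow E κ d A μ y) (j : Fin g) :
    ContinuousOn (fun s => flowVelocity κ d (fun l => μ l s) j) A :=
  continuousOn_flowVelocity κ d h.continuousOn_μ h.injective j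

theorem intervalIntegrable_formDensity (hE : Function.Injective E) {t₀ t₁ : ℝ}
    (h : IsDivisorFlow E κ d (uIcc t₀ t₁) μ y) (l j : Fin g) :
    IntervalIntegrable (formDensity g l (μ j) (fun _ => 1) (y j)) volume t₀ t₁ := by
  have hc : ContinuousOn (fun s => μ j s ^ (l : ℕ) * flowVelocity κ d (fun l => μ l s) j)
      (uIcc t₀ t₁) := ((h.continuousOn_μ j).pow _).mul (h.continuousOn_velocity j)
  refine hc.intervalIntegrable.congr_ae ?_
  refine (ae_restrict_iff' measurableSet_uIoc).2 ?_
  filter_upwards [ae_formDensity_eq hE l (fun s hs => h.onCurve s hs j)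
    fun s hs => h.moves s hs j] with s hs hs'
  exact (hs (uIoc_subset_uIcc hs')).symm

theorem sum_integral_formDensity (hE : Function.Injective E) {t₀ t₁ : ℝ}
    (h : IsDivisorFlow E κ d (uIcc t₀ t₁) μ y) (l : Fin g) :
    ∑ j, ∫ s in t₀..t₁, formDensity g l (μ j) (fun _ => 1) (y j) s =
      (t₁ - t₀ : ℝ) * (κ * d (g - 1 - l)) := by
  rw [← intervalIntegral.integral_finsetSum fun j _ => h.intervalIntegrable_formDensity hE l j]
  have hae : ∀ᵐ s, s ∈ uIoc t₀ t₁ → ∑ j, formDensity g l (μ j) (fun _ => 1) (y j) s =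
      κ * d (g - 1 - l) := by
    have : ∀ᵐ s, ∀ j, s ∈ uIcc t₀ t₁ → formDensity g l (μ j) (fun _ => 1) (y j) s =
        μ j s ^ (l : ℕ) * flowVelocity κ d (fun l => μ l s) j :=
      ae_all_iff.2 fun j => ae_formDensity_eq hE l (fun s hs => h.onCurve s hs j)
        fun s hs => h.moves s hs j
    filter_upwards [this] with s hs hs'
    rw [Finset.sum_congr rfl fun j _ => hs j (uIoc_subset_uIcc hs')]
    exact sum_pow_mul_flowVelocity κ d (h.injective s (uIoc_subset_uIcc hs')) l
  rw [intervalIntegral.integral_congr_ae hae, intervalIntegral.integral_const,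
    Complex.real_smul]

theorem mem_uIcc_of_mem_Icc {t₀ t₁ s : ℝ} (hs : s ∈ Icc (0 : ℝ) 1) :
    (t₁ - t₀) * s + t₀ ∈ uIcc t₀ t₁ := by
  rw [← segment_eq_uIcc]
  exact ⟨1 - s, s, sub_nonneg.2 hs.2, hs.1, by ring, by simp only [smul_eq_mul]; ring⟩

theorem contDiffOn_comp_affine {t₀ t₁ : ℝ} {f f' : ℝ → ℂ}
    (hf : ∀ s ∈ uIcc t₀ t₁, HasDerivAt f (f' s) s) (hf' : ContinuousOn f' (uIcc t₀ t₁)) :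
    ContDiffOn ℝ 1 (fun s => f ((t₁ - t₀) * s + t₀)) (Icc 0 1) := by
  have haff : ∀ s : ℝ, HasDerivAt (fun s => (t₁ - t₀) * s + t₀) (t₁ - t₀) s := fun s => by
    simpa using ((hasDerivAt_id s).const_mul (t₁ - t₀)).add_const t₀
  refine contDiffOn_one_of_hasDerivAt (f' := fun s => (t₁ - t₀) • f' ((t₁ - t₀) * s + t₀))
    (fun s hs => (hf _ (mem_uIcc_of_mem_Icc hs)).scomp s (haff s)) ?_
  exact (continuousOn_const (c := t₁ - t₀)).smul
    (hf'.comp (by fun_prop) fun s hs => mem_uIcc_of_mem_Icc hs)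

/-- The path traced by the `j`-th point between two parameters. -/
noncomputable def path {t₀ t₁ : ℝ} (h : IsDivisorFlow E κ d (uIcc t₀ t₁) μ y) (j : Fin g) :
    CurvePath g E where
  Z s := μ j ((t₁ - t₀) * s + t₀)
  W _ := 1
  Y s := y j ((t₁ - t₀) * s + t₀)
  smooth_Z := contDiffOn_comp_affine (fun s hs => (h.moves s hs j).1)
    ((h.continuousOn_velocity j).mul (h.continuousOn_y j))
  smooth_W := contDiffOn_const
  smooth_Y := contDiffOn_comp_affine (fun s hs => (h.moves s hs j).2) (by
    have hR : ContDiff ℂ 1 (curvePoly E) := by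
      unfold curvePoly
      fun_prop
    exact ((h.continuousOn_velocity j).mul
      ((hR.continuous_deriv le_rfl).comp_continuousOn (h.continuousOn_μ j))).div_const 2)
  nonzero := by simp
  eqn s hs := by
    rw [h.onCurve _ (mem_uIcc_of_mem_Icc hs) j]
    simp [homCurvePoly, curvePoly]

theorem path_source {t₀ t₁ : ℝ} (h : IsDivisorFlow E κ d (uIcc t₀ t₁) μ y) (j : Fin g) :
    (h.path j).source =
      finitePoint g E (μ j t₀) (y j t₀) (h.onCurve t₀ left_mem_uIcc j) := by
  refine Quotient.sound ⟨1, one_ne_zero, ?_, ?_, ?_⟩ <;> simp [path]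

theorem path_target {t₀ t₁ : ℝ} (h : IsDivisorFlow E κ d (uIcc t₀ t₁) μ y) (j : Fin g) :
    (h.path j).target =
      finitePoint g E (μ j t₁) (y j t₁) (h.onCurve t₁ right_mem_uIcc j) := by
  refine Quotient.sound ⟨1, one_ne_zero, ?_, ?_, ?_⟩ <;> simp [path]

theorem path_integral {t₀ t₁ : ℝ} (h : IsDivisorFlow E κ d (uIcc t₀ t₁) μ y) (l j : Fin g) :
    (h.path j).integral l = ∫ s in t₀..t₁, formDensity g l (μ j) (fun _ => 1) (y j) s := by
  have haff : ∀ s : ℝ, HasDerivAt (fun s => (t₁ - t₀) * s + t₀) (t₁ - t₀) s := fun s => by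
    simpa using ((hasDerivAt_id s).const_mul (t₁ - t₀)).add_const t₀
  have hs := intervalIntegral.smul_integral_comp_mul_add (a := 0) (b := 1)
    (formDensity g l (μ j) (fun _ => 1) (y j)) (t₁ - t₀) t₀
  rw [mul_zero, zero_add, mul_one, sub_add_cancel, ← intervalIntegral.integral_smul] at hs
  rw [← hs, CurvePath.integral]
  refine intervalIntegral.integral_congr fun s hs => ?_
  rw [uIcc_of_le zero_le_one] at hs
  have hμ : DifferentiableAt ℝ (μ j) ((t₁ - t₀) * s + t₀) :=
    (h.moves _ (mem_uIcc_of_mem_Icc hs) j).1.differentiableAt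
  refine formDensity_reparam (κ := 1) (φ := fun s => (t₁ - t₀) * s + t₀) (Z := μ j)
    (W := fun _ => 1) (Y := y j) l one_ne_zero (haff s) hμ (differentiableAt_const _)
    (Filter.Eventually.of_forall fun s => ?_) (Filter.Eventually.of_forall fun s => ?_) ?_
  · exact (one_mul _).symm
  · exact (one_mul _).symm
  · rw [one_pow, one_mul, path]

end IsDivisorFlow

namespace MarkedCurve

variable {g n : ℕ} (C : MarkedCurve g n) {κ : ℂ} {d : ℕ → ℂ} {A : Set ℝ} {μ y : Fin g → ℝ → ℂ}

theorem sum_integral_omegaDensity {t₀ t₁ : ℝ} (h : IsDivisorFlow C.E κ d (uIcc t₀ t₁) μ y)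
    (k : Fin g) : ∑ j, ∫ s in t₀..t₁, C.omegaDensity k (μ j) (y j) s =
      (t₁ - t₀ : ℝ) * rateT C κ d k := by
  have hj : ∀ j, ∫ s in t₀..t₁, C.omegaDensity k (μ j) (y j) s =
      ∑ l, C.c k l * ∫ s in t₀..t₁, formDensity g l (μ j) (fun _ => 1) (y j) s := by
    intro j
    simp only [omegaDensity]
    rw [intervalIntegral.integral_finsetSum fun l _ =>
      (h.intervalIntegrable_formDensity C.E_injective l j).const_mul _]
    simp only [intervalIntegral.integral_const_mul]
  simp only [hj]
  rw [Finset.sum_comm]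
  simp only [← Finset.mul_sum, h.sum_integral_formDensity C.E_injective, rateT]
  rw [Finset.mul_sum, Finset.mul_sum]
  exact Finset.sum_congr rfl fun l _ => by ring

theorem hasDerivAt_sum_integral_omegaDensity (hA : IsOpen A)
    (h : IsDivisorFlow C.E κ d A μ y) (k : Fin g) {t₀ t : ℝ} (ht : uIcc t₀ t ⊆ A) :
    HasDerivAt (fun θ => ∑ j, ∫ s in t₀..θ, C.omegaDensity k (μ j) (y j) s)
      (rateT C κ d k) t := by
  have hlin : HasDerivAt (fun θ : ℝ => ((θ - t₀ : ℝ) : ℂ) * rateT C κ d k)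
      (rateT C κ d k) t := by
    simpa using (((hasDerivAt_id t).sub_const t₀).ofReal_comp).mul_const (rateT C κ d k)
  refine hlin.congr_of_eventuallyEq ?_
  obtain ⟨ε, hε, hball⟩ := Metric.isOpen_iff.1 hA t (ht right_mem_uIcc)
  filter_upwards [Metric.ball_mem_nhds t hε] with θ hθ
  refine C.sum_integral_omegaDensity (h.mono fun s hs => ?_) k
  rcases uIcc_subset_uIcc_union_uIcc hs with hs | hs
  · exact ht hs
  · refine hball ((convex_ball t ε).ordConnected.uIcc_subset (Metric.mem_ball_self hε) hθ hs)

theorem sum_abelMap {α β : Fin (2 * g + 2) → ℂ} (hbr : BranchPoints g C.E α β) {t₀ t₁ : ℝ}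
    (h : IsDivisorFlow C.E κ d (uIcc t₀ t₁) μ y) :
    ∑ j, C.abelMap (finitePoint g C.E (μ j t₁) (y j t₁) (h.onCurve t₁ right_mem_uIcc j)) =
      ∑ j, C.abelMap (finitePoint g C.E (μ j t₀) (y j t₀) (h.onCurve t₀ left_mem_uIcc j)) +
        (QuotientAddGroup.mk (fun k => ((t₁ - t₀ : ℝ) : ℂ) * rateT C κ d k) : C.Jacobian) := by
  have hj : ∀ j, C.abelMap (finitePoint g C.E (μ j t₁) (y j t₁)
      (h.onCurve t₁ right_mem_uIcc j)) =
      C.abelMap (finitePoint g C.E (μ j t₀) (y j t₀) (h.onCurve t₀ left_mem_uIcc j)) +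
        QuotientAddGroup.mk (C.abelianIntegral (h.path j)) := fun j => by
    rw [← h.path_source, ← h.path_target, C.abelMap_target hbr]
  rw [Finset.sum_congr rfl fun j _ => hj j, Finset.sum_add_distrib, ← QuotientAddGroup.mk_sum]
  congr 2
  funext k
  simp only [Finset.sum_apply, abelianIntegral, h.path_integral]
  rw [Finset.sum_comm]
  simp only [← Finset.mul_sum, h.sum_integral_formDensity C.E_injective, rateT]
  rw [Finset.mul_sum, Finset.mul_sum]
  exact Finset.sum_congr rfl fun l _ => by ring

/-- A divisor flow with constant coefficients over an interval is linearized. -/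
theorem linearizesOne {α β : Fin (2 * g + 2) → ℂ} (hbr : BranchPoints g C.E α β)
    (hA : IsOpen A) (hconn : IsPreconnected A) (h : IsDivisorFlow C.E κ d A μ y) :
    LinearizesOne C A μ y h.onCurve (rateT C κ d) where
  deriv_t k _ _ ht := C.hasDerivAt_sum_integral_omegaDensity hA h k ht
  abel _ _ h₀ h₁ := C.sum_abelMap hbr (h.mono (hconn.ordConnected.uIcc_subset h₀ h₁))

theorem rateX_eq_rateT (C : MarkedCurve g n) :
    rateX C = rateT C (-2 * Complex.I) fun k => if k = 0 then 1 else 0 := by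
  funext k
  rw [rateX, rateT, Finset.sum_eq_single ⟨g - 1, Nat.sub_lt (Nat.zero_lt_of_lt k.isLt) one_pos⟩]
  · simp
  · intro l _ hl
    rw [if_neg, mul_zero]
    intro h0
    exact hl (Fin.ext (by have := l.isLt; simp only; omega))
  · simp

theorem flowVelocity_x {m : Fin g → ℂ} (j : Fin g) :
    flowVelocity (-2 * Complex.I) (fun k => if k = 0 then 1 else 0) m j =
      -2 * Complex.I / diffProd m j := by
  have : ∑ k ∈ Finset.range g, (if k = 0 then (1 : ℂ) else 0) * Phi k j m = 1 := by
    rw [Finset.sum_eq_single 0]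
    · simp [Phi_zero]
    · intro k _ hk
      simp [hk]
    · intro h
      exact absurd (Finset.mem_range.2 j.pos) h
  rw [flowVelocity, this, mul_one]

/-- The sum of the Abel maps minus the expected linear function is constant on squares, by
following the flow first in `x` and then in `t`, hence constant on the connected set `Ω`. -/
theorem linearizes {α β : Fin (2 * g + 2) → ℂ} (hbr : BranchPoints g C.E α β)
    {Ω : Set (ℝ × ℝ)} (hΩ : IsOpen Ω) (hconn : IsPreconnected Ω) {μ y : Fin g → ℝ → ℝ → ℂ}
    (hy : OnCurve C.E Ω μ y) (hinj : ∀ x t, (x, t) ∈ Ω → Function.Injective fun j => μ j x t)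
    (hx : DubrovinX C.E Ω μ y)
    {v : Fin g → ℝ → ℝ → ℂ} (ht : DubrovinT C.E Ω μ y v)
    (hv : ∀ x t, (x, t) ∈ Ω → ∀ j,
      v j x t = κ * ∑ k ∈ Finset.range g, d k * Phi k j fun l => μ l x t) :
    Linearizes C Ω μ y hy (rateX C) (rateT C κ d) := by
  have hflowx : ∀ t, IsDivisorFlow C.E (-2 * Complex.I) (fun k => if k = 0 then 1 else 0)
      {x | (x, t) ∈ Ω} (fun j x => μ j x t) fun j x => y j x t := fun t =>
    ⟨fun x hxt => hinj x t hxt, fun x hxt => hy x t hxt, fun x hxt j => by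
      rw [flowVelocity_x]
      exact hx x t hxt j⟩
  have hflowt : ∀ x, IsDivisorFlow C.E κ d {t | (x, t) ∈ Ω} (fun j => μ j x) fun j => y j x :=
    fun x => ⟨fun t hxt => hinj x t hxt, fun t hxt => hy x t hxt, fun t hxt j => by
      rw [flowVelocity, ← hv x t hxt j]
      exact ht x t hxt j⟩
  rw [rateX_eq_rateT]
  refine ⟨fun k x₀ x t h => ?_, fun k x t₀ t h => ?_, fun x₀ t₀ x t h₀ h => ?_⟩
  · exact C.hasDerivAt_sum_integral_omegaDensity (hΩ.preimage (by fun_prop)) (hflowx t) k h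
  · exact C.hasDerivAt_sum_integral_omegaDensity (hΩ.preimage (by fun_prop)) (hflowt x) k h
  -- the Abel image of the divisor, and the linear function to compare it with
  let L : ℝ × ℝ → C.Jacobian := fun p => QuotientAddGroup.mk fun k =>
    (p.1 : ℂ) * rateT C (-2 * Complex.I) (fun k => if k = 0 then 1 else 0) k +
      (p.2 : ℂ) * rateT C κ d k
  let S : Ω → C.Jacobian := fun p => ∑ j, C.abelMap (finitePoint g C.E (μ j p.1.1 p.1.2)
    (y j p.1.1 p.1.2) (hy _ _ p.2 j))
  have hL : ∀ p q : ℝ × ℝ, (QuotientAddGroup.mk (fun k => ((p.1 - q.1 : ℝ) : ℂ) *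
      rateT C (-2 * Complex.I) (fun k => if k = 0 then 1 else 0) k +
      ((p.2 - q.2 : ℝ) : ℂ) * rateT C κ d k) : C.Jacobian) = L p - L q := by
    intro p q
    simp only [L]
    rw [← QuotientAddGroup.mk_sub]
    congr 1
    funext k
    simp only [Pi.sub_apply]
    push_cast
    ring
  have hloc : IsLocallyConstant fun p : Ω => S p - L p := by
    rw [IsLocallyConstant.iff_eventually_eq]
    rintro ⟨⟨x₁, t₁⟩, h₁⟩
    obtain ⟨ε, hε, hball⟩ := Metric.isOpen_iff.1 hΩ _ h₁
    filter_upwards [Metric.ball_mem_nhds _ hε] with p hp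
    obtain ⟨⟨x₂, t₂⟩, h₂⟩ := p
    have hp : (x₂, t₂) ∈ Metric.ball (x₁, t₁) ε := hp
    rw [← ball_prod_same] at hp hball
    obtain ⟨hpx, hpt⟩ := hp
    have hx₁ := Metric.mem_ball_self (x := x₁) hε
    have ht₁ := Metric.mem_ball_self (x := t₁) hε
    have hmid : (x₂, t₁) ∈ Ω := hball ⟨hpx, ht₁⟩
    have e1 := C.sum_abelMap hbr ((hflowx t₁).mono (B := uIcc x₁ x₂) fun s hs =>
      hball ⟨(convex_ball x₁ ε).ordConnected.uIcc_subset hx₁ hpx hs, ht₁⟩)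
    have e2 := C.sum_abelMap hbr ((hflowt x₂).mono (B := uIcc t₁ t₂) fun s hs =>
      hball ⟨hpx, (convex_ball t₁ ε).ordConnected.uIcc_subset ht₁ hpt hs⟩)
    have l1 := hL (x₂, t₁) (x₁, t₁)
    have l2 := hL (x₂, t₂) (x₂, t₁)
    simp only [sub_self, Complex.ofReal_zero, zero_mul, add_zero, zero_add] at l1 l2
    have e1' : S ⟨(x₂, t₁), hmid⟩ = S ⟨(x₁, t₁), h₁⟩ + (L (x₂, t₁) - L (x₁, t₁)) := by
      rw [← l1]; exact e1
    have e2' : S ⟨(x₂, t₂), h₂⟩ = S ⟨(x₂, t₁), hmid⟩ + (L (x₂, t₂) - L (x₂, t₁)) := by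
      rw [← l2]; exact e2
    change S ⟨(x₂, t₂), h₂⟩ - L (x₂, t₂) = S ⟨(x₁, t₁), h₁⟩ - L (x₁, t₁)
    rw [e2', e1']
    abel
  have : PreconnectedSpace Ω := Subtype.preconnectedSpace hconn
  have heq := hloc.apply_eq_of_preconnectedSpace ⟨(x, t), h⟩ ⟨(x₀, t₀), h₀⟩
  rw [hL (x, t) (x₀, t₀)]
  change S ⟨(x, t), h⟩ = S ⟨(x₀, t₀), h₀⟩ + (L (x, t) - L (x₀, t₀))
  rw [sub_eq_iff_eq_add] at heq
  rw [heq]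
  abel

end MarkedCurve

end DivisorFlows

/-! ### Evaluation of the time-dependent polynomials on the divisor -/

section Evaluation

open MvPolynomial (eval)

theorem ContDiffAt.iteratedDeriv_infty {f : ℝ → ℂ} {x : ℝ} (hf : ContDiffAt ℝ ∞ f x) (k : ℕ) :
    ContDiffAt ℝ ∞ (iteratedDeriv k f) x := by
  induction k with
  | zero => simpa using hf
  | succ k ih =>
    rw [iteratedDeriv_succ]
    exact (ih.fderiv_right (m := ∞) (by simp)).clm_apply contDiffAt_const

theorem ContDiffAt.hasDerivAt_iteratedDeriv {f : ℝ → ℂ} {x : ℝ} (hf : ContDiffAt ℝ ∞ f x)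
    (k : ℕ) : HasDerivAt (iteratedDeriv k f) (iteratedDeriv (k + 1) f x) x := by
  rw [iteratedDeriv_succ]
  exact ((hf.iteratedDeriv_infty k).differentiableAt (by simp)).hasDerivAt

theorem contDiffAt_eval {σ : Type*} {v : σ → ℝ → ℂ} {x : ℝ}
    (hv : ∀ i, ContDiffAt ℝ ∞ (v i) x) (P : MvPolynomial σ ℂ) :
    ContDiffAt ℝ ∞ (fun x' => eval (fun i => v i x') P) x := by
  simp only [MvPolynomial.eval_eq]
  exact ContDiffAt.sum fun d _ => contDiffAt_const.mul (contDiffAt_prod fun i _ => (hv i).pow _)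

theorem sum_range_min_dCoeff {n g : ℕ} (E : Fin n → ℂ) (ct : ℕ → ℂ) (r : ℕ) (j : Fin g)
    (m : Fin g → ℂ) : ∑ k ∈ Finset.range (min r g + 1), dCoeff E ct r k * Phi k j m =
      ∑ k ∈ Finset.range g, dCoeff E ct r k * Phi k j m := by
  have h1 : ∑ k ∈ Finset.range (min r g + 1), dCoeff E ct r k * Phi k j m =
      ∑ k ∈ Finset.range (g + 1), dCoeff E ct r k * Phi k j m := by
    refine Finset.sum_subset (fun k hk => ?_) fun k hk hk' => ?_
    · simp only [Finset.mem_range] at hk ⊢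
      omega
    · simp only [Finset.mem_range] at hk hk'
      rw [dCoeff, if_neg (by omega), zero_mul]
  rw [h1, Finset.sum_range_succ, Phi_eq_zero_of_le le_rfl, mul_zero, add_zero]

/-- For a potential `V` and a polynomial `F(z) = ∏ (z - μ_j)` that solve the stationary curve
equation of the KdV hierarchy, the values at `μ_j` of the polynomials built by the recursion. -/
theorem kdv_eval_at_root {g : ℕ} {U : Set ℝ} (hU : IsOpen U) (E : Fin (2 * g + 1) → ℂ)
    {ct : ℕ → ℂ} {ft : ℕ → MvPolynomial ℕ ℂ} (hft : IsKdVSeq ct ft) {V : ℝ → ℂ}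
    (hV : ∀ x ∈ U, ContDiffAt ℝ ∞ V x) {b : ℕ → ℝ → ℂ}
    (hb : ∀ x ∈ U, ∀ k ≤ g, ContDiffAt ℝ ∞ (b k) x) {F : ℂ → ℝ → ℂ}
    (hF : ∀ z x, F z x = ∑ j ∈ Finset.range (g + 1), b (g - j) x * z ^ j) {μ : Fin g → ℝ → ℂ}
    (hμ : ∀ x ∈ U, ∀ z, F z x = ∏ j, (z - μ j x))
    (hcurve : ∀ x ∈ U, ∀ z, 1 / 2 * iteratedDeriv 2 (F z) x * F z x - 1 / 4 * deriv (F z) x ^ 2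
      - (V x - z) * F z x ^ 2 = curvePoly E z) {x : ℝ} (hx : x ∈ U) (r : ℕ) (j : Fin g) :
    ∑ l ∈ Finset.range (r + 1), eval (fun k => iteratedDeriv k V x) (ft (r - l)) * μ j x ^ l =
      ∑ k ∈ Finset.range (min r g + 1), dCoeff E ct r k * Phi k j (fun l => μ l x) := by
  have hprod : ∀ x ∈ U, ∀ z, ∑ j ∈ Finset.range (g + 1), b (g - j) x * z ^ j =
      1 * ∏ j, (z - μ j x) := fun x hx z => by rw [← hF, hμ x hx, one_mul]
  have hF1 : ∀ x ∈ U, ∀ z, HasDerivAt (F z)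
      (∑ j ∈ Finset.range (g + 1), iteratedDeriv 1 (b (g - j)) x * z ^ j) x := by
    intro x hx z
    have : F z = fun x => ∑ j ∈ Finset.range (g + 1), b (g - j) x * z ^ j := funext (hF z)
    rw [this]
    refine HasDerivAt.fun_sum fun j _ => HasDerivAt.mul_const ?_ _
    simpa using (hb x hx (g - j) (Nat.sub_le g j)).hasDerivAt_iteratedDeriv 0
  have hF2 : ∀ x ∈ U, ∀ z, iteratedDeriv 2 (F z) x =
      ∑ j ∈ Finset.range (g + 1), iteratedDeriv 2 (b (g - j)) x * z ^ j := by
    intro x hx z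
    have h1 : deriv (F z) =ᶠ[nhds x] fun x =>
        ∑ j ∈ Finset.range (g + 1), iteratedDeriv 1 (b (g - j)) x * z ^ j :=
      Filter.mem_of_superset (hU.mem_nhds hx) fun x hx => (hF1 x hx z).deriv
    rw [iteratedDeriv_succ, iteratedDeriv_one, h1.deriv_eq]
    exact (HasDerivAt.fun_sum fun j _ =>
      ((hb x hx (g - j) (Nat.sub_le g j)).hasDerivAt_iteratedDeriv 1).mul_const _).deriv
  have hseries := kdvSeries_eq hU E hft (v := fun k => iteratedDeriv k V) (b := b)
    (b' := fun k => iteratedDeriv 1 (b k)) (b'' := fun k => iteratedDeriv 2 (b k))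
    (fun x hx k => (hV x hx).hasDerivAt_iteratedDeriv k)
    (fun x hx k hk => by simpa using (hb x hx k hk).hasDerivAt_iteratedDeriv 0)
    (fun x hx k hk => (hb x hx k hk).hasDerivAt_iteratedDeriv 1)
    (fun x hx => sum_leading_coeff (b := fun k => b k x) (hprod x hx))
    (fun x hx z => by
      have h := hcurve x hx z
      rw [hF2 x hx, (hF1 x hx z).deriv, hF] at h
      simpa using h) x hx
  rw [reversedSeries_eq_prod (hprod x hx), map_one, one_mul] at hseries
  exact eval_at_root_of_series_eq E ct (fun l => μ l x) r j hseries

end Evaluation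

/-! ### The KdV, AKNS and Toda hierarchies -/

section Hierarchies

open MvPolynomial (eval)

variable {g : ℕ} {Ω : Set (ℝ × ℝ)}

theorem isOpen_slice (hΩ : IsOpen Ω) (t : ℝ) : IsOpen {x | (x, t) ∈ Ω} :=
  hΩ.preimage (by fun_prop)

theorem IsStationaryKdV.eval_at_root {E : Fin (2 * g + 1) → ℂ} (hΩ : IsOpen Ω)
    {ct : ℕ → ℂ} {f ft : ℕ → MvPolynomial ℕ ℂ} (hft : IsKdVSeq ct ft) {V : ℝ → ℝ → ℂ}
    (h : IsStationaryKdV g E Ω f V) {μ : Fin g → ℝ → ℝ → ℂ}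
    (hμ : ∀ x t, (x, t) ∈ Ω → ∀ z : ℂ, kdvF f V g z x t = ∏ j, (z - μ j x t)) (r : ℕ)
    (x t : ℝ) (hx : (x, t) ∈ Ω) (j : Fin g) :
    kdvF ft V r (μ j x t) x t =
      ∑ k ∈ Finset.range (min r g + 1), dCoeff E ct r k * Phi k j (fun l => μ l x t) :=
  kdv_eval_at_root (isOpen_slice hΩ t) E hft (V := fun x => V x t)
    (b := fun k x => kdvCoeff f V k x t) (F := fun z x => kdvF f V g z x t)
    (μ := fun j x => μ j x t) (fun x hx => h.smooth x t hx)
    (fun x hx k _ => contDiffAt_eval (fun i => (h.smooth x t hx).iteratedDeriv_infty i) (f k))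
    (fun _ _ => rfl) (fun x hx => hμ x t hx) (fun x hx => h.curve x t hx) hx r j

theorem IsStationaryAKNS.eval_at_root {E : Fin (2 * g + 2) → ℂ} (hΩ : IsOpen Ω)
    {c ct : ℕ → ℂ} {F G H Ft Gt Ht : ℕ → MvPolynomial (ℕ ⊕ ℕ) ℂ} (hs : IsAKNSSeq c F G H)
    (hst : IsAKNSSeq ct Ft Gt Ht) {p q : ℝ → ℝ → ℂ} (h : IsStationaryAKNS g E Ω F G H p q)
    (r : ℕ) (x t : ℝ) (hx : (x, t) ∈ Ω) (κ : ℂ) (μ : Fin g → ℂ) (j : Fin g) :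
    ((∀ z : ℂ, aknsPoly F p q g z x t = κ * ∏ j, (z - μ j)) → κ ≠ 0 →
      aknsPoly Ft p q r (μ j) x t = κ *
        ∑ k ∈ Finset.range (min r g + 1), dCoeff E ct r k * Phi k j μ) ∧
    ((∀ z : ℂ, aknsPoly H p q g z x t = κ * ∏ j, (z - μ j)) → κ ≠ 0 →
      aknsPoly Ht p q r (μ j) x t = κ *
        ∑ k ∈ Finset.range (min r g + 1), dCoeff E ct r k * Phi k j μ) := by
  let v : ℕ ⊕ ℕ → ℝ → ℂ := Sum.elim (fun k => iteratedDeriv k fun x' => p x' t)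
    fun k => iteratedDeriv k fun x' => q x' t
  have hv : ∀ x, (fun i => v i x) = Sum.elim (fun k => iteratedDeriv k (fun x' => p x' t) x)
      (fun k => iteratedDeriv k (fun x' => q x' t) x) := by
    intro x
    funext i
    cases i <;> rfl
  have hcoeff : ∀ (P : ℕ → MvPolynomial (ℕ ⊕ ℕ) ℂ) k x,
      eval (fun i => v i x) (P k) = aknsCoeff P p q k x t := fun P k x => by
    rw [hv]; rfl
  obtain ⟨h1, h2⟩ := aknsSeries_eq (isOpen_slice hΩ t) E hs hst (v := v)
    (fun x hx i => by
      cases i with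
      | inl k => exact (h.smooth_p x t hx).hasDerivAt_iteratedDeriv k
      | inr k => exact (h.smooth_q x t hx).hasDerivAt_iteratedDeriv k)
    (fun x hx => by rw [hcoeff]; exact h.stationary_f x t hx)
    (fun x hx => by rw [hcoeff]; exact h.stationary_h x t hx)
    (fun x hx z => by simp only [hcoeff]; exact h.curve x t hx z) x hx
  simp only [hcoeff] at h1 h2
  have key : ∀ P Pt : ℕ → MvPolynomial (ℕ ⊕ ℕ) ℂ,
      aknsSeries Pt (fun i => v i x) = PowerSeries.mk ct * invSqrtSeries E *
        reversedSeries g (fun k => aknsCoeff P p q k x t) →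
      (∀ z : ℂ, aknsPoly P p q g z x t = κ * ∏ j, (z - μ j)) → κ ≠ 0 →
      aknsPoly Pt p q r (μ j) x t = κ *
        ∑ k ∈ Finset.range (min r g + 1), dCoeff E ct r k * Phi k j μ := by
    intro P Pt hP hroots hκ
    have hmk : PowerSeries.mk (fun k => κ⁻¹ * aknsCoeff Pt p q k x t) =
        PowerSeries.mk ct * invSqrtSeries E *
          ∏ l, (1 - PowerSeries.C (μ l) * PowerSeries.X) := by
      have hC : PowerSeries.mk (fun k => κ⁻¹ * aknsCoeff Pt p q k x t) =
          PowerSeries.C κ⁻¹ * aknsSeries Pt fun i => v i x := by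
        ext k
        simp [aknsSeries, hcoeff]
      rw [hC, hP, reversedSeries_eq_prod (b := fun k => aknsCoeff P p q k x t) hroots,
        mul_left_comm, ← mul_assoc (PowerSeries.C κ⁻¹),
        ← map_mul, inv_mul_cancel₀ hκ, map_one, one_mul]
    rw [← eval_at_root_of_series_eq E ct μ r j hmk, Finset.mul_sum]
    refine Finset.sum_congr rfl fun l _ => ?_
    field_simp
  exact ⟨key F Ft h1, key H Ht h2⟩

theorem IsStationaryToda.eval_at_root {E : Fin (2 * g + 2) → ℂ} {J : Set ℝ}
    {c ct : ℕ → ℂ} {F G Ft Gt : ℕ → MvPolynomial (ℤ ⊕ ℤ) ℂ} (hs : IsTodaSeq c F G)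
    (hst : IsTodaSeq ct Ft Gt) {a b : ℤ → ℝ → ℂ} (h : IsStationaryToda g E J F G a b) (n : ℤ)
    {μ : Fin g → ℝ → ℂ} (hμ : ∀ t ∈ J, ∀ z : ℂ, todaF F a b g z n t = ∏ j, (z - μ j t)) (r : ℕ)
    (t : ℝ) (ht : t ∈ J) (j : Fin g) :
    todaF Ft a b r (μ j t) n t =
      ∑ k ∈ Finset.range (min r g + 1), dCoeff E ct r k * Phi k j (fun l => μ l t) := by
  have hseries := todaSeriesF_eq E hs hst h ht n
  rw [reversedSeries_eq_prod (b := fun k => todaCoeff F a b k n t) (κ := 1) (μ := fun j => μ j t)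
    fun z => (hμ t ht z).trans (one_mul _).symm, map_one, one_mul] at hseries
  exact eval_at_root_of_series_eq E ct (fun l => μ l t) r j hseries

end Hierarchies

/-! ### The combined sine-Gordon and mKdV hierarchy -/

section SineGordon

open MvPolynomial (eval)

variable {g : ℕ} {Ω : Set (ℝ × ℝ)}

/-- The zero curvature equations for `P` (which is `F` for `ε = 1` and `H` for `ε = -1`) and for
its partner `Q` turn `z² G² + z P Q = R(z)` into the stationary KdV curve equation with
potential `-(u_x² + 2 ε i u_xx) / 4`. -/
theorem kdv_curve_of_zeroCurvature {U : Set ℝ} (hU : IsOpen U) {ε z R : ℂ} (hε : ε ^ 2 = 1)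
    {u P Q G : ℝ → ℂ} (hu : ∀ x ∈ U, ContDiffAt ℝ ∞ u x) (hP : ∀ x ∈ U, ContDiffAt ℝ ∞ P x)
    (hP' : ∀ x ∈ U, deriv P x = -(ε * Complex.I * deriv u x * P x) - 2 * ε * Complex.I * z * G x)
    (hQ : ∀ x ∈ U, Q x = P x - ε * Complex.I * deriv G x)
    (hcurve : ∀ x ∈ U, z ^ 2 * G x ^ 2 + z * P x * Q x = R) :
    ∀ x ∈ U, 1 / 2 * iteratedDeriv 2 P x * P x - 1 / 4 * deriv P x ^ 2
      - (-(1 / 4) * (deriv u x ^ 2 + 2 * ε * Complex.I * iteratedDeriv 2 u x) - z) * P x ^ 2 =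
        R := by
  intro x hx
  have hzG : ∀ x ∈ U, z * G x =
      ε * Complex.I / 2 * (deriv P x + ε * Complex.I * deriv u x * P x) := by
    intro x hx
    rw [hP' x hx]
    linear_combination (z * G x) * (ε ^ 2 * Complex.I_sq - hε)
  have hzG' : z * deriv G x = ε * Complex.I / 2 * (iteratedDeriv 2 P x +
      (ε * Complex.I * iteratedDeriv 2 u x * P x + ε * Complex.I * deriv u x * deriv P x)) := by
    have heq : (fun x => z * G x) =ᶠ[nhds x] fun x =>
        ε * Complex.I / 2 * (deriv P x + ε * Complex.I * deriv u x * P x) :=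
      Filter.mem_of_superset (hU.mem_nhds hx) hzG
    rw [← deriv_const_mul_field, heq.deriv_eq]
    have d0 := (hP x hx).hasDerivAt_iteratedDeriv 0
    have d1 := (hP x hx).hasDerivAt_iteratedDeriv 1
    have d2 := (hu x hx).hasDerivAt_iteratedDeriv 1
    simp only [iteratedDeriv_zero, iteratedDeriv_one, zero_add, Nat.reduceAdd] at d0 d1 d2
    exact ((d1.add ((d2.const_mul (ε * Complex.I)).mul d0)).const_mul _).deriv
  have h1 := hzG x hx
  rw [← hcurve x hx, hQ x hx]
  have hs : (ε * Complex.I) ^ 2 = -1 := by rw [mul_pow, hε, Complex.I_sq, one_mul]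
  rw [show 2 * ε * Complex.I * iteratedDeriv 2 u x = 2 * (ε * Complex.I) * iteratedDeriv 2 u x by
    ring]
  generalize ε * Complex.I = s at hs h1 hzG' ⊢
  linear_combination (-(z * G x + s / 2 * (deriv P x + s * deriv u x * P x))) * h1
    + s * P x * hzG'
    + (-(1 / 4) * (deriv P x ^ 2 + 2 * s * deriv u x * P x * deriv P x
        + (s ^ 2 - 1) * deriv u x ^ 2 * P x ^ 2)
      + 1 / 2 * P x * (iteratedDeriv 2 P x + s * iteratedDeriv 2 u x * P x
        + s * deriv u x * deriv P x)) * hs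

theorem sgPoly_zero (ε : ℂ) (f : ℕ → MvPolynomial ℕ ℂ) (α : ℂ) (u : ℝ → ℝ → ℂ) (r : ℕ)
    (x t : ℝ) : sgPoly ε f α u r 0 x t = α * Complex.exp (-ε * Complex.I * u x t) := by
  rw [sgPoly, Finset.sum_eq_zero, add_zero]
  intro j hj
  rw [zero_pow (Nat.sub_ne_zero_of_lt (Finset.mem_range.1 hj)), mul_zero]

/-- The curve equation, divided by `z`, gives `αβ = F(0) H(0) = R'(0)` at `z = 0`, and
`E_0 = 0` is a simple zero of `R`. -/
theorem IsStationarySG.mul_ne_zero {E : Fin (2 * g + 1) → ℂ} (hE : Function.Injective E)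
    {f : ℕ → MvPolynomial ℕ ℂ} {α β : ℂ} {u : ℝ → ℝ → ℂ}
    (h : IsStationarySG g E Ω f α β u) {x t : ℝ} (hx : (x, t) ∈ Ω) : α * β ≠ 0 := by
  have hR0 : curvePoly E 0 = 0 :=
    Finset.prod_eq_zero (Finset.mem_univ 0) (by rw [h.E_zero, sub_zero])
  have hG : DifferentiableAt ℂ (fun z => sgG f u g z x t) 0 := by
    unfold sgG; fun_prop
  have hF : DifferentiableAt ℂ (fun z => sgPoly 1 f α u g z x t) 0 := by
    unfold sgPoly; fun_prop
  have hH : DifferentiableAt ℂ (fun z => sgPoly (-1) f β u g z x t) 0 := by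
    unfold sgPoly; fun_prop
  have hd := (((hasDerivAt_id (0 : ℂ)).pow 2).mul (hG.hasDerivAt.pow 2)).add
    (((hasDerivAt_id (0 : ℂ)).mul hF.hasDerivAt).mul hH.hasDerivAt)
  have heq : curvePoly E = fun z => z ^ 2 * sgG f u g z x t ^ 2
      + z * sgPoly 1 f α u g z x t * sgPoly (-1) f β u g z x t :=
    funext fun z => (h.curve x t hx z).symm
  have hne := deriv_curvePoly_ne_zero hE hR0
  have hval : deriv (curvePoly E) 0 = sgPoly 1 f α u g 0 x t * sgPoly (-1) f β u g 0 x t := by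
    rw [heq]
    refine hd.deriv.trans ?_
    simp
  rw [hval, sgPoly_zero, sgPoly_zero] at hne
  intro hαβ
  exact hne (by rw [mul_mul_mul_comm, hαβ, zero_mul])

/-- The coefficients of `F` (for `ε = 1`) or `H` (for `ε = -1`) are those of a KdV polynomial with
potential `sgW ε u`, save for the lowest one, whose contribution to the time-dependent
polynomial is expressed by the product of the zeros. -/
theorem sg_eval_at_root {U : Set ℝ} (hU : IsOpen U) (E : Fin (2 * g + 1) → ℂ)
    {ct : ℕ → ℂ} {f ft : ℕ → MvPolynomial ℕ ℂ} (hft : IsKdVSeq ct ft) {ε α αt : ℂ}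
    (hε : ε ^ 2 = 1) (hα : α ≠ 0) {u : ℝ → ℝ → ℂ} {t : ℝ}
    (hu : ∀ x ∈ U, ContDiffAt ℝ ∞ (fun x' => u x' t) x) {G Q : ℂ → ℝ → ℂ}
    (hP' : ∀ x ∈ U, ∀ z, deriv (fun x' => sgPoly ε f α u g z x' t) x =
      -(ε * Complex.I * deriv (fun x' => u x' t) x * sgPoly ε f α u g z x t)
        - 2 * ε * Complex.I * z * G z x)
    (hQ : ∀ x ∈ U, ∀ z, Q z x = sgPoly ε f α u g z x t - ε * Complex.I * deriv (G z) x)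
    (hcurve : ∀ x ∈ U, ∀ z,
      z ^ 2 * G z x ^ 2 + z * sgPoly ε f α u g z x t * Q z x = curvePoly E z)
    {μ : Fin g → ℝ → ℂ} (hμ : ∀ x ∈ U, ∀ z, sgPoly ε f α u g z x t = ∏ j, (z - μ j x))
    {x : ℝ} (hx : x ∈ U) (r : ℕ) (j : Fin g) :
    sgPoly ε ft αt u r (μ j x) x t / μ j x =
      ∑ k ∈ Finset.range g, sgCoeff E ct (αt / α) g r k * Phi k j (fun l => μ l x) := by
  have hV : ∀ x ∈ U, ContDiffAt ℝ ∞ (fun x' => sgW ε u x' t) x := fun x hx => by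
    have h1 := (hu x hx).iteratedDeriv_infty 1
    have h2 := (hu x hx).iteratedDeriv_infty 2
    rw [iteratedDeriv_one] at h1
    exact contDiffAt_const.mul ((h1.pow 2).add (contDiffAt_const.mul h2))
  let b : ℕ → ℝ → ℂ := fun k x => if k < g then kdvCoeff f (sgW ε u) k x t
    else α * Complex.exp (-ε * Complex.I * u x t)
  have hb : ∀ x ∈ U, ∀ k, ContDiffAt ℝ ∞ (b k) x := by
    intro x hx k
    by_cases hk : k < g
    · simp only [b, if_pos hk]
      exact contDiffAt_eval (fun i => (hV x hx).iteratedDeriv_infty i) (f k)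
    · simp only [b, if_neg hk]
      exact contDiffAt_const.mul (contDiffAt_const.mul (hu x hx)).cexp
  have hF : ∀ z x, sgPoly ε f α u g z x t = ∑ j ∈ Finset.range (g + 1), b (g - j) x * z ^ j := by
    intro z x
    rw [← Finset.sum_flip, Finset.sum_range_succ, sgPoly, add_comm]
    congr 1
    · refine Finset.sum_congr rfl fun j hj => ?_
      have hj := Finset.mem_range.1 hj
      rw [Nat.sub_sub_self hj.le]
      simp [b, hj]
    · simp [b]
  have hPsm : ∀ x ∈ U, ∀ z, ContDiffAt ℝ ∞ (fun x' => sgPoly ε f α u g z x' t) x := by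
    intro x hx z
    simp only [hF]
    exact ContDiffAt.sum fun j _ => (hb x hx (g - j)).mul contDiffAt_const
  have hkdv := kdv_eval_at_root hU E hft hV (fun x hx k _ => hb x hx k) hF hμ
    (fun x hx z => kdv_curve_of_zeroCurvature hU hε hu (fun x hx => hPsm x hx z)
      (fun x hx => hP' x hx z) (fun x hx => hQ x hx z) (fun x hx => hcurve x hx z) x hx) hx
  -- the lowest coefficient is the product of the zeros up to sign
  have hexp : α * Complex.exp (-ε * Complex.I * u x t) =
      -(μ j x * Phi (g - 1) j fun l => μ l x) := by
    rw [← sgPoly_zero ε f, hμ x hx, Phi_top, ← Finset.mul_prod_erase _ _ (Finset.mem_univ j)]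
    simp only [zero_sub, Finset.prod_neg]
    simp
  have hμ0 : μ j x ≠ 0 := by
    intro h0
    rw [h0, zero_mul, neg_zero] at hexp
    exact mul_ne_zero hα (Complex.exp_ne_zero _) hexp
  have hlow : αt * Complex.exp (-ε * Complex.I * u x t) / μ j x =
      -(αt / α * Phi (g - 1) j fun l => μ l x) := by
    have he : Complex.exp (-ε * Complex.I * u x t) =
        -(μ j x * Phi (g - 1) j fun l => μ l x) / α := by
      rw [← hexp, mul_div_cancel_left₀ _ hα]
    rw [he]
    field_simp
  have hg := j.pos
  have htop : ∑ k ∈ Finset.range g, (if k + 1 = g then αt / α else 0) *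
      Phi k j (fun l => μ l x) = αt / α * Phi (g - 1) j fun l => μ l x := by
    rw [Finset.sum_eq_single (g - 1)]
    · rw [if_pos (by omega)]
    · intro k _ hk
      rw [if_neg (by omega), zero_mul]
    · intro h
      exact absurd (Finset.mem_range.2 (by omega)) h
  have hhigh : (∑ k ∈ Finset.range r, kdvCoeff ft (sgW ε u) k x t * μ j x ^ (r - k)) / μ j x =
      ∑ k ∈ Finset.range g, (if 1 ≤ r then dCoeff E ct (r - 1) k else 0) *
        Phi k j fun l => μ l x := by
    rcases r with _ | r
    · simp
    · have h1 := hkdv r j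
      rw [sum_range_min_dCoeff] at h1
      simp only [le_add_iff_nonneg_left, zero_le, if_true, Nat.add_sub_cancel, ← h1]
      rw [← Finset.sum_flip, Finset.sum_div]
      refine Finset.sum_congr rfl fun k hk => ?_
      have hk := Finset.mem_range_succ_iff.1 hk
      rw [show r + 1 - (r - k) = k + 1 by omega, pow_succ, ← mul_assoc,
        mul_div_cancel_right₀ _ hμ0]
      rfl
  rw [sgPoly, add_div, hlow, hhigh]
  simp only [sgCoeff, sub_mul, Finset.sum_sub_distrib, htop]
  ring

end SineGordon

/-! ### Linearization of the time-dependent flows -/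

theorem mainTheorem3 (g r : ℕ) :
    -- KdV
    (∀ (C : MarkedCurve g (2 * g + 1)) (Ω : Set (ℝ × ℝ)), IsOpen Ω → IsPreconnected Ω →
      ∀ (c ct : ℕ → ℂ) (f ft : ℕ → MvPolynomial ℕ ℂ), IsKdVSeq c f → IsKdVSeq ct ft →
      ∀ V : ℝ → ℝ → ℂ, IsStationaryKdV g C.E Ω f V →
      ∀ (μ y : Fin g → ℝ → ℝ → ℂ) (hy : OnCurve C.E Ω μ y),
      (∀ x t, (x, t) ∈ Ω → ∀ z : ℂ, kdvF f V g z x t = ∏ j, (z - μ j x t)) →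
      (∀ x t, (x, t) ∈ Ω → Function.Injective (fun j => μ j x t)) →
      DubrovinX C.E Ω μ y →
      DubrovinT C.E Ω μ y (fun j x t => -2 * Complex.I * kdvF ft V r (μ j x t) x t) →
      (∀ x t, (x, t) ∈ Ω → ∀ j, kdvF ft V r (μ j x t) x t =
        ∑ k ∈ Finset.range (min r g + 1), dCoeff C.E ct r k * Phi k j (fun l => μ l x t)) ∧
      Linearizes C Ω μ y hy (rateX C) (rateT C (-2 * Complex.I) (dCoeff C.E ct r))) ∧
    -- AKNS, the divisors of the zeros of F and of H
    (∀ (C : MarkedCurve g (2 * g + 2)) (Ω : Set (ℝ × ℝ)), IsOpen Ω → IsPreconnected Ω →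
      ∀ (c ct : ℕ → ℂ) (F G H Ft Gt Ht : ℕ → MvPolynomial (ℕ ⊕ ℕ) ℂ),
      IsAKNSSeq c F G H → IsAKNSSeq ct Ft Gt Ht →
      ∀ p q : ℝ → ℝ → ℂ, IsStationaryAKNS g C.E Ω F G H p q →
      (∀ (μ y : Fin g → ℝ → ℝ → ℂ) (hy : OnCurve C.E Ω μ y),
        (∀ x t, (x, t) ∈ Ω → q x t ≠ 0) →
        (∀ x t, (x, t) ∈ Ω → ∀ z : ℂ,
          aknsPoly F p q g z x t = -Complex.I * q x t * ∏ j, (z - μ j x t)) →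
        (∀ x t, (x, t) ∈ Ω → Function.Injective (fun j => μ j x t)) →
        DubrovinX C.E Ω μ y →
        DubrovinT C.E Ω μ y (fun j x t => 2 * aknsPoly Ft p q r (μ j x t) x t / q x t) →
        (∀ x t, (x, t) ∈ Ω → ∀ j, aknsPoly Ft p q r (μ j x t) x t = -Complex.I * q x t *
          ∑ k ∈ Finset.range (min r g + 1), dCoeff C.E ct r k * Phi k j (fun l => μ l x t)) ∧
        Linearizes C Ω μ y hy (rateX C) (rateT C (-2 * Complex.I) (dCoeff C.E ct r))) ∧
      (∀ (ν y : Fin g → ℝ → ℝ → ℂ) (hy : OnCurve C.E Ω ν y),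
        (∀ x t, (x, t) ∈ Ω → p x t ≠ 0) →
        (∀ x t, (x, t) ∈ Ω → ∀ z : ℂ,
          aknsPoly H p q g z x t = Complex.I * p x t * ∏ j, (z - ν j x t)) →
        (∀ x t, (x, t) ∈ Ω → Function.Injective (fun j => ν j x t)) →
        DubrovinX C.E Ω ν y →
        DubrovinT C.E Ω ν y (fun j x t => -2 * aknsPoly Ht p q r (ν j x t) x t / p x t) →
        (∀ x t, (x, t) ∈ Ω → ∀ j, aknsPoly Ht p q r (ν j x t) x t = Complex.I * p x t *
          ∑ k ∈ Finset.range (min r g + 1), dCoeff C.E ct r k * Phi k j (fun l => ν l x t)) ∧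
        Linearizes C Ω ν y hy (rateX C) (rateT C (-2 * Complex.I) (dCoeff C.E ct r)))) ∧
    -- Toda, at a fixed lattice site
    (∀ (C : MarkedCurve g (2 * g + 2)) (J : Set ℝ), IsOpen J → IsPreconnected J →
      ∀ (c ct : ℕ → ℂ) (F G Ft Gt : ℕ → MvPolynomial (ℤ ⊕ ℤ) ℂ),
      IsTodaSeq c F G → IsTodaSeq ct Ft Gt →
      ∀ a b : ℤ → ℝ → ℂ, IsStationaryToda g C.E J F G a b →
      ∀ (n : ℤ) (μ y : Fin g → ℝ → ℂ) (hy : OnCurveOne C.E J μ y),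
      (∀ t ∈ J, ∀ z : ℂ, todaF F a b g z n t = ∏ j, (z - μ j t)) →
      (∀ t ∈ J, Function.Injective (fun j => μ j t)) →
      (∀ t ∈ J, ∀ j, MovesAt C.E (μ j) (y j)
        (2 * todaF Ft a b r (μ j t) n t / diffProd (fun l => μ l t) j) t) →
      (∀ t ∈ J, ∀ j, todaF Ft a b r (μ j t) n t =
        ∑ k ∈ Finset.range (min r g + 1), dCoeff C.E ct r k * Phi k j (fun l => μ l t)) ∧
      LinearizesOne C J μ y hy (rateT C 2 (dCoeff C.E ct r))) ∧
    -- combined sine-Gordon and mKdV, the divisors of the zeros of F and of H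
    (∀ (C : MarkedCurve g (2 * g + 1)) (Ω : Set (ℝ × ℝ)), IsOpen Ω → IsPreconnected Ω →
      ∀ (c ct : ℕ → ℂ) (f ft : ℕ → MvPolynomial ℕ ℂ), IsKdVSeq c f → IsKdVSeq ct ft →
      ∀ (α β αt βt : ℂ) (u : ℝ → ℝ → ℂ), IsStationarySG g C.E Ω f α β u →
      (∀ (μ y : Fin g → ℝ → ℝ → ℂ) (hy : OnCurve C.E Ω μ y),
        (∀ x t, (x, t) ∈ Ω → ∀ z : ℂ, sgPoly 1 f α u g z x t = ∏ j, (z - μ j x t)) →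
        (∀ x t, (x, t) ∈ Ω → Function.Injective (fun j => μ j x t)) →
        DubrovinX C.E Ω μ y →
        DubrovinT C.E Ω μ y (fun j x t => 2 * (sgPoly 1 ft αt u r (μ j x t) x t / μ j x t)) →
        (∀ x t, (x, t) ∈ Ω → ∀ j, sgPoly 1 ft αt u r (μ j x t) x t / μ j x t =
          ∑ k ∈ Finset.range g,
            sgCoeff C.E ct (αt / α) g r k * Phi k j (fun l => μ l x t)) ∧
        Linearizes C Ω μ y hy (rateX C) (rateT C 2 (sgCoeff C.E ct (αt / α) g r))) ∧
      (∀ (ν y : Fin g → ℝ → ℝ → ℂ) (hy : OnCurve C.E Ω ν y),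
        (∀ x t, (x, t) ∈ Ω → ∀ z : ℂ, sgPoly (-1) f β u g z x t = ∏ j, (z - ν j x t)) →
        (∀ x t, (x, t) ∈ Ω → Function.Injective (fun j => ν j x t)) →
        DubrovinX C.E Ω ν y →
        DubrovinT C.E Ω ν y
          (fun j x t => 2 * (sgPoly (-1) ft βt u r (ν j x t) x t / ν j x t)) →
        (∀ x t, (x, t) ∈ Ω → ∀ j, sgPoly (-1) ft βt u r (ν j x t) x t / ν j x t =
          ∑ k ∈ Finset.range g,
            sgCoeff C.E ct (βt / β) g r k * Phi k j (fun l => ν l x t)) ∧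
        Linearizes C Ω ν y hy (rateX C) (rateT C 2 (sgCoeff C.E ct (βt / β) g r)))) := by

  refine ⟨?_, ?_, ?_, ?_⟩
  · intro C Ω hΩ hconn c ct f ft _ hft V h μ y hy hμ hinj hx ht
    obtain ⟨_, _, hbr⟩ := exists_branchPoints_odd C.E_injective
    have key := h.eval_at_root hΩ hft hμ r
    refine ⟨key, C.linearizes hbr hΩ hconn hy hinj hx ht fun x t hxt j => ?_⟩
    simp only [key x t hxt j, sum_range_min_dCoeff]
  · intro C Ω hΩ hconn c ct F G H Ft Gt Ht hs hst p q h
    obtain ⟨_, _, hbr⟩ := exists_branchPoints_even C.E_injective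
    constructor
    · intro μ y hy hq hμ hinj hx ht
      have key := fun x t (hxt : (x, t) ∈ Ω) j => (h.eval_at_root hΩ hs hst r x t hxt
        (-Complex.I * q x t) (fun l => μ l x t) j).1 (hμ x t hxt)
        (mul_ne_zero (neg_ne_zero.2 Complex.I_ne_zero) (hq x t hxt))
      refine ⟨key, C.linearizes hbr hΩ hconn hy hinj hx ht fun x t hxt j => ?_⟩
      have h0 := hq x t hxt
      simp only [key x t hxt j, sum_range_min_dCoeff]
      field_simp
    · intro μ y hy hp hμ hinj hx ht
      have key := fun x t (hxt : (x, t) ∈ Ω) j => (h.eval_at_root hΩ hs hst r x t hxt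
        (Complex.I * p x t) (fun l => μ l x t) j).2 (hμ x t hxt)
        (mul_ne_zero Complex.I_ne_zero (hp x t hxt))
      refine ⟨key, C.linearizes hbr hΩ hconn hy hinj hx ht fun x t hxt j => ?_⟩
      have h0 := hp x t hxt
      simp only [key x t hxt j, sum_range_min_dCoeff]
      field_simp
  · intro C J hJ hconn c ct F G Ft Gt hs hst a b h n μ y hy hμ hinj ht
    obtain ⟨_, _, hbr⟩ := exists_branchPoints_even C.E_injective
    have key := h.eval_at_root hs hst n hμ r
    refine ⟨key, C.linearizesOne hbr hJ hconn ⟨hinj, hy, fun t htJ j => ?_⟩⟩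
    have hm := ht t htJ j
    rwa [key t htJ j, sum_range_min_dCoeff] at hm
  · intro C Ω hΩ hconn c ct f ft _ hft α β αt βt u h
    obtain ⟨_, _, hbr⟩ := exists_branchPoints_odd C.E_injective
    constructor
    · intro μ y hy hμ hinj hx ht
      have key : ∀ x t, (x, t) ∈ Ω → ∀ j, sgPoly 1 ft αt u r (μ j x t) x t / μ j x t =
          ∑ k ∈ Finset.range g,
            sgCoeff C.E ct (αt / α) g r k * Phi k j (fun l => μ l x t) := by
        intro x t hxt j
        refine sg_eval_at_root (isOpen_slice hΩ t) C.E hft (one_pow 2)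
          (left_ne_zero_of_mul (h.mul_ne_zero C.E_injective hxt))
          (fun x hx => h.smooth x t hx) (G := fun z x => sgG f u g z x t)
          (Q := fun z x => sgPoly (-1) f β u g z x t) (fun x hx z => ?_) (fun x hx z => ?_)
          (fun x hx z => h.curve x t hx z) (μ := fun j x => μ j x t)
          (fun x hx => hμ x t hx) hxt r j
        · rw [h.zeroCurvature_F x t hx z]
          ring
        · linear_combination -(1 / 2) * h.zeroCurvature_G x t hx z
      refine ⟨key, C.linearizes hbr hΩ hconn hy hinj hx ht fun x t hxt j => ?_⟩
      simp only [key x t hxt j]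
    · intro μ y hy hμ hinj hx ht
      have key : ∀ x t, (x, t) ∈ Ω → ∀ j, sgPoly (-1) ft βt u r (μ j x t) x t / μ j x t =
          ∑ k ∈ Finset.range g,
            sgCoeff C.E ct (βt / β) g r k * Phi k j (fun l => μ l x t) := by
        intro x t hxt j
        refine sg_eval_at_root (isOpen_slice hΩ t) C.E hft (neg_one_sq)
          (right_ne_zero_of_mul (h.mul_ne_zero C.E_injective hxt))
          (fun x hx => h.smooth x t hx) (G := fun z x => sgG f u g z x t)
          (Q := fun z x => sgPoly 1 f α u g z x t) (fun x hx z => ?_) (fun x hx z => ?_)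
          (fun x hx z => ?_) (μ := fun j x => μ j x t)
          (fun x hx => hμ x t hx) hxt r j
        · rw [h.zeroCurvature_H x t hx z]
          ring
        · linear_combination 1 / 2 * h.zeroCurvature_G x t hx z
        · rw [← h.curve x t hx z]
          ring
      refine ⟨key, C.linearizes hbr hΩ hconn hy hinj hx ht fun x t hxt j => ?_⟩
      simp only [key x t hxt j]
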